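/- Let $\mathfrak g$ be a finite-dimensional simple Lie algebra over $\mathbb C$, $(e,h,f)$ an $\mathfrak{sl}_2$-triple in $\mathfrak g$, and $(\cdot,\cdot)$ the symmetric invariant bilinear form on $\mathfrak g$ with $(e,f)=1$ and $(h,h)=2$. For $j\in\frac12\mathbb Z$ let $\mathfrak g(j)$ be the eigenspace of $\mathrm{ad}\,\frac h2$ with eigenvalue $j$, and put $\mathfrak n=\bigoplus_{j>0}\mathfrak g(j)$, $\mathfrak m=\bigoplus_{j\ge1}\mathfrak g(j)$, so that $\mathfrak n/\mathfrak m\cong\mathfrak g(\frac12)$. Let $\{u_\alpha\}_{\alpha\in S}$ be a basis of $\mathfrak n$ of eigenvectors, $u_\alpha\in\mathfrak g(j_\alpha)$, with dual basis $\{v^\alpha\}$ of $\mathfrak n^*$, and let $\mathfrak g_f$ be the centralizer of $f$. Let $k\in\mathbb C$. Let $R=\mathbb C[\partial]\otimes(\mathfrak g\oplus\phi_{\mathfrak n}\oplus\phi^{\mathfrak n^*}\oplus\Phi_{\mathfrak n/\mathfrak m})$, where $\mathfrak g$ and $\Phi_{\mathfrak n/\mathfrak m}$ (a copy of $\mathfrak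 n/\mathfrak m$) are even and $\phi_{\mathfrak n}$, $\phi^{\mathfrak n^*}$ (copies of $\mathfrak n$, $\mathfrak n^*$) are odd. The symmetric superalgebra $S(R)$ is a differential superalgebra with even derivation $\partial$, and carries the Poisson $\lambda$-bracket determined by sesquilinearity, skewsymmetry, the Leibniz rules and $$\{a_\lambda b\}=[a,b]+\lambda k(a,b),\qquad \{\phi_x{}_\lambda\phi^\theta\}=\{\phi^\theta{}_\lambda\phi_x\}=\theta(x),\qquad \{\Phi_{[x]}{}_\lambda\Phi_{[y]}\}=(f,[\bar x,\bar y])$$ for $a,b\in\mathfrak g$, $x,y\in\mathfrak n$, $\theta\in\mathfrak n^*$, where $\bar x$ is the $\mathfrak g(\frac12)$-component of $x$, all other brackets of generators being $0$. For $x\in\mathfrak g$ write $\phi_x:=\phi_{\pi x}$ and $\Phi_{[x]}:=\Phi_{[\pi x]}$, with $\pi:\mathfrak g\to\mathfrak n$ the projection along $\bigoplus_{j\le0}\mathfrak g(j)$. Put $$d=\sum_{\alpha\in S}\phi^{v^\alpha}\big(u_\alpha+(f,u_\alpha)+\Phi_{[u_\alpha]}\big)+\tfrac12\sum_{\alpha,\beta\in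 S}\phi^{v^\alpha}\phi^{v^\beta}\phi_{[u_\beta,u_\alpha]},\qquad d_{(0)}=\{d_\lambda\,\cdot\,\}|_{\lambda=0},$$ $$J_a=a+\sum_{\alpha\in S}\phi^{v^\alpha}\phi_{[u_\alpha,a]}\quad(a\in\mathfrak g).$$ Let $r_-=\{J_a: a\in\bigoplus_{j\le0}\mathfrak g(j)\}\oplus\phi^{\mathfrak n^*}\oplus\Phi_{\mathfrak n/\mathfrak m}$ and $R_-=\mathbb C[\partial]\otimes r_-$. The differential $d_{(0)}$ preserves the differential subalgebra $S(R_-)\subset S(R)$ generated by $r_-$; let $d_-$ be its restriction and $H(S(R_-),d_-)=\ker d_- /\operatorname{im} d_-$, a differential algebra. Give $S(R_-)$ the multiplicative gradings $$\deg J_a=-j+\tfrac12\ (a\in\mathfrak g(j),\,j\le0),\quad \deg\phi^{v^\alpha}=j_\alpha-\tfrac12,\quad \deg\Phi_{[x]}=\deg\partial=0,$$ $$\operatorname{charge}J_a=\operatorname{charge}\Phi_{[x]}=\operatorname{charge}\partial=0,\quad \operatorname{charge}\phi^\theta=1,$$ and let $F_p$, $p\in\frac12\mathbb Z$, be the span of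 the elements of degree at most $p$. **Proposition.** Let $\{u_i\}_{i\in I}$ be a basis of $\mathfrak g_f$ consisting of eigenvectors of $\mathrm{ad}\,\frac h2$, with $u_i\in\mathfrak g(\frac{n_i}2)$, $n_i\in\mathbb Z$. Then there are elements $A_{u_i}\in F_{-n_i/2}$ of charge $0$ such that every $J_{u_i}+A_{u_i}$ lies in $\ker d_-$ and the classes of the $J_{u_i}+A_{u_i}$, $i\in I$, generate $H(S(R_-),d_-)$ as a differential algebra. -/

import Mathlib

open Polynomial TensorProduct

/-- A complex vector superspace, given by its parity involution: `x` is even when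
`parity x = x` and odd when `parity x = -x`. -/
class SuperSpace (M : Type*) [AddCommGroup M] [Module ℂ M] where
  parity : M →ₗ[ℂ] M
  parity_parity : ∀ x, parity (parity x) = x

namespace SuperSpace

/-- `E × O` as a superspace with even part `E` and odd part `O`. -/
instance prod (E O : Type*) [AddCommGroup E] [Module ℂ E] [AddCommGroup O] [Module ℂ O] :
    SuperSpace (E × O) where
  parity := LinearMap.prodMap LinearMap.id (-LinearMap.id)
  parity_parity x := by ext <;> simp

/-- `ℂ[∂] ⊗ M`, where `∂` is even; the variable of `ℂ[X]` plays the role of `∂`. -/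
noncomputable instance tensor (M : Type*) [AddCommGroup M] [Module ℂ M] [SuperSpace M] :
    SuperSpace (ℂ[X] ⊗[ℂ] M) where
  parity := LinearMap.lTensor _ parity
  parity_parity x := by
    rw [← LinearMap.comp_apply, ← LinearMap.lTensor_comp,
      show (parity : M →ₗ[ℂ] M) ∘ₗ parity = LinearMap.id from LinearMap.ext parity_parity]
    simp

end SuperSpace

open SuperSpace (parity parity_parity)

/-- Supercommutativity: `x y = y x` if `x` is even, `x y = - y x` if `x` and `y` are odd. -/
inductive SuperSym.Rel (M : Type*) [AddCommGroup M] [Module ℂ M] [SuperSpace M] :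
    TensorAlgebra ℂ M → TensorAlgebra ℂ M → Prop
  | even (x y : M) (hx : parity x = x) :
      Rel M (TensorAlgebra.ι ℂ x * TensorAlgebra.ι ℂ y) (TensorAlgebra.ι ℂ y * TensorAlgebra.ι ℂ x)
  | odd (x y : M) (hx : parity x = -x) (hy : parity y = -y) :
      Rel M (TensorAlgebra.ι ℂ x * TensorAlgebra.ι ℂ y)
        (-(TensorAlgebra.ι ℂ y * TensorAlgebra.ι ℂ x))

/-- The symmetric superalgebra of a superspace: the tensor algebra modulo supercommutativity. -/
def SuperSym (M : Type*) [AddCommGroup M] [Module ℂ M] [SuperSpace M] : Type _ :=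
  RingQuot (SuperSym.Rel M)

namespace SuperSym

variable {M : Type*} [AddCommGroup M] [Module ℂ M] [SuperSpace M]

noncomputable instance : Ring (SuperSym M) := inferInstanceAs (Ring (RingQuot (SuperSym.Rel M)))
noncomputable instance : Algebra ℂ (SuperSym M) :=
  inferInstanceAs (Algebra ℂ (RingQuot (SuperSym.Rel M)))

/-- The canonical map from a superspace to its symmetric superalgebra. -/
noncomputable def ι : M →ₗ[ℂ] SuperSym M :=
  (RingQuot.mkAlgHom ℂ (SuperSym.Rel M)).toLinearMap ∘ₗ TensorAlgebra.ι ℂ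

theorem ι_even (x y : M) (hx : parity x = x) : ι x * ι y = ι y * ι x := by
  have := RingQuot.mkAlgHom_rel ℂ (Rel.even x y hx)
  rw [map_mul, map_mul] at this
  exact this

theorem ι_odd (x y : M) (hx : parity x = -x) (hy : parity y = -y) :
    ι x * ι y = -(ι y * ι x) := by
  have := RingQuot.mkAlgHom_rel ℂ (Rel.odd x y hx hy)
  rw [map_neg, map_mul, map_mul] at this
  exact this

section lift
variable {B : Type*} [Ring B] [Algebra ℂ B]

/-- The universal property of the symmetric superalgebra. -/
noncomputable def lift (F : M →ₗ[ℂ] B)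
    (he : ∀ x y, parity x = x → F x * F y = F y * F x)
    (ho : ∀ x y, parity x = -x → parity y = -y → F x * F y = -(F y * F x)) :
    SuperSym M →ₐ[ℂ] B :=
  RingQuot.liftAlgHom ℂ ⟨TensorAlgebra.lift ℂ F, by
    intro a b h
    cases h with
    | even x y hx => simpa using he x y hx
    | odd x y hx hy => simpa using ho x y hx hy⟩

theorem lift_ι (F : M →ₗ[ℂ] B) (he) (ho) (x : M) : lift F he ho (ι x) = F x := by
  have := RingQuot.liftAlgHom_mkAlgHom_apply ℂ (s := Rel M) (TensorAlgebra.lift ℂ F)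
    (by
      intro a b h
      cases h with
      | even x y hx => simpa using he x y hx
      | odd x y hx hy => simpa using ho x y hx hy) (TensorAlgebra.ι ℂ x)
  rw [TensorAlgebra.lift_ι_apply] at this
  exact this

end lift

@[elab_as_elim]
theorem induction {P : SuperSym M → Prop} (hc : ∀ c : ℂ, P (algebraMap ℂ _ c))
    (hι : ∀ x, P (ι x)) (hm : ∀ a b, P a → P b → P (a * b)) (ha : ∀ a b, P a → P b → P (a + b))
    (a : SuperSym M) : P a := by
  obtain ⟨a, rfl⟩ := RingQuot.mkAlgHom_surjective ℂ (Rel M) a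
  induction a using TensorAlgebra.induction with
  | algebraMap r => rw [AlgHom.commutes]; exact hc r
  | ι x => exact hι x
  | mul a b h1 h2 => rw [map_mul]; exact hm _ _ h1 h2
  | add a b h1 h2 => rw [map_add]; exact ha _ _ h1 h2

/-- The parity automorphism of the symmetric superalgebra: `a` is even when `sigma a = a` and
odd when `sigma a = -a`. -/
noncomputable def sigma : SuperSym M →ₐ[ℂ] SuperSym M :=
  lift (ι ∘ₗ parity)
    (fun x y hx => by simp only [LinearMap.comp_apply]; rw [hx]; exact ι_even _ _ hx)
    (fun x y hx hy => by
      simp only [LinearMap.comp_apply]; rw [hx, hy]; simpa using ι_odd x y hx hy)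

theorem sigma_ι (x : M) : sigma (ι x) = ι (parity x) := lift_ι _ _ _ x

theorem sigma_sigma (a : SuperSym M) : sigma (sigma a) = a := by
  induction a using induction with
  | hc c => simp
  | hι x => rw [sigma_ι, sigma_ι, parity_parity]
  | hm a b ha hb => rw [map_mul, map_mul, ha, hb]
  | ha a b ha hb => rw [map_add, map_add, ha, hb]

theorem split (x : M) : x = (2⁻¹ : ℂ) • (x + parity x) + (2⁻¹ : ℂ) • (x - parity x) := by
  module

theorem parity_evenPart (x : M) :
    parity ((2⁻¹ : ℂ) • (x + parity x)) = (2⁻¹ : ℂ) • (x + parity x) := by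
  rw [map_smul, map_add, parity_parity, add_comm]

theorem parity_oddPart (x : M) :
    parity ((2⁻¹ : ℂ) • (x - parity x)) = -((2⁻¹ : ℂ) • (x - parity x)) := by
  rw [map_smul, map_sub, parity_parity]; module

theorem even_comm (x : M) (hx : parity x = x) (a : SuperSym M) : ι x * a = a * ι x := by
  induction a using induction with
  | hc c => exact (Algebra.commutes c _).symm
  | hι y => exact ι_even x y hx
  | hm a b ha hb => rw [← mul_assoc, ha, mul_assoc, hb, mul_assoc]
  | ha a b ha hb => rw [mul_add, add_mul, ha, hb]

theorem odd_comm (x : M) (hx : parity x = -x) (a : SuperSym M) : a * ι x = ι x * sigma a := by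
  induction a using induction with
  | hc c => simpa using Algebra.commutes c _
  | hι y =>
    rw [sigma_ι]
    have h0 := ι_even _ x (parity_evenPart y)
    have h1 := ι_odd _ x (parity_oddPart y) hx
    rw [split y, map_add, add_mul, h0, h1, map_add parity, parity_evenPart, parity_oddPart,
      map_add, map_neg, mul_add, mul_neg]
  | hm a b ha hb => rw [mul_assoc, hb, ← mul_assoc, ha, mul_assoc, map_mul]
  | ha a b ha hb => rw [map_add, mul_add, add_mul, ha, hb]

/-- `j : SuperSym M → B` makes `B`, with parity automorphism `s`, a supercommutative extension. -/
structure IsSuperExt {B : Type*} [Ring B] [Algebra ℂ B]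
    (j : SuperSym M →ₐ[ℂ] B) (s : B →ₐ[ℂ] B) : Prop where
  invol : ∀ b, s (s b) = b
  compat : ∀ a, s (j a) = j (sigma a)
  even : ∀ x b, parity x = x → j (ι x) * b = b * j (ι x)
  odd : ∀ x b, parity x = -x → b * j (ι x) = j (ι x) * s b

/-- The sign of the parity `ε`, where `true` means odd. -/
def sgn (ε : Bool) : ℂ := if ε then -1 else 1

/-- `a ↦ (-1)^(ε p(a)) a`. -/
noncomputable def twist (ε : Bool) : SuperSym M →ₐ[ℂ] SuperSym M :=
  if ε then sigma else AlgHom.id ℂ _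

section deriv

variable {B : Type*} [Ring B] [Algebra ℂ B] {j : SuperSym M →ₐ[ℂ] B} {s : B →ₐ[ℂ] B}

/-- The part of parity `ε` of the linear map `D`; it is `D` itself if `D` has parity `ε`. -/
noncomputable def homPart (s : B →ₐ[ℂ] B) (ε : Bool) (D : M →ₗ[ℂ] B) : M →ₗ[ℂ] B :=
  (2⁻¹ : ℂ) • (D + sgn ε • (s.toLinearMap ∘ₗ D ∘ₗ parity))

theorem homPart_parity (H : IsSuperExt j s) (ε : Bool) (D : M →ₗ[ℂ] B) (x : M) :
    s (homPart s ε D x) = sgn ε • homPart s ε D (parity x) := by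
  cases ε <;> simp [homPart, sgn, H.invol, parity_parity, add_comm, ← sub_eq_add_neg]

/-- An auxiliary upper triangular matrix encoding a super-derivation. -/
noncomputable def superDerivMat (j : SuperSym M →ₐ[ℂ] B) (s : B →ₐ[ℂ] B) (ε : Bool) (D : M →ₗ[ℂ] B) :
    M →ₗ[ℂ] Matrix (Fin 2) (Fin 2) B where
  toFun x := !![j (twist ε (ι x)), homPart s ε D x; 0, j (ι x)]
  map_add' x y := by ext i k; fin_cases i <;> fin_cases k <;> simp
  map_smul' c x := by ext i k; fin_cases i <;> fin_cases k <;> simp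

/-- An auxiliary algebra morphism, with `superDeriv` as its off-diagonal entry. -/
noncomputable def superDerivHom (H : IsSuperExt j s) (ε : Bool) (D : M →ₗ[ℂ] B) :
    SuperSym M →ₐ[ℂ] Matrix (Fin 2) (Fin 2) B :=
  lift (superDerivMat j s ε D)
    (by
      intro x y hx
      have h1 := homPart_parity H ε D x
      rw [hx] at h1
      have hc : j (ι x) * j (ι y) = j (ι y) * j (ι x) := H.even _ _ hx
      have h2 := H.even x (homPart s ε D y) hx
      have h0 := H.even _ (homPart s ε D x) (parity_evenPart y)
      have h3 := H.odd _ (homPart s ε D x) (parity_oddPart y)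
      rw [h1] at h3
      cases ε
      · have h4 : homPart s false D x * j (ι y) = j (ι y) * homPart s false D x := by
          rw [split y, map_add ι, map_add j, mul_add, add_mul, h3, h0]; simp [sgn]
        ext i k; fin_cases i <;> fin_cases k <;>
          simp [superDerivMat, Matrix.mul_apply, Fin.sum_univ_two, twist, hc, h2, h4, add_comm]
      · have h4 : homPart s true D x * j (ι y) = j (ι (parity y)) * homPart s true D x := by
          rw [split y, map_add ι, map_add j, mul_add, h3, ← h0, map_add parity, parity_evenPart,
            parity_oddPart, map_add ι, map_add j, add_mul]; simp [sgn]
        have hc' : j (ι x) * j (ι (parity y)) = j (ι (parity y)) * j (ι x) := H.even _ _ hx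
        ext i k; fin_cases i <;> fin_cases k <;>
          simp [superDerivMat, Matrix.mul_apply, Fin.sum_univ_two, twist, sigma_ι, hx, hc, hc', h2, h4,
            add_comm])
    (by
      intro x y hx hy
      have h1 := homPart_parity H ε D x
      have h2 := homPart_parity H ε D y
      have hc : j (ι x) * j (ι y) = -(j (ι y) * j (ι x)) := by
        rw [← map_mul, ι_odd x y hx hy, map_neg, map_mul]
      have h3 := H.odd y (homPart s ε D x) hy
      have h4 := H.odd x (homPart s ε D y) hx
      rw [h1, hx] at h3
      rw [h2, hy] at h4
      cases ε
      · ext i k; fin_cases i <;> fin_cases k <;>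
          simp [superDerivMat, Matrix.mul_apply, Fin.sum_univ_two, twist, hc, h3, h4, sgn]
      · ext i k; fin_cases i <;> fin_cases k <;>
          simp [superDerivMat, Matrix.mul_apply, Fin.sum_univ_two, twist, hc, h3, h4, sgn, sigma_ι,
            hx, hy])

/-- The unique super-derivation `T` of parity `ε` with `T (ι x) = D x` (where `D` is replaced by
its part of parity `ε`, which is `D` in all applications):
`T (a b) = T a * b + (-1)^(ε p(a)) a * T b`, see `superDeriv_mul`, `superDeriv_ι` and
`superDeriv_unique`. -/
noncomputable def superDeriv (H : IsSuperExt j s) (ε : Bool) (D : M →ₗ[ℂ] B) :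
    SuperSym M →ₗ[ℂ] B :=
  Matrix.entryLinearMap ℂ B 0 1 ∘ₗ (superDerivHom H ε D).toLinearMap

theorem superDeriv_ι (H : IsSuperExt j s) (ε : Bool) (D : M →ₗ[ℂ] B) (x : M) :
    superDeriv H ε D (ι x) = homPart s ε D x := by
  simp [superDeriv, superDerivHom, lift_ι, superDerivMat]

theorem superDerivHom_apply (H : IsSuperExt j s) (ε : Bool) (D : M →ₗ[ℂ] B) (a : SuperSym M) :
    superDerivHom H ε D a = !![j (twist ε a), superDeriv H ε D a; 0, j a] := by
  have key : superDerivHom H ε D a 0 0 = j (twist ε a) ∧ superDerivHom H ε D a 1 0 = 0 ∧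
      superDerivHom H ε D a 1 1 = j a := by
    induction a using induction with
    | hc c => simp [Matrix.algebraMap_matrix_apply]
    | hι x => simp [superDerivHom, lift_ι, superDerivMat]
    | hm a b ha hb => simp [Matrix.mul_apply, Fin.sum_univ_two, ha, hb]
    | ha a b ha hb => simp [ha, hb]
  ext i k; fin_cases i <;> fin_cases k <;> simp [key, superDeriv]

theorem superDeriv_mul (H : IsSuperExt j s) (ε : Bool) (D : M →ₗ[ℂ] B) (a b : SuperSym M) :
    superDeriv H ε D (a * b) = superDeriv H ε D a * j b + j (twist ε a) * superDeriv H ε D b := by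
  have : superDerivHom H ε D (a * b) 0 1 = (superDerivHom H ε D a * superDerivHom H ε D b) 0 1 := by
    rw [map_mul]
  rw [superDerivHom_apply H ε D a, superDerivHom_apply H ε D b] at this
  simpa [superDeriv, Matrix.mul_apply, Fin.sum_univ_two, add_comm] using this

theorem superDeriv_algebraMap (H : IsSuperExt j s) (ε : Bool) (D : M →ₗ[ℂ] B) (c : ℂ) :
    superDeriv H ε D (algebraMap ℂ _ c) = 0 := by
  simp [superDeriv, Matrix.algebraMap_matrix_apply]

end deriv

theorem isSuperExt_id : IsSuperExt (AlgHom.id ℂ (SuperSym M)) sigma where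
  invol := sigma_sigma
  compat _ := rfl
  even x b hx := even_comm x hx b
  odd x b hx := odd_comm x hx b

theorem isSuperExt_C : IsSuperExt (M := M) Polynomial.CAlgHom (Polynomial.mapAlgHom sigma) where
  invol P := by ext n; simp [sigma_sigma]
  compat a := by simp
  even x P hx := by ext n; simp [even_comm x hx]
  odd x P hx := by ext n; simp [odd_comm x hx]

section deriv

variable {B : Type*} [Ring B] [Algebra ℂ B] {j : SuperSym M →ₐ[ℂ] B} {s : B →ₐ[ℂ] B}

theorem superDeriv_unique (H : IsSuperExt j s) (ε : Bool) (D : M →ₗ[ℂ] B) (T : SuperSym M →ₗ[ℂ] B)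
    (h1 : T 1 = 0)
    (hmul : ∀ a b, T (a * b) = T a * j b + j (twist ε a) * T b)
    (hι : ∀ x, T (ι x) = homPart s ε D x) : T = superDeriv H ε D := by
  ext a
  induction a using induction with
  | hc c => rw [superDeriv_algebraMap, Algebra.algebraMap_eq_smul_one, map_smul, h1, smul_zero]
  | hι x => rw [hι, superDeriv_ι]
  | hm a b ha hb => rw [hmul, superDeriv_mul, ha, hb]
  | ha a b ha hb => rw [map_add, map_add, ha, hb]

theorem superDeriv_one (H : IsSuperExt j s) (ε : Bool) (D : M →ₗ[ℂ] B) : superDeriv H ε D 1 = 0 := by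
  simpa using superDeriv_algebraMap H ε D 1

/-- `superDeriv` as a linear function of its values on generators. -/
noncomputable def superDerivL (H : IsSuperExt j s) (ε : Bool) :
    (M →ₗ[ℂ] B) →ₗ[ℂ] SuperSym M →ₗ[ℂ] B where
  toFun D := superDeriv H ε D
  map_add' D D' := by
    symm
    apply superDeriv_unique
    · simp [superDeriv_one]
    · intro a b; simp only [LinearMap.add_apply, superDeriv_mul]; noncomm_ring
    · intro x; simp only [LinearMap.add_apply, superDeriv_ι]; simp [homPart]; module
  map_smul' c D := by
    symm
    apply superDeriv_unique
    · simp [superDeriv_one]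
    · intro a b; simp [superDeriv_mul]
    · intro x
      simp only [LinearMap.smul_apply, superDeriv_ι, RingHom.id_apply]; simp [homPart]; module

theorem superDeriv_parity (H : IsSuperExt j s) (ε : Bool) (D : M →ₗ[ℂ] B) (a : SuperSym M) :
    s (superDeriv H ε D a) = sgn ε • superDeriv H ε D (sigma a) := by
  induction a using induction with
  | hc c => simp [superDeriv_algebraMap]
  | hι x => rw [sigma_ι, superDeriv_ι, superDeriv_ι, homPart_parity H]
  | hm a b ha hb =>
    have : sigma (twist ε a) = twist ε (sigma a) := by cases ε <;> simp [twist]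
    rw [superDeriv_mul, map_mul sigma, superDeriv_mul, map_add, map_mul, map_mul, ha, hb, H.compat, H.compat, this]
    simp
  | ha a b ha hb => simp only [map_add, ha, hb, smul_add]

end deriv

/-- The projection to the even part. -/
noncomputable def evenPart : M →ₗ[ℂ] M := (2⁻¹ : ℂ) • (LinearMap.id + parity)
/-- The projection to the odd part. -/
noncomputable def oddPart : M →ₗ[ℂ] M := (2⁻¹ : ℂ) • (LinearMap.id - parity)

end SuperSym

namespace PVA
open SuperSym

variable {V : Type*} [AddCommGroup V] [Module ℂ V] [SuperSpace V]

/-- Multiplication by `∂` on `ℂ[∂] ⊗ V`. -/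
noncomputable def delGen : ℂ[X] ⊗[ℂ] V →ₗ[ℂ] ℂ[X] ⊗[ℂ] V :=
  LinearMap.rTensor V (LinearMap.mulLeft ℂ (X : ℂ[X]))

/-- The even derivation `∂` of `S(ℂ[∂] ⊗ V)` extending multiplication by `∂`. -/
noncomputable def del : SuperSym (ℂ[X] ⊗[ℂ] V) →ₗ[ℂ] SuperSym (ℂ[X] ⊗[ℂ] V) :=
  superDeriv isSuperExt_id false (ι ∘ₗ delGen)

theorem parity_delGen (x : ℂ[X] ⊗[ℂ] V) : parity (delGen x) = delGen (parity x) := by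
  induction x with
  | zero => simp
  | tmul P v => simp [delGen, parity]
  | add x y hx hy => simp only [map_add, hx, hy]

theorem del_ι (x : ℂ[X] ⊗[ℂ] V) : del (ι x) = ι (delGen x) := by
  rw [del, superDeriv_ι]
  simp [homPart, sgn, sigma_ι, parity_delGen, parity_parity]
  module

theorem del_mul (a b : SuperSym (ℂ[X] ⊗[ℂ] V)) : del (a * b) = del a * b + a * del b :=
  superDeriv_mul _ _ _ a b

theorem sigma_del (a : SuperSym (ℂ[X] ⊗[ℂ] V)) : sigma (del a) = del (sigma a) := by
  have := superDeriv_parity isSuperExt_id false (ι ∘ₗ delGen (V := V)) a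
  rw [show sgn false = 1 from rfl, one_smul] at this
  exact this

/-- `λ + ∂` on `S(ℂ[∂] ⊗ V)[λ]`, with `∂` acting on the coefficients. -/
noncomputable def lamDel : (SuperSym (ℂ[X] ⊗[ℂ] V))[X] →ₗ[ℂ] (SuperSym (ℂ[X] ⊗[ℂ] V))[X] :=
  LinearMap.mulLeft ℂ X + lsum fun n => ((monomial n).restrictScalars ℂ) ∘ₗ del

/-- The substitution `λ ↦ -λ-∂`, with `∂` moved to the left and acting on the coefficients:
`λ^n p ↦ (-λ-∂)^n p`. -/
noncomputable def negLamDel : (SuperSym (ℂ[X] ⊗[ℂ] V))[X] →ₗ[ℂ] (SuperSym (ℂ[X] ⊗[ℂ] V))[X] :=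
  lsum fun n => ((-lamDel) ^ n) ∘ₗ CAlgHom.toLinearMap

section bracket

variable (β : V →ₗ[ℂ] V →ₗ[ℂ] (SuperSym (ℂ[X] ⊗[ℂ] V))[X])

/-- `{P(∂) v _λ Q(∂) w} = P(-λ) Q(λ+∂) {v _λ w}`, with `P` and `v` fixed. -/
noncomputable def genBracketAux (P : ℂ[X]) (v : V) :
    ℂ[X] ⊗[ℂ] V →ₗ[ℂ] (SuperSym (ℂ[X] ⊗[ℂ] V))[X] :=
  TensorProduct.lift (LinearMap.mk₂ ℂ
    (fun Q w => aeval (-LinearMap.mulLeft ℂ (X : (SuperSym (ℂ[X] ⊗[ℂ] V))[X])) P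
      (aeval lamDel Q (β v w)))
    (by intros; simp) (by intros; simp) (by intros; simp) (by intros; simp))

/-- The sesquilinear extension to `ℂ[∂] ⊗ V` of a bracket `β v w = {v _λ w}` on `V`. -/
noncomputable def genBracket :
    ℂ[X] ⊗[ℂ] V →ₗ[ℂ] ℂ[X] ⊗[ℂ] V →ₗ[ℂ] (SuperSym (ℂ[X] ⊗[ℂ] V))[X] :=
  TensorProduct.lift (LinearMap.mk₂ ℂ (genBracketAux β)
    (by intros; ext; simp [genBracketAux]) (by intros; ext; simp [genBracketAux])
    (by intros; ext; simp [genBracketAux]) (by intros; ext; simp [genBracketAux]))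

/-- `{b _λ f}` for `b ∈ ℂ[∂] ⊗ V` and `f ∈ S(ℂ[∂] ⊗ V)`, by the left Leibniz rule
`{b _λ f g} = {b _λ f} g + (-1)^(p(b) p(f)) f {b _λ g}`. -/
noncomputable def genAd : ℂ[X] ⊗[ℂ] V →ₗ[ℂ] SuperSym (ℂ[X] ⊗[ℂ] V) →ₗ[ℂ]
    (SuperSym (ℂ[X] ⊗[ℂ] V))[X] :=
  superDerivL isSuperExt_C false ∘ₗ genBracket β ∘ₗ evenPart +
    superDerivL isSuperExt_C true ∘ₗ genBracket β ∘ₗ oddPart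

/-- `{f _λ b}` for `f ∈ S(ℂ[∂] ⊗ V)` and `b ∈ ℂ[∂] ⊗ V`, by skewsymmetry
`{f _λ b} = -(-1)^(p(f) p(b)) {b _(-λ-∂) f}`. -/
noncomputable def adGen : SuperSym (ℂ[X] ⊗[ℂ] V) →ₗ[ℂ] ℂ[X] ⊗[ℂ] V →ₗ[ℂ]
    (SuperSym (ℂ[X] ⊗[ℂ] V))[X] :=
  LinearMap.flip (-((genAd β ∘ₗ evenPart).compr₂ negLamDel) -
    ((genAd β ∘ₗ oddPart).compl₂ sigma.toLinearMap).compr₂ negLamDel)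

/-- The Poisson `λ`-bracket on `S(ℂ[∂] ⊗ V)` with values `β v w` on generators: `{f _λ ·}` is the
super-derivation of parity `p(f)` given by the left Leibniz rule and its values `adGen β f` on
`ℂ[∂] ⊗ V`, extended linearly to `f` of mixed parity. -/
noncomputable def bracket : SuperSym (ℂ[X] ⊗[ℂ] V) →ₗ[ℂ] SuperSym (ℂ[X] ⊗[ℂ] V) →ₗ[ℂ]
    (SuperSym (ℂ[X] ⊗[ℂ] V))[X] :=
  (2⁻¹ : ℂ) • (superDerivL isSuperExt_C false ∘ₗ adGen β ∘ₗ (LinearMap.id + sigma.toLinearMap) +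
    superDerivL isSuperExt_C true ∘ₗ adGen β ∘ₗ (LinearMap.id - sigma.toLinearMap))

theorem genAd_apply (b : ℂ[X] ⊗[ℂ] V) (f : SuperSym (ℂ[X] ⊗[ℂ] V)) :
    genAd β b f = superDeriv isSuperExt_C false (genBracket β (evenPart b)) f +
      superDeriv isSuperExt_C true (genBracket β (oddPart b)) f := rfl

theorem adGen_apply (f : SuperSym (ℂ[X] ⊗[ℂ] V)) (b : ℂ[X] ⊗[ℂ] V) :
    adGen β f b = -negLamDel (genAd β (evenPart b) f) - negLamDel (genAd β (oddPart b) (sigma f)) :=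
  rfl

theorem bracket_of_odd (f : SuperSym (ℂ[X] ⊗[ℂ] V)) (hf : sigma f = -f) :
    bracket β f = superDeriv isSuperExt_C true (adGen β f) := by
  have h : bracket β f = (2⁻¹ : ℂ) • (superDerivL isSuperExt_C false (adGen β (f + sigma f)) +
    superDerivL isSuperExt_C true (adGen β (f - sigma f))) := rfl
  rw [h, hf, sub_neg_eq_add, add_neg_cancel, map_zero, map_zero, zero_add, map_add, map_add,
    smul_add, ← add_smul, show (2⁻¹ + 2⁻¹ : ℂ) = 1 by norm_num, one_smul]
  rfl

/-- `{f _λ ·}` at `λ = 0`, the zeroth mode `f_(0)`. -/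
noncomputable def zeroMode (f : SuperSym (ℂ[X] ⊗[ℂ] V)) :
    SuperSym (ℂ[X] ⊗[ℂ] V) →ₗ[ℂ] SuperSym (ℂ[X] ⊗[ℂ] V) :=
  ((lcoeff (SuperSym (ℂ[X] ⊗[ℂ] V)) 0).restrictScalars ℂ) ∘ₗ bracket β f

theorem zeroMode_mul {f : SuperSym (ℂ[X] ⊗[ℂ] V)} (hf : sigma f = -f)
    (a b : SuperSym (ℂ[X] ⊗[ℂ] V)) :
    zeroMode β f (a * b) = zeroMode β f a * b + sigma a * zeroMode β f b := by
  simp [zeroMode, bracket_of_odd β f hf, superDeriv_mul, twist]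

theorem zeroMode_one {f : SuperSym (ℂ[X] ⊗[ℂ] V)} (hf : sigma f = -f) :
    zeroMode β f 1 = 0 := by
  simp [zeroMode, bracket_of_odd β f hf, superDeriv_one]

theorem zeroMode_sigma {f : SuperSym (ℂ[X] ⊗[ℂ] V)} (hf : sigma f = -f)
    (a : SuperSym (ℂ[X] ⊗[ℂ] V)) :
    zeroMode β f (sigma a) = -sigma (zeroMode β f a) := by
  have := superDeriv_parity isSuperExt_C true (adGen β f) a
  have h2 := congrArg (fun P => Polynomial.coeff P 0) this
  simp only [sgn, if_true, neg_smul, one_smul, coe_mapAlgHom, coeff_map, coeff_neg] at h2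
  simp only [zeroMode, bracket_of_odd β f hf, LinearMap.comp_apply, LinearMap.restrictScalars_apply,
    lcoeff_apply]
  rw [eq_neg_iff_add_eq_zero, ← neg_eq_iff_add_eq_zero]
  exact h2.symm

theorem lamDel_apply (P : (SuperSym (ℂ[X] ⊗[ℂ] V))[X]) :
    lamDel P = X * P + P.sum fun n p => monomial n (del p) := rfl

theorem coeff_lamDel (P : (SuperSym (ℂ[X] ⊗[ℂ] V))[X]) (n : ℕ) :
    (lamDel P).coeff n = (X * P).coeff n + del (P.coeff n) := by
  induction P using Polynomial.induction_on' with
  | add p q hp hq => rw [map_add, coeff_add, hp, hq, mul_add, coeff_add, coeff_add, map_add]; abel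
  | monomial m a =>
    rw [lamDel_apply, sum_monomial_index _ _ (by simp), coeff_add, coeff_monomial, coeff_monomial]
    split_ifs <;> simp

theorem coeff_lamDel_zero (P : (SuperSym (ℂ[X] ⊗[ℂ] V))[X]) :
    (lamDel P).coeff 0 = del (P.coeff 0) := by
  simp [coeff_lamDel]

theorem lamDel_mul_C (P : (SuperSym (ℂ[X] ⊗[ℂ] V))[X]) (a : SuperSym (ℂ[X] ⊗[ℂ] V)) :
    lamDel (P * C a) = lamDel P * C a + P * C (del a) := by
  ext n
  simp only [coeff_lamDel, coeff_add, coeff_mul_C, del_mul, ← mul_assoc, add_mul]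
  abel

theorem lamDel_C_mul (P : (SuperSym (ℂ[X] ⊗[ℂ] V))[X]) (a : SuperSym (ℂ[X] ⊗[ℂ] V)) :
    lamDel (C a * P) = C (del a) * P + C a * lamDel P := by
  ext n
  simp only [coeff_lamDel, coeff_add, coeff_C_mul, del_mul, mul_add]
  rw [← mul_assoc, X_mul, mul_assoc, coeff_C_mul]
  abel

theorem lamDel_map_sigma (P : (SuperSym (ℂ[X] ⊗[ℂ] V))[X]) :
    mapAlgHom sigma (lamDel P) = lamDel (mapAlgHom sigma P) := by
  ext n
  cases n <;> simp [coeff_lamDel, sigma_del]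

theorem negLamDel_apply (P : (SuperSym (ℂ[X] ⊗[ℂ] V))[X]) :
    negLamDel P = P.sum fun n p => ((-lamDel) ^ n) (C p) := rfl

theorem negLamDel_monomial (n : ℕ) (p : SuperSym (ℂ[X] ⊗[ℂ] V)) :
    negLamDel (monomial n p) = ((-lamDel) ^ n) (C p) := by
  rw [negLamDel_apply, sum_monomial_index _ _ (by simp)]

theorem negLamDel_X_mul (P : (SuperSym (ℂ[X] ⊗[ℂ] V))[X]) :
    negLamDel (X * P) = -lamDel (negLamDel P) := by
  induction P using Polynomial.induction_on' with
  | add p q hp hq => rw [mul_add, map_add, hp, hq, map_add, map_add, neg_add]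
  | monomial m a =>
    rw [X_mul_monomial, negLamDel_monomial, negLamDel_monomial, pow_succ', Module.End.mul_apply,
      LinearMap.neg_apply]

theorem genBracket_delGen (x : ℂ[X] ⊗[ℂ] V) :
    genBracket β (delGen x) = -(LinearMap.mulLeft ℂ X ∘ₗ genBracket β x) := by
  induction x with
  | zero => simp
  | add x y hx hy => rw [map_add, map_add, hx, hy, map_add, LinearMap.comp_add, neg_add]
  | tmul P v =>
    ext
    simp [delGen, genBracket, genBracketAux, map_mul]

theorem superDeriv_X_mul (ε : Bool)
    (D : ℂ[X] ⊗[ℂ] V →ₗ[ℂ] (SuperSym (ℂ[X] ⊗[ℂ] V))[X]) (a : SuperSym (ℂ[X] ⊗[ℂ] V)) :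
    superDeriv isSuperExt_C ε (-(LinearMap.mulLeft ℂ X ∘ₗ D)) a =
      -(X * superDeriv isSuperExt_C ε D a) := by
  have := superDeriv_unique isSuperExt_C ε (-(LinearMap.mulLeft ℂ X ∘ₗ D))
    (-(LinearMap.mulLeft ℂ X ∘ₗ superDeriv isSuperExt_C ε D)) (by simp [superDeriv_one])
    (by
      intro a b
      simp only [LinearMap.neg_apply, LinearMap.comp_apply, LinearMap.mulLeft_apply,
        superDeriv_mul, CAlgHom_apply, mul_add, neg_add, neg_mul, mul_neg]
      rw [mul_assoc X (superDeriv _ _ _ _), ← mul_assoc X (C (twist ε a)), X_mul (p := C (twist ε a)),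
        mul_assoc (C (twist ε a))])
    (by
      intro x
      simp only [LinearMap.neg_apply, LinearMap.comp_apply, LinearMap.mulLeft_apply,
        superDeriv_ι, homPart, LinearMap.smul_apply, LinearMap.add_apply,
        AlgHom.toLinearMap_apply, map_neg, map_mul, coe_mapAlgHom, map_X, mul_smul_comm,
        mul_add, smul_neg]
      rw [← smul_neg, neg_add])
  rw [← this]; rfl

theorem genAd_delGen (b : ℂ[X] ⊗[ℂ] V) (f : SuperSym (ℂ[X] ⊗[ℂ] V)) :
    genAd β (delGen b) f = -(X * genAd β b f) := by
  have h1 : evenPart (delGen b) = delGen (evenPart b) := by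
    simp [evenPart, parity_delGen]
  have h2 : oddPart (delGen b) = delGen (oddPart b) := by
    simp [oddPart, parity_delGen]
  rw [genAd_apply, genAd_apply, h1, h2, genBracket_delGen, genBracket_delGen, superDeriv_X_mul,
    superDeriv_X_mul, mul_add, neg_add]

theorem adGen_delGen (f : SuperSym (ℂ[X] ⊗[ℂ] V)) (b : ℂ[X] ⊗[ℂ] V) :
    adGen β f (delGen b) = lamDel (adGen β f b) := by
  have h1 : evenPart (delGen b) = delGen (evenPart b) := by
    simp [evenPart, parity_delGen]
  have h2 : oddPart (delGen b) = delGen (oddPart b) := by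
    simp [oddPart, parity_delGen]
  rw [adGen_apply, adGen_apply, h1, h2, genAd_delGen, genAd_delGen, map_neg, map_neg,
    negLamDel_X_mul, negLamDel_X_mul, map_sub, map_neg]
  simp

theorem superDeriv_del (ε : Bool)
    (D : ℂ[X] ⊗[ℂ] V →ₗ[ℂ] (SuperSym (ℂ[X] ⊗[ℂ] V))[X]) (hD : ∀ b, D (delGen b) = lamDel (D b))
    (a : SuperSym (ℂ[X] ⊗[ℂ] V)) :
    superDeriv isSuperExt_C ε D (del a) = lamDel (superDeriv isSuperExt_C ε D a) := by
  induction a using SuperSym.induction with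
  | hc c =>
    have : del (algebraMap ℂ (SuperSym (ℂ[X] ⊗[ℂ] V)) c) = 0 := superDeriv_algebraMap _ _ _ c
    rw [this, superDeriv_algebraMap, map_zero, map_zero]
  | hι x =>
    rw [del_ι, superDeriv_ι, superDeriv_ι]
    simp only [homPart, LinearMap.smul_apply, LinearMap.add_apply, LinearMap.comp_apply,
      AlgHom.toLinearMap_apply, parity_delGen, hD, lamDel_map_sigma, map_smul, map_add]
  | hm a b ha hb =>
    have : twist ε (del a) = del (twist ε a) := by
      cases ε
      · rfl
      · exact sigma_del a
    simp only [del_mul, map_add, superDeriv_mul, ha, hb, CAlgHom_apply, lamDel_mul_C,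
      lamDel_C_mul, this]
    abel
  | ha a b ha hb => simp only [map_add, ha, hb]

theorem bracket_apply (f a : SuperSym (ℂ[X] ⊗[ℂ] V)) :
    bracket β f a = (2⁻¹ : ℂ) • (superDeriv isSuperExt_C false (adGen β (f + sigma f)) a +
      superDeriv isSuperExt_C true (adGen β (f - sigma f)) a) := rfl

theorem bracket_del (f a : SuperSym (ℂ[X] ⊗[ℂ] V)) :
    bracket β f (del a) = lamDel (bracket β f a) := by
  rw [bracket_apply, bracket_apply, superDeriv_del _ _ (adGen_delGen β _),
    superDeriv_del _ _ (adGen_delGen β _), map_smul lamDel, map_add lamDel]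

theorem zeroMode_del (f a : SuperSym (ℂ[X] ⊗[ℂ] V)) :
    zeroMode β f (del a) = del (zeroMode β f a) := by
  simp [zeroMode, bracket_del, coeff_lamDel_zero]

end bracket

/-- The generator `1 ⊗ v`. -/
noncomputable def gen : V →ₗ[ℂ] SuperSym (ℂ[X] ⊗[ℂ] V) := ι ∘ₗ TensorProduct.mk ℂ ℂ[X] V 1

theorem sigma_gen (v : V) : sigma (gen v) = gen (parity v) := by
  simp [gen, sigma_ι, parity]

end PVA

namespace Sl2

variable {U : Type*} [AddCommGroup U] [Module ℂ U] {E F H : Module.End ℂ U}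

theorem H_mul_F_pow (hHF : H * F = F * H - (2 : ℂ) • F) (n : ℕ) :
    H * F ^ n = F ^ n * H - (2 * n : ℂ) • F ^ n := by
  induction n with
  | zero => simp
  | succ n ih =>
    rw [pow_succ, ← mul_assoc, ih, sub_mul, mul_assoc, hHF, mul_sub, mul_smul_comm, smul_mul_assoc,
      ← pow_succ, ← mul_assoc, ← pow_succ]
    push_cast
    module

theorem H_mul_E_pow (hHE : H * E = E * H + (2 : ℂ) • E) (n : ℕ) :
    H * E ^ n = E ^ n * H + (2 * n : ℂ) • E ^ n := by
  induction n with
  | zero => simp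
  | succ n ih =>
    rw [pow_succ, ← mul_assoc, ih, add_mul, mul_assoc, hHE, mul_add, mul_smul_comm, smul_mul_assoc,
      ← pow_succ, ← mul_assoc, ← pow_succ]
    push_cast
    module

theorem pow_eq_zero [FiniteDimensional ℂ U] (c : ℂ) (hc : c ≠ 0)
    (hE : ∀ n : ℕ, H * E ^ n = E ^ n * H + (c * n) • E ^ n) : ∃ N : ℕ, E ^ N = 0 := by
  by_contra! hN
  let T : Module.End ℂ (Module.End ℂ U) := LinearMap.mulLeft ℂ H - LinearMap.mulRight ℂ H
  have h1 : ∀ n : ℕ, T.HasEigenvalue (c * n) := fun n =>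
    Module.End.hasEigenvalue_of_hasEigenvector (x := E ^ n)
      ⟨Module.End.mem_eigenspace_iff.2 (by simp [T, hE]), hN n⟩
  have h2 := Module.End.finite_hasEigenvalue T
  exact Set.infinite_of_injective_forall_mem (f := fun n : ℕ => c * (n : ℂ))
    (fun a b hab => by simpa [hc] using hab) h1 h2

theorem E_F_pow (hEF : E * F = F * E + H) (hHF : H * F = F * H - (2 : ℂ) • F)
    (n : ℕ) : E * F ^ (n + 1) = F ^ (n + 1) * E + (n + 1 : ℂ) • (F ^ n * (H - (n : ℂ) • 1)) := by
  induction n with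
  | zero => simp [hEF]
  | succ n ih =>
    have h1 := H_mul_F_pow hHF (n + 1)
    rw [pow_succ' F (n + 1), ← mul_assoc, hEF, add_mul, mul_assoc, ih, h1, mul_add, ← mul_assoc,
      mul_smul_comm, ← mul_assoc, ← pow_succ' F n]
    simp only [mul_sub, mul_smul_comm, mul_one]
    push_cast
    module

theorem ker_E (hEF : E * F = F * E + H) (hHE : H * E = E * H + (2 : ℂ) • E)
    (hHF : H * F = F * H - (2 : ℂ) • F)
    (n : ℕ) (v : U) (hv : E v = 0) :
    ∃ c : ℂ, c ≠ 0 ∧ (E ^ n) ((F ^ n) v) = c • aeval H (∏ i ∈ Finset.range n, (X - C (i : ℂ))) v := by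
  induction n generalizing v with
  | zero => exact ⟨1, one_ne_zero, by simp⟩
  | succ n ih =>
    have hv' : E ((H - (n : ℂ) • 1) v) = 0 := by
      have := congrArg (fun T => T v) hHE
      simp only [Module.End.mul_apply, LinearMap.add_apply, LinearMap.smul_apply, hv] at this
      simp at this
      simp [hv, ← this]
    obtain ⟨c, hc, h⟩ := ih _ hv'
    have h2 := congrArg (fun T => (E ^ n) (T v)) (E_F_pow hEF hHF n)
    simp only [Module.End.mul_apply, LinearMap.add_apply, LinearMap.smul_apply, hv, map_zero,
      zero_add, map_smul, h] at h2
    refine ⟨(n + 1) * c, mul_ne_zero (Nat.cast_add_one_ne_zero n) hc, ?_⟩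
    rw [pow_succ E, Module.End.mul_apply, h2, Finset.prod_range_succ, map_mul,
      Module.End.mul_apply, smul_smul]
    congr 2
    simp [Nat.cast_smul_eq_nsmul]

theorem key [FiniteDimensional ℂ U] (hEF : E * F = F * E + H)
    (hHE : H * E = E * H + (2 : ℂ) • E) (hHF : H * F = F * H - (2 : ℂ) • F)
    (v : U) (hv : E v = 0) (hv0 : v ≠ 0) (ν : ℂ) (k : ℕ) (hk : ((H - ν • 1) ^ k) v = 0) :
    ∃ m : ℕ, ν = m ∧ H v = ν • v := by
  obtain ⟨N, hN⟩ := pow_eq_zero (H := H) (E := F) (-2) (by norm_num) fun n => by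
    rw [H_mul_F_pow hHF n]; module
  obtain ⟨c, hc, hP⟩ := ker_E hEF hHE hHF N v hv
  rw [hN, LinearMap.zero_apply, map_zero, eq_comm, smul_eq_zero_iff_right hc] at hP
  have hk' : aeval H ((X - C ν) ^ k) v = 0 := by
    rw [← hk]; simp [Algebra.algebraMap_eq_smul_one]
  by_cases hν : ∃ m ∈ Finset.range N, ν = (m : ℂ)
  · obtain ⟨m, hm, rfl⟩ := hν
    refine ⟨m, rfl, ?_⟩
    rw [← Finset.prod_erase_mul _ _ hm, map_mul, Module.End.mul_apply] at hP
    have hcop : IsCoprime (∏ i ∈ (Finset.range N).erase m, (X - C (i : ℂ))) ((X - C (m : ℂ)) ^ k) := by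
      refine IsCoprime.prod_left fun i hi => IsCoprime.pow_right ?_
      exact isCoprime_X_sub_C_of_isUnit_sub (by
        rw [isUnit_iff_ne_zero, sub_ne_zero, Nat.cast_injective.ne_iff]
        exact (Finset.mem_erase.1 hi).1)
    have hd := Polynomial.disjoint_ker_aeval_of_isCoprime H hcop
    have := Submodule.disjoint_def.1 hd (aeval H (X - C (m : ℂ)) v) hP (by
      rw [LinearMap.mem_ker, ← Module.End.mul_apply, ← map_mul, mul_comm, map_mul,
        Module.End.mul_apply, hk', map_zero])
    simpa [sub_eq_zero, Nat.cast_smul_eq_nsmul] using this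
  · exfalso
    push Not at hν
    have hcop : IsCoprime (∏ i ∈ Finset.range N, (X - C (i : ℂ))) ((X - C ν) ^ k) := by
      refine IsCoprime.prod_left fun i hi => IsCoprime.pow_right ?_
      exact isCoprime_X_sub_C_of_isUnit_sub (by
        rw [isUnit_iff_ne_zero, sub_ne_zero]
        exact (hν i hi).symm)
    exact hv0 (Submodule.disjoint_def.1 (Polynomial.disjoint_ker_aeval_of_isCoprime H hcop) v hP hk')

theorem casimir_comm_H
    (hHE : H * E = E * H + (2 : ℂ) • E) (hHF : H * F = F * H - (2 : ℂ) • F) :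
    H * ((4 : ℂ) • (F * E) + H * H + (2 : ℂ) • H) = ((4 : ℂ) • (F * E) + H * H + (2 : ℂ) • H) * H := by
  have : H * (F * E) = F * E * H := by
    rw [← mul_assoc, hHF, sub_mul, mul_assoc, hHE, mul_add, mul_smul_comm, smul_mul_assoc,
      ← mul_assoc]; abel
  rw [mul_add, mul_add, add_mul, add_mul, mul_smul_comm, mul_smul_comm, smul_mul_assoc,
    smul_mul_assoc, this, ← mul_assoc H H H]

theorem casimir_comm_E (hEF : E * F = F * E + H)
    (hHE : H * E = E * H + (2 : ℂ) • E) :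
    ((4 : ℂ) • (F * E) + H * H + (2 : ℂ) • H) * E =
      E * ((4 : ℂ) • (F * E) + H * H + (2 : ℂ) • H) := by
  have h1 : E * (F * E) = F * E * E + H * E := by rw [← mul_assoc, hEF, add_mul]
  have h2 : E * H = H * E - (2 : ℂ) • E := by rw [hHE]; abel
  have h3 : E * (H * H) = H * H * E - (4 : ℂ) • (H * E) + (4 : ℂ) • E := by
    rw [← mul_assoc, h2, sub_mul, mul_assoc, h2, smul_mul_assoc, h2, mul_sub, mul_smul_comm,
      ← mul_assoc]
    module
  simp only [mul_add, add_mul, mul_smul_comm, smul_mul_assoc, h1, h3, h2]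
  module

theorem diag [FiniteDimensional ℂ U] (hEF : E * F = F * E + H)
    (hHE : H * E = E * H + (2 : ℂ) • E) (hHF : H * F = F * H - (2 : ℂ) • F) :
    ⨆ i : ℤ, Module.End.eigenspace H (i : ℂ) = ⊤ := by
  set Q : Module.End ℂ U := (4 : ℂ) • (F * E) + H * H + (2 : ℂ) • H with hQ
  have hQH : H * Q = Q * H := casimir_comm_H hHE hHF
  have hQE : Q * E = E * Q := casimir_comm_E hEF hHE
  obtain ⟨N, hN⟩ := pow_eq_zero (H := H) (E := E) 2 (by norm_num) (H_mul_E_pow hHE)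
  have hshift : ∀ (μ : ℂ) (r k : ℕ), (H - (μ + 2 * r) • 1) ^ k * E ^ r = E ^ r * (H - μ • 1) ^ k := by
    intro μ r k
    have h1 : SemiconjBy (E ^ r) (H - μ • 1) (H - (μ + 2 * r) • 1) := by
      rw [SemiconjBy, mul_sub, sub_mul, H_mul_E_pow hHE, mul_smul_comm, smul_mul_assoc, mul_one,
        one_mul]
      module
    exact (h1.pow_right k).symm
  have hQshift : ∀ (c : ℂ) (r k : ℕ), (Q - c • 1) ^ k * E ^ r = E ^ r * (Q - c • 1) ^ k := by
    intro c r k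
    have h0 : Commute Q E := hQE
    have h1 : Commute (Q - c • 1) E := h0.sub_left ((Commute.one_left E).smul_left c)
    exact (h1.pow_pow k r)
  have hQv : ∀ (v : U) (m : ℂ), E v = 0 → H v = m • v → Q v = (m ^ 2 + 2 * m) • v := by
    intro v m h1 h2
    simp only [hQ, LinearMap.add_apply, LinearMap.smul_apply, Module.End.mul_apply, h1, h2, map_smul,
      map_zero]
    module
  have claim : ∀ (c μ : ℂ) (v : U) (k l : ℕ), v ≠ 0 → ((H - μ • 1) ^ k) v = 0 →
      ((Q - c • 1) ^ l) v = 0 → ∃ r m : ℕ, (E ^ r) v ≠ 0 ∧ μ + 2 * r = m ∧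
        H ((E ^ r) v) = (m : ℂ) • (E ^ r) v ∧ (m : ℂ) ^ 2 + 2 * m = c := by
    intro c μ v k l hv hk hl
    obtain ⟨r, hr, hr'⟩ := Nat.exists_not_and_succ_of_not_zero_of_exists
      (p := fun n => (E ^ n) v = 0) (by simpa using hv) ⟨N, by simp [hN]⟩
    have hE0 : E ((E ^ r) v) = 0 := by
      rw [← Module.End.mul_apply, ← pow_succ']; exact hr'
    obtain ⟨m, hm, hH⟩ := key hEF hHE hHF ((E ^ r) v) hE0 hr (μ + 2 * r) k (by
      rw [← Module.End.mul_apply, hshift, Module.End.mul_apply, hk, map_zero])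
    rw [hm] at hH
    refine ⟨r, m, hr, hm, hH, ?_⟩
    have h1 := hQv _ _ hE0 hH
    have h2 : ((Q - c • 1) ^ l) ((E ^ r) v) = 0 := by
      rw [← Module.End.mul_apply, hQshift, Module.End.mul_apply, hl, map_zero]
    have h3 : ∀ n : ℕ, ((Q - c • 1) ^ n) ((E ^ r) v) = ((m : ℂ) ^ 2 + 2 * m - c) ^ n • (E ^ r) v := by
      intro n
      induction n with
      | zero => simp
      | succ n ih =>
        rw [pow_succ', Module.End.mul_apply, ih, map_smul, LinearMap.sub_apply, h1,
          LinearMap.smul_apply, Module.End.one_apply, ← sub_smul, smul_smul, ← pow_succ]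
    rw [h3, smul_eq_zero_iff_left hr] at h2
    exact sub_eq_zero.1 (eq_zero_of_pow_eq_zero h2)
  have hinf : ∀ c : ℂ, Q.maxGenEigenspace c =
      ⨆ μ, Q.maxGenEigenspace c ⊓ H.maxGenEigenspace μ := by
    intro c
    have h1 : ∀ x ∈ Q.maxGenEigenspace c, H x ∈ Q.maxGenEigenspace c :=
      Module.End.mapsTo_maxGenEigenspace_of_comm (f := Q) (g := H) hQH.symm c
    have h2 := Submodule.inf_iSup_genEigenspace h1 ⊤
    have h3 : ⨆ μ, H.genEigenspace μ ⊤ = ⊤ := Module.End.iSup_maxGenEigenspace_eq_top H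
    exact (inf_eq_left.2 (le_top.trans h3.ge)).symm.trans h2
  rw [eq_top_iff, ← Module.End.iSup_maxGenEigenspace_eq_top Q]
  refine iSup_le fun c => ?_
  rw [hinf c]
  refine iSup_le fun μ => ?_
  rintro v ⟨hvc, hvμ⟩
  obtain ⟨l, hl⟩ := (Module.End.mem_maxGenEigenspace _ _ _).1 hvc
  obtain ⟨k, hk⟩ := (Module.End.mem_maxGenEigenspace _ _ _).1 hvμ
  by_cases hv : v = 0
  · rw [hv]; exact zero_mem _
  obtain ⟨r, m, hr, hm, hH, hc⟩ := claim c μ v k l hv hk hl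
  have hEu : (E ^ r) ((H - μ • 1) v) = 0 := by
    have := congrArg (fun T => T v) (hshift μ r 1)
    simp only [pow_one, Module.End.mul_apply] at this
    rw [← this, LinearMap.sub_apply, hH, hm]
    simp
  have hu : (H - μ • 1) v = 0 := by
    by_contra hu
    obtain ⟨r', m', hr', hm', hH', hc'⟩ := claim c μ _ k l hu
      (by rw [← Module.End.mul_apply, ← pow_succ, pow_succ', Module.End.mul_apply, hk, map_zero])
      (by
        have h0 : Commute Q H := hQH.symm
        have h1 : Commute ((Q - c • 1) ^ l) (H - μ • 1) :=
          Commute.pow_left ((h0.sub_right ((Commute.one_right Q).smul_right μ)).sub_left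
            ((Commute.one_left _).smul_left c)) l
        rw [← Module.End.mul_apply, h1.eq, Module.End.mul_apply, hl, map_zero])
    have h1 : m = m' := by
      have h2 : (m : ℂ) ^ 2 + 2 * m = m' ^ 2 + 2 * m' := by rw [hc, hc']
      have h3 : m ^ 2 + 2 * m = m' ^ 2 + 2 * m' := by exact_mod_cast h2
      nlinarith
    rw [h1, ← hm', add_right_inj] at hm
    have h4 : r = r' := by simpa using hm
    rw [← h4] at hr'
    exact hr' hEu
  have hμ : μ = ((m - 2 * r : ℤ) : ℂ) := by
    push_cast; rw [← hm]; ring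
  refine Submodule.mem_iSup_of_mem (m - 2 * r : ℤ) ?_
  rw [Module.End.mem_eigenspace_iff, ← hμ]
  simpa [sub_eq_zero] using hu

end Sl2

namespace WAlg
open SuperSym PVA

variable {𝔤 : Type*} [LieRing 𝔤] [LieAlgebra ℂ 𝔤]

/-- `gr h i` is `𝔤(i/2)`, the eigenspace of `ad (h/2)` with eigenvalue `i/2`. All half-integers
(eigenvalues, degrees, filtration levels) are indexed by their doubles. -/
noncomputable def gr (h : 𝔤) (i : ℤ) : Submodule ℂ 𝔤 :=
  Module.End.eigenspace (LieAlgebra.ad ℂ 𝔤 ((2⁻¹ : ℂ) • h)) ((i : ℂ) / 2)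

/-- `𝔫`, the sum of the `𝔤(j)` with `j > 0`. -/
noncomputable def pos (h : 𝔤) : Submodule ℂ 𝔤 := ⨆ i : ℤ, ⨆ _ : 0 < i, gr h i

/-- The sum of the `𝔤(j)` with `j ≤ 0`. -/
noncomputable def nonpos (h : 𝔤) : Submodule ℂ 𝔤 := ⨆ i : ℤ, ⨆ _ : i ≤ 0, gr h i

theorem mem_gr (h x : 𝔤) (i : ℤ) : x ∈ gr h i ↔ ⁅h, x⁆ = (i : ℂ) • x := by
  rw [gr, Module.End.mem_eigenspace_iff, LieAlgebra.ad_apply, smul_lie]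
  constructor
  · intro H
    have := congrArg (fun y => (2 : ℂ) • y) H
    simp only [smul_smul] at this
    rw [mul_inv_cancel₀ two_ne_zero, one_smul, mul_div_cancel₀ _ two_ne_zero] at this
    exact this
  · intro H
    rw [H, smul_smul]; congr 1; ring

theorem iSupIndep_gr (h : 𝔤) : iSupIndep (gr h) := by
  have := Module.End.eigenspaces_iSupIndep (LieAlgebra.ad ℂ 𝔤 ((2⁻¹ : ℂ) • h))
  exact this.comp (f := fun i : ℤ => (i : ℂ) / 2) fun i j hij => by
    simpa [div_left_inj' (two_ne_zero (α := ℂ))] using hij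

variable [FiniteDimensional ℂ 𝔤] {h e f : 𝔤}

theorem iSup_gr (t : IsSl2Triple h e f) : ⨆ i, gr h i = ⊤ := by
  have hEF : LieAlgebra.ad ℂ 𝔤 e * LieAlgebra.ad ℂ 𝔤 f =
      LieAlgebra.ad ℂ 𝔤 f * LieAlgebra.ad ℂ 𝔤 e + LieAlgebra.ad ℂ 𝔤 h := by
    ext x; simp [← t.lie_e_f]
  have hHE : LieAlgebra.ad ℂ 𝔤 h * LieAlgebra.ad ℂ 𝔤 e =
      LieAlgebra.ad ℂ 𝔤 e * LieAlgebra.ad ℂ 𝔤 h + (2 : ℂ) • LieAlgebra.ad ℂ 𝔤 e := by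
    ext x
    have := congrArg (fun y => ⁅y, x⁆) (t.lie_h_e_smul ℂ)
    simp only [lie_lie, smul_lie] at this
    simp [← this]
  have hHF : LieAlgebra.ad ℂ 𝔤 h * LieAlgebra.ad ℂ 𝔤 f =
      LieAlgebra.ad ℂ 𝔤 f * LieAlgebra.ad ℂ 𝔤 h - (2 : ℂ) • LieAlgebra.ad ℂ 𝔤 f := by
    ext x
    have := congrArg (fun y => ⁅y, x⁆) (t.lie_lie_smul_f ℂ)
    simp only [lie_lie, neg_lie, smul_lie] at this
    rw [sub_eq_iff_eq_add] at this
    simp only [Module.End.mul_apply, LinearMap.sub_apply, LinearMap.smul_apply,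
      LieAlgebra.ad_apply, this]
    abel
  rw [← Sl2.diag hEF hHE hHF]
  congr 1
  ext i x
  rw [mem_gr, Module.End.mem_eigenspace_iff, LieAlgebra.ad_apply]

theorem isCompl_of (t : IsSl2Triple h e f) (p : ℤ → Prop) :
    IsCompl (⨆ i : ℤ, ⨆ _ : p i, gr h i) (⨆ i : ℤ, ⨆ _ : ¬ p i, gr h i) := by
  refine ⟨(iSupIndep_gr h).disjoint_biSup_biSup (s := {i | p i}) (t := {i | ¬ p i}) ?_, ?_⟩
  · exact Set.disjoint_left.2 fun i hi hi' => hi' hi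
  · rw [codisjoint_iff, eq_top_iff, ← iSup_gr t]
    refine iSup_le fun i => ?_
    by_cases hi : p i
    · exact le_sup_of_le_left (le_iSup₂_of_le i hi le_rfl)
    · exact le_sup_of_le_right (le_iSup₂_of_le i hi le_rfl)

theorem isCompl_pos (t : IsSl2Triple h e f) : IsCompl (pos h) (nonpos h) := by
  have := isCompl_of t (fun i => 0 < i)
  simp only [not_lt] at this
  exact this

theorem isCompl_half (t : IsSl2Triple h e f) :
    IsCompl (gr h 1) (⨆ i : ℤ, ⨆ _ : i ≠ 1, gr h i) := by
  simpa using isCompl_of t (fun i => i = 1)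

/-- The projection of `𝔤` to `𝔫` along the sum of the `𝔤(j)` with `j ≤ 0`. -/
noncomputable def posProj (t : IsSl2Triple h e f) : 𝔤 →ₗ[ℂ] pos h :=
  Submodule.projectionOnto _ _ (isCompl_pos t)

/-- The projection of `𝔤` to `𝔤(1/2)` along the other eigenspaces; on `𝔫` it is the quotient map
`𝔫 → 𝔫/𝔪 ≅ 𝔤(1/2)`, where `𝔪` is the sum of the `𝔤(j)` with `j ≥ 1`. -/
noncomputable def halfProj (t : IsSl2Triple h e f) : 𝔤 →ₗ[ℂ] gr h 1 :=
  Submodule.projectionOnto _ _ (isCompl_half t)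

/-- The generating superspace: even part `𝔤 ⊕ Φ_(𝔫/𝔪)`, odd part `φ_𝔫 ⊕ φ^(𝔫*)`, with `𝔫/𝔪`
identified with `𝔤(1/2)`. -/
abbrev Gen (h : 𝔤) : Type _ := (𝔤 × gr h 1) × (pos h × Module.Dual ℂ (pos h))

/-- The differential superalgebra `S(R)` on `R = ℂ[∂] ⊗ (𝔤 ⊕ φ_𝔫 ⊕ φ^(𝔫*) ⊕ Φ_(𝔫/𝔪))`. -/
abbrev S (h : 𝔤) : Type _ := SuperSym (ℂ[X] ⊗[ℂ] Gen h)

/-- The generator `a`, for `a ∈ 𝔤`. -/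
noncomputable def cur : 𝔤 →ₗ[ℂ] S h := gen ∘ₗ LinearMap.inl ℂ _ _ ∘ₗ LinearMap.inl ℂ _ _

/-- The even generator `Φ_[u]`, for `u ∈ 𝔤(1/2)`. -/
noncomputable def neutral : gr h 1 →ₗ[ℂ] S h :=
  gen ∘ₗ LinearMap.inl ℂ _ _ ∘ₗ LinearMap.inr ℂ _ _

/-- The odd generator `φ_x`, for `x ∈ 𝔫`. -/
noncomputable def phi : pos h →ₗ[ℂ] S h := gen ∘ₗ LinearMap.inr ℂ _ _ ∘ₗ LinearMap.inl ℂ _ _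

/-- The odd generator `φ^θ`, for `θ ∈ 𝔫*`. -/
noncomputable def phiStar : Module.Dual ℂ (pos h) →ₗ[ℂ] S h :=
  gen ∘ₗ LinearMap.inr ℂ _ _ ∘ₗ LinearMap.inr ℂ _ _

/-- The `λ`-brackets of generators: `{a _λ b} = [a, b] + λ k (a, b)`,
`{φ_x _λ φ^θ} = {φ^θ _λ φ_x} = θ(x)`, `{Φ_[u] _λ Φ_[u']} = (f, [u, u'])`, all others zero. -/
noncomputable def vectorBracket (h f : 𝔤) (B : LinearMap.BilinForm ℂ 𝔤) (k : ℂ) :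
    Gen h →ₗ[ℂ] Gen h →ₗ[ℂ] (S h)[X] :=
  LinearMap.mk₂ ℂ
    (fun v w =>
      C (cur ⁅v.1.1, w.1.1⁆) + (k * B v.1.1 w.1.1) • X
        + (w.2.2 v.2.1 + v.2.2 w.2.1 + B f ⁅(v.1.2 : 𝔤), (w.1.2 : 𝔤)⁆) • 1)
    (by
      intro v v' w
      simp only [Prod.fst_add, Prod.snd_add, add_lie, map_add, LinearMap.add_apply, mul_add,
        add_smul, Submodule.coe_add]
      abel)
    (by
      intro c v w
      simp only [Prod.smul_fst, Prod.smul_snd, smul_lie, map_smul, LinearMap.smul_apply, ← smul_C,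
        SetLike.val_smul, smul_eq_mul, smul_add, smul_smul, mul_left_comm, mul_add])
    (by
      intro v w w'
      simp only [Prod.fst_add, Prod.snd_add, lie_add, map_add, LinearMap.add_apply, mul_add,
        add_smul, Submodule.coe_add]
      abel)
    (by
      intro c v w
      simp only [Prod.smul_fst, Prod.smul_snd, lie_smul, map_smul, LinearMap.smul_apply, ← smul_C,
        SetLike.val_smul, smul_eq_mul, smul_add, smul_smul, mul_left_comm, mul_add])

/-- `∑ φ^(v^α) (u_α + (f, u_α) + Φ_[u_α]) + 1/2 ∑∑ φ^(v^α) φ^(v^β) φ_([u_β, u_α])`, for a basis `u`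
of `𝔫` with dual basis `v`; it does not depend on the basis. Since `[𝔫, 𝔫] ⊆ 𝔫`, `posProj` does not
change `[u_β, u_α]`. -/
noncomputable def brst (t : IsSl2Triple h e f) (B : LinearMap.BilinForm ℂ 𝔤) : S h :=
  let u := Module.finBasis ℂ (pos h)
  ∑ α, phiStar (u.coord α) *
      (cur (u α : 𝔤) + algebraMap ℂ _ (B f (u α : 𝔤)) + neutral (halfProj t (u α : 𝔤)))
    + (2⁻¹ : ℂ) • ∑ α, ∑ β,
      phiStar (u.coord α) * phiStar (u.coord β) * phi (posProj t ⁅(u β : 𝔤), (u α : 𝔤)⁆)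

/-- The differential `d_(0) = {d _λ ·}` at `λ = 0`. -/
noncomputable def d (t : IsSl2Triple h e f) (B : LinearMap.BilinForm ℂ 𝔤) (k : ℂ) :
    S h →ₗ[ℂ] S h :=
  zeroMode (vectorBracket h f B k) (brst t B)

/-- `J_a = a + ∑ φ^(v^α) φ_(π [u_α, a])`, with `π` the projection to `𝔫`. -/
noncomputable def J (t : IsSl2Triple h e f) : 𝔤 →ₗ[ℂ] S h where
  toFun a := cur a + ∑ α, phiStar ((Module.finBasis ℂ (pos h)).coord α) *
    phi (posProj t ⁅(Module.finBasis ℂ (pos h) α : 𝔤), a⁆)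
  map_add' a b := by simp [mul_add, Finset.sum_add_distrib]; abel
  map_smul' c a := by simp [Finset.smul_sum]

theorem sigma_cur (a : 𝔤) : sigma (cur a : S h) = cur a := by
  simp [cur, sigma_gen, parity]

theorem sigma_neutral (u : gr h 1) : sigma (neutral u) = neutral u := by
  simp [neutral, sigma_gen, parity]

theorem sigma_phi (x : pos h) : sigma (phi x) = -phi x := by
  rw [phi, LinearMap.comp_apply, sigma_gen, ← map_neg]
  simp [parity]

theorem sigma_phiStar (θ : Module.Dual ℂ (pos h)) : sigma (phiStar θ) = -phiStar θ := by
  rw [phiStar, LinearMap.comp_apply, sigma_gen, ← map_neg]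
  simp [parity]

theorem sigma_brst (t : IsSl2Triple h e f) (B : LinearMap.BilinForm ℂ 𝔤) :
    sigma (brst t B) = -brst t B := by
  simp only [brst, map_add, map_sum, map_mul, map_smul, sigma_cur, sigma_neutral, sigma_phi,
    sigma_phiStar, AlgHom.commutes]
  simp only [neg_mul, mul_neg, neg_neg, Finset.sum_neg_distrib, smul_neg, neg_add]

theorem sigma_J (t : IsSl2Triple h e f) (a : 𝔤) : sigma (J t a) = J t a := by
  simp [J, sigma_cur, sigma_phi, sigma_phiStar]

/-- The elements of `r_-`: `J_a` for `a` in the sum of the `𝔤(j)`, `j ≤ 0`, and `φ^θ` and `Φ_[u]`. -/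
inductive IsMinusGen (t : IsSl2Triple h e f) : S h → Prop
  | J (a : 𝔤) (ha : a ∈ nonpos h) : IsMinusGen t (J t a)
  | phiStar (θ : Module.Dual ℂ (pos h)) : IsMinusGen t (phiStar θ)
  | neutral (u : gr h 1) : IsMinusGen t (neutral u)

/-- `S(R_-)` inside `S(R)`: the differential subalgebra generated by `r_-`. -/
noncomputable def Sminus (t : IsSl2Triple h e f) : Subalgebra ℂ (S h) :=
  Algebra.adjoin ℂ {x | ∃ (n : ℕ) (g : S h), IsMinusGen t g ∧ x = (del ^ n) g}

theorem del_mem_Sminus (t : IsSl2Triple h e f) {x : S h} (hx : x ∈ Sminus t) :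
    del x ∈ Sminus t := by
  induction hx using Algebra.adjoin_induction with
  | mem x hx =>
    obtain ⟨n, g, hg, rfl⟩ := hx
    exact Algebra.subset_adjoin ⟨n + 1, g, hg, by rw [pow_succ', Module.End.mul_apply]⟩
  | algebraMap c =>
    have : del (algebraMap ℂ (S h) c) = 0 := superDeriv_algebraMap _ _ _ c
    rw [this]; exact zero_mem _
  | add x y _ _ hx hy => rw [map_add]; exact add_mem hx hy
  | mul x y hx' hy' hx hy =>
    rw [del_mul]; exact add_mem (mul_mem hx hy') (mul_mem hx' hy)

theorem sigma_mem_Sminus (t : IsSl2Triple h e f) {x : S h} (hx : x ∈ Sminus t) :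
    sigma x ∈ Sminus t := by
  induction hx using Algebra.adjoin_induction with
  | mem x hx =>
    obtain ⟨n, g, hg, rfl⟩ := hx
    have h1 : ∀ (n : ℕ) (g : S h), sigma ((del ^ n) g) = (del ^ n) (sigma g) := by
      intro n
      induction n with
      | zero => intro g; rfl
      | succ n ih =>
        intro g
        rw [pow_succ, Module.End.mul_apply, ih, sigma_del, Module.End.mul_apply]
    have h2 : (del ^ n) g ∈ Sminus t := Algebra.subset_adjoin ⟨n, g, hg, rfl⟩
    rw [h1]
    cases hg with
    | J a ha => rw [sigma_J]; exact h2
    | phiStar θ => rw [sigma_phiStar, map_neg]; exact neg_mem h2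
    | neutral u => rw [sigma_neutral]; exact h2
  | algebraMap c => rw [AlgHom.commutes]; exact Subalgebra.algebraMap_mem _ c
  | add x y _ _ hx hy => rw [map_add]; exact add_mem hx hy
  | mul x y _ _ hx hy => rw [map_mul]; exact mul_mem hx hy

/-- `IsMonomial t x p c`: `x` is a product of elements `∂^n J_a` (`a ∈ 𝔤(j)`, `j ≤ 0`, of degree
`-j + 1/2` and charge `0`), `∂^n φ^θ` (`θ` supported on `𝔤(j)`, of degree `j - 1/2` and charge `1`)
and `∂^n Φ_[u]` (of degree and charge `0`), of total degree `p/2` and total charge `c`. -/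
inductive IsMonomial (t : IsSl2Triple h e f) : S h → ℤ → ℕ → Prop
  | one : IsMonomial t 1 0 0
  | J (n : ℕ) (j : ℤ) (hj : j ≤ 0) (a : 𝔤) (ha : a ∈ gr h j) {x : S h} {p : ℤ} {c : ℕ}
      (hx : IsMonomial t x p c) : IsMonomial t ((del ^ n) (J t a) * x) ((-j + 1) + p) c
  | phiStar (n : ℕ) (j : ℤ) (θ : Module.Dual ℂ (pos h))
      (hθ : ∀ i, i ≠ j → ∀ v : pos h, (v : 𝔤) ∈ gr h i → θ v = 0) {x : S h} {p : ℤ} {c : ℕ}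
      (hx : IsMonomial t x p c) : IsMonomial t ((del ^ n) (phiStar θ) * x) ((j - 1) + p) (c + 1)
  | neutral (n : ℕ) (u : gr h 1) {x : S h} {p : ℤ} {c : ℕ}
      (hx : IsMonomial t x p c) : IsMonomial t ((del ^ n) (neutral u) * x) p c

/-- The elements of `S(R_-)` of degree `p/2`. -/
noncomputable def degreePiece (t : IsSl2Triple h e f) (p : ℤ) : Submodule ℂ (S h) :=
  Submodule.span ℂ {x | ∃ c, IsMonomial t x p c}

/-- The filtration level `F_(p/2)` of `S(R_-)`: the sum of the pieces of degree at most `p/2`. -/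
noncomputable def filtration (t : IsSl2Triple h e f) (p : ℤ) : Submodule ℂ (S h) :=
  ⨆ q : ℤ, ⨆ _ : q ≤ p, degreePiece t q

/-- The elements of `S(R_-)` of charge `c`. -/
noncomputable def chargePiece (t : IsSl2Triple h e f) (c : ℕ) : Submodule ℂ (S h) :=
  Submodule.span ℂ {x | ∃ p, IsMonomial t x p c}

section cohomology

variable (t : IsSl2Triple h e f) (B : LinearMap.BilinForm ℂ 𝔤) (k : ℂ)

theorem d_mul (x y : S h) : d t B k (x * y) = d t B k x * y + sigma x * d t B k y :=
  zeroMode_mul _ (sigma_brst t B) x y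

theorem d_sigma (x : S h) : d t B k (sigma x) = -sigma (d t B k x) :=
  zeroMode_sigma _ (sigma_brst t B) x

theorem d_del (x : S h) : d t B k (del x) = del (d t B k x) := zeroMode_del _ _ x

/-- The kernel of `d_-`, the restriction of `d_(0)` to `S(R_-)`. -/
noncomputable def cocycles : Subalgebra ℂ (S h) where
  carrier := {x | x ∈ Sminus t ∧ d t B k x = 0}
  mul_mem' := by
    rintro x y ⟨hx, hx'⟩ ⟨hy, hy'⟩
    exact ⟨mul_mem hx hy, by rw [d_mul, hx', hy', zero_mul, mul_zero, add_zero]⟩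
  add_mem' := by
    rintro x y ⟨hx, hx'⟩ ⟨hy, hy'⟩
    exact ⟨add_mem hx hy, by rw [map_add, hx', hy', add_zero]⟩
  algebraMap_mem' c := by
    refine ⟨Subalgebra.algebraMap_mem _ c, ?_⟩
    rw [Algebra.algebraMap_eq_smul_one, map_smul, d, zeroMode_one _ (sigma_brst t B), smul_zero]

/-- The image of `d_-` as an ideal of its kernel; see `mem_boundaries`. (As `d_(0)` preserves
`S(R_-)` and squares to zero, every `d_(0) w` with `w ∈ S(R_-)` lies in the kernel of `d_-`.) -/
noncomputable def boundaries : TwoSidedIdeal (cocycles t B k) :=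
  TwoSidedIdeal.mk' {z | ∃ w ∈ Sminus t, d t B k w = z}
    ⟨0, zero_mem _, by simp⟩
    (by
      rintro x y ⟨v, hv, hv'⟩ ⟨w, hw, hw'⟩
      exact ⟨v + w, add_mem hv hw, by rw [map_add, hv', hw']; rfl⟩)
    (by
      rintro x ⟨v, hv, hv'⟩
      exact ⟨-v, neg_mem hv, by rw [map_neg, hv']; rfl⟩)
    (by
      rintro x y ⟨w, hw, hw'⟩
      have hx : (x : S h) ∈ Sminus t := x.2.1
      have hx' : d t B k (x : S h) = 0 := x.2.2
      refine ⟨sigma (x : S h) * w, mul_mem (sigma_mem_Sminus t hx) hw, ?_⟩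
      have : d t B k (sigma (x : S h) * w) = (x : S h) * (y : S h) := by
        rw [d_mul, d_sigma, hx', map_zero, neg_zero, zero_mul, zero_add, sigma_sigma, hw']
      exact this)
    (by
      rintro x y ⟨w, hw, hw'⟩
      have hy : (y : S h) ∈ Sminus t := y.2.1
      have hy' : d t B k (y : S h) = 0 := y.2.2
      refine ⟨w * (y : S h), mul_mem hw hy, ?_⟩
      have : d t B k (w * (y : S h)) = (x : S h) * (y : S h) := by
        rw [d_mul, hw', hy', mul_zero, add_zero]
      exact this)

theorem mem_boundaries (z : cocycles t B k) :
    z ∈ boundaries t B k ↔ ∃ w ∈ Sminus t, d t B k w = z := by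
  rw [boundaries, TwoSidedIdeal.mem_mk']; rfl

/-- `H(S(R_-), d_-)`, the kernel of `d_-` modulo its image, with the induced product. -/
abbrev Cohomology : Type _ := (boundaries t B k).ringCon.Quotient

/-- The cohomology class of a cocycle. -/
noncomputable def toCohomology : cocycles t B k →ₐ[ℂ] Cohomology t B k :=
  (boundaries t B k).ringCon.mkₐ ℂ

/-- `∂` on cocycles. -/
noncomputable def delCocycles : cocycles t B k →ₗ[ℂ] cocycles t B k :=
  del.restrict (p := (cocycles t B k).toSubmodule) (q := (cocycles t B k).toSubmodule)
    fun x hx => ⟨del_mem_Sminus t hx.1, by rw [d_del, hx.2, map_zero]⟩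

/-- The derivation `∂` on cohomology. -/
noncomputable def delCohomology : Cohomology t B k →ₗ[ℂ] Cohomology t B k where
  toFun := Quotient.map' (delCocycles t B k) (by
    intro x y hxy
    change (boundaries t B k).ringCon _ _ at hxy
    change (boundaries t B k).ringCon _ _
    rw [TwoSidedIdeal.rel_iff, mem_boundaries] at hxy ⊢
    obtain ⟨w, hw, hw'⟩ := hxy
    refine ⟨del w, del_mem_Sminus t hw, ?_⟩
    rw [d_del, hw', ← map_sub]
    rfl)
  map_add' := by
    rintro ⟨x⟩ ⟨y⟩
    exact congrArg (toCohomology t B k) (map_add (delCocycles t B k) x y)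
  map_smul' := by
    rintro c ⟨x⟩
    exact congrArg (toCohomology t B k) (map_smul (delCocycles t B k) c x)

/-- `G` generates the cohomology as a differential algebra: the only `∂`-stable subalgebra
containing `G` is the whole algebra. -/
def DifferentiallyGenerates (G : Set (Cohomology t B k)) : Prop :=
  ∀ T : Subalgebra ℂ (Cohomology t B k), G ⊆ T → (∀ x ∈ T, delCohomology t B k x ∈ T) → T = ⊤

end cohomology

/-- The centralizer `𝔤_f` of `f`. -/
noncomputable def centralizer (f : 𝔤) : Submodule ℂ 𝔤 where
  carrier := {x | ⁅x, f⁆ = 0}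
  add_mem' := by intro x y hx hy; simp_all
  zero_mem' := by simp
  smul_mem' := by intro c x hx; simp_all

end WAlg

set_option linter.unusedSectionVars false
set_option linter.unusedVariables false

namespace WAlg
open SuperSym PVA

/-! ### The `ad h`-grading of `𝔤` and the action of `ad f`. -/

section Grading

variable {𝔤 : Type*} [LieRing 𝔤] [LieAlgebra ℂ 𝔤]

/-! The argument is a filtered homotopy, used in place of a spectral sequence. Extend `a ↦ J_a` from
`⨁_{j ≤ 0} 𝔤(j)` to `𝔤` by `-Φ` on `𝔤(1/2)` and by `0` above; this is `Jext`. With `phiForm y =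
φ^{(y,·)}`, one formula (`d_Jext`) then covers both kinds of even generator: `d (Jext a) = phiForm
[f,a] + ∑ φ^{v^α} Jext [u_α,a] + k ∂ phiForm a`. If `a` is an eigenvector, `phiForm [f,a]` has the
degree of `Jext a` and everything else has lower degree. The differential of `phiForm y` also has
lower degree than `phiForm y`. So to leading order the differential is `ad f`.

By invariance and nondegeneracy of the form, `ad f` maps onto the sum of the `𝔤(j)`, `j < 0`. It is
injective on each `𝔤(j)`, `j > 0`. Choose a graded right inverse `r` of `ad f` on the negative part,
and let the homotopy `s` be the odd derivation with `phiForm y ↦ Jext (r y)` and `Jext a ↦ 0`. The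
even derivation `N = d s + s d` (`laplacian`) respects the filtration. On the associated graded
space it multiplies a monomial by its weight `m`, the number of factors that are not derivatives of
some `J_a` with `a ∈ 𝔤_f` (`laplacian_monomial`). Degrees are nonnegative, so induction on the
degree produces polynomials `R` with `R(0) ≠ 0` such that `R(N)` moves a given element into a
prescribed `N`-stable subspace, as soon as weight-zero monomials lie in that subspace modulo lower
degree (`filCharge_le_invertedInto`).

This is used twice. Charge-one monomials have positive weight, so some `R(N)` kills `d J_a` for `a ∈
𝔤_f`. Since `N` commutes with `d`, the element `R(0)⁻¹ R(N) J_a = J_a + A` is a cocycle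
(`exists_cocycle`). Next, take as the subspace the differential subalgebra generated by these
cocycles, on which `N` vanishes. For a cocycle `z`, `R(N) z` differs from `R(0) z` by a boundary,
because `N z = d s z`; so `z` is cohomologous to an element of the subalgebra
(`exists_cohomologous`). That `d` squares to zero is needed only on `S(R_-)`, where it is checked on
generators. -/

theorem lie_mem_gr {h x y : 𝔤} {i j : ℤ} (hx : x ∈ gr h i) (hy : y ∈ gr h j) :
    ⁅x, y⁆ ∈ gr h (i + j) := by
  rw [mem_gr] at *
  rw [leibniz_lie, hx, hy, smul_lie, lie_smul, ← add_smul]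
  push_cast
  rfl

variable [FiniteDimensional ℂ 𝔤] {h e f : 𝔤}

theorem f_mem_gr (t : IsSl2Triple h e f) : f ∈ gr h (-2) := by
  rw [mem_gr, t.lie_lie_smul_f ℂ]
  push_cast
  rw [neg_smul]

theorem lie_f_mem_gr (t : IsSl2Triple h e f) {y : 𝔤} {j : ℤ} (hy : y ∈ gr h j) :
    ⁅f, y⁆ ∈ gr h (j - 2) := by
  have := lie_mem_gr (f_mem_gr t) hy
  rwa [show -2 + j = j - 2 by ring] at this

/-- Linear maps agreeing on the eigenspaces agree. -/
theorem eq_of_forall_gr (t : IsSl2Triple h e f) {W : Type*} [AddCommGroup W] [Module ℂ W]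
    {L L' : 𝔤 →ₗ[ℂ] W} (H : ∀ i, ∀ x ∈ gr h i, L x = L' x) : L = L' := by
  ext x
  have hx : x ∈ ⨆ i, gr h i := by rw [iSup_gr t]; trivial
  induction hx using Submodule.iSup_induction' with
  | mem i x hx => exact H i x hx
  | zero => simp
  | add x y _ _ hx hy => rw [map_add, map_add, hx, hy]

theorem isCompl_gr (t : IsSl2Triple h e f) (i : ℤ) :
    IsCompl (gr h i) (⨆ j : ℤ, ⨆ _ : j ≠ i, gr h j) := by
  simpa using isCompl_of t (fun j => j = i)

/-- The projection to `gr h i` along the other eigenspaces. -/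
noncomputable def grProj (t : IsSl2Triple h e f) (i : ℤ) : 𝔤 →ₗ[ℂ] 𝔤 :=
  Submodule.subtype _ ∘ₗ Submodule.projectionOnto _ _ (isCompl_gr t i)

theorem grProj_mem (t : IsSl2Triple h e f) (i : ℤ) (x : 𝔤) : grProj t i x ∈ gr h i :=
  Subtype.coe_prop _

theorem grProj_self (t : IsSl2Triple h e f) {i : ℤ} {x : 𝔤} (hx : x ∈ gr h i) :
    grProj t i x = x := by
  simp [grProj, Submodule.projectionOnto_apply_of_mem_left (isCompl_gr t i) hx]

theorem grProj_of_ne (t : IsSl2Triple h e f) {i j : ℤ} (hij : j ≠ i) {x : 𝔤} (hx : x ∈ gr h j) :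
    grProj t i x = 0 := by
  have hx' : x ∈ ⨆ j : ℤ, ⨆ _ : j ≠ i, gr h j :=
    Submodule.mem_iSup_of_mem j (Submodule.mem_iSup_of_mem hij hx)
  rw [grProj, LinearMap.comp_apply, (Submodule.projectionOnto_apply_eq_zero_iff _).2 hx', map_zero]

theorem finite_gr (h : 𝔤) : Set.Finite {i : ℤ | gr h i ≠ ⊥} :=
  WellFoundedGT.finite_ne_bot_of_iSupIndep (iSupIndep_gr h)

/-- The indices of the nonzero eigenspaces. -/
noncomputable def weights (h : 𝔤) : Finset ℤ := (finite_gr h).toFinset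

/-- Only the term `j = i` survives. This lets a linear map on `𝔤` be assembled from a family
prescribed on each eigenspace. -/
theorem sum_grProj_apply (t : IsSl2Triple h e f) {i : ℤ} {x : 𝔤} (hx : x ∈ gr h i)
    {W : Type*} [AddCommGroup W] [Module ℂ W] (L : ℤ → 𝔤 →ₗ[ℂ] W) :
    ∑ j ∈ weights h, L j (grProj t j x) = L i x := by
  rw [Finset.sum_eq_single i, grProj_self t hx]
  · intro j _ hj
    rw [grProj_of_ne t hj.symm hx, map_zero]
  · intro hi
    have : gr h i = ⊥ := by simpa [weights] using hi
    rw [this, Submodule.mem_bot] at hx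
    simp [hx]

theorem sum_grProj (t : IsSl2Triple h e f) (x : 𝔤) : ∑ j ∈ weights h, grProj t j x = x := by
  have : ∑ j ∈ weights h, grProj t j = LinearMap.id := eq_of_forall_gr t fun i x hx => by
    simpa using sum_grProj_apply t hx fun _ => LinearMap.id
  simpa using congrArg (fun L => L x) this

theorem mem_pos {i : ℤ} (hi : 0 < i) {x : 𝔤} (hx : x ∈ gr h i) : x ∈ pos h :=
  Submodule.mem_iSup_of_mem i (Submodule.mem_iSup_of_mem hi hx)

theorem mem_nonpos {i : ℤ} (hi : i ≤ 0) {x : 𝔤} (hx : x ∈ gr h i) : x ∈ nonpos h :=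
  Submodule.mem_iSup_of_mem i (Submodule.mem_iSup_of_mem hi hx)

theorem posProj_of_mem (t : IsSl2Triple h e f) {x : 𝔤} (hx : x ∈ pos h) : posProj t x = ⟨x, hx⟩ :=
  Submodule.projectionOnto_apply_of_mem_left _ hx

theorem posProj_coe (t : IsSl2Triple h e f) (x : pos h) : posProj t (x : 𝔤) = x :=
  posProj_of_mem t x.2

theorem posProj_of_pos (t : IsSl2Triple h e f) {i : ℤ} (hi : 0 < i) {x : 𝔤} (hx : x ∈ gr h i) :
    (posProj t x : 𝔤) = x := by
  rw [posProj_of_mem t (mem_pos hi hx)]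

theorem posProj_of_mem_nonpos (t : IsSl2Triple h e f) {x : 𝔤} (hx : x ∈ nonpos h) :
    posProj t x = 0 :=
  (Submodule.projectionOnto_apply_eq_zero_iff _).2 hx

theorem posProj_of_nonpos (t : IsSl2Triple h e f) {i : ℤ} (hi : i ≤ 0) {x : 𝔤} (hx : x ∈ gr h i) :
    posProj t x = 0 :=
  posProj_of_mem_nonpos t (mem_nonpos hi hx)

theorem halfProj_of_mem (t : IsSl2Triple h e f) {x : 𝔤} (hx : x ∈ gr h 1) :
    halfProj t x = ⟨x, hx⟩ :=
  Submodule.projectionOnto_apply_of_mem_left _ hx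

theorem halfProj_of_ne (t : IsSl2Triple h e f) {i : ℤ} (hi : i ≠ 1) {x : 𝔤} (hx : x ∈ gr h i) :
    halfProj t x = 0 :=
  (Submodule.projectionOnto_apply_eq_zero_iff _).2
    (Submodule.mem_iSup_of_mem i (Submodule.mem_iSup_of_mem hi hx))

theorem lie_mem_pos {x y : 𝔤} (hx : x ∈ pos h) (hy : y ∈ pos h) : ⁅x, y⁆ ∈ pos h := by
  induction hx using Submodule.iSup_induction' with
  | zero => simp
  | add x x' _ _ hx hx' => rw [add_lie]; exact add_mem hx hx'
  | mem i x hx =>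
    by_cases hi : 0 < i
    swap
    · simp [hi] at hx; simp [hx]
    simp only [hi, iSup_pos] at hx
    induction hy using Submodule.iSup_induction' with
    | zero => simp
    | add x x' _ _ hx hx' => rw [lie_add]; exact add_mem hx hx'
    | mem j y hy =>
      by_cases hj : 0 < j
      · simp only [hj, iSup_pos] at hy
        exact mem_pos (add_pos hi hj) (lie_mem_gr hx hy)
      · simp [hj] at hy; simp [hy]

/-- `ad f` is injective on the eigenspaces with positive eigenvalue. -/
theorem eq_zero_of_lie_f_eq_zero (t : IsSl2Triple h e f) {i : ℤ} (hi : 1 ≤ i) {x : 𝔤}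
    (hx : x ∈ gr h i) (hf : ⁅f, x⁆ = 0) : x = 0 := by
  by_contra h0
  -- For the reflected triple `(-h, f, e)` the vector `x` would be primitive of weight `-i`, but in
  -- finite dimension such weights are natural numbers.
  have P : t.symm.HasPrimitiveVectorWith x (-i : ℂ) :=
    ⟨h0, by rw [neg_lie, (mem_gr _ _ _).1 hx, neg_smul], hf⟩
  obtain ⟨n, hn⟩ := P.exists_nat
  have : -i = (n : ℤ) := by exact_mod_cast hn
  omega

/-! ### The invariant form: nondegeneracy, a section of `ad f`, and duality with `𝔫`. -/

section Form

variable {B : LinearMap.BilinForm ℂ 𝔤}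

theorem form_lie_right (hinv : B.lieInvariant 𝔤) (x y z : 𝔤) : B x ⁅y, z⁆ = B ⁅x, y⁆ z := by
  rw [← lie_skew x y, map_neg, LinearMap.neg_apply, hinv, neg_neg]

/-- Invariance under `ad h` gives `(i + j) B x y = 0`. -/
theorem form_eq_zero (hinv : B.lieInvariant 𝔤) {i j : ℤ} (hij : i + j ≠ 0) {x y : 𝔤}
    (hx : x ∈ gr h i) (hy : y ∈ gr h j) : B x y = 0 := by
  rw [mem_gr] at hx hy
  have := hinv h x y
  rw [hx, hy, map_smul, map_smul, LinearMap.smul_apply, smul_eq_mul, smul_eq_mul,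
    ← add_eq_zero_iff_eq_neg, ← add_mul] at this
  refine (mul_eq_zero.1 this).resolve_left ?_
  exact_mod_cast hij

theorem form_grProj (t : IsSl2Triple h e f) (hinv : B.lieInvariant 𝔤) (i : ℤ) (x y : 𝔤) :
    B x (grProj t i y) = B (grProj t (-i) x) y := by
  have : (B.compl₂ (grProj t i)) = B ∘ₗ grProj t (-i) := by
    refine eq_of_forall_gr t fun a x hx => eq_of_forall_gr t fun b y hy => ?_
    simp only [LinearMap.compl₂_apply, LinearMap.comp_apply]
    by_cases hb : b = i
    · subst hb
      rw [grProj_self t hy]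
      by_cases ha : a = -b
      · subst ha; rw [grProj_self t hx]
      · rw [grProj_of_ne t ha hx, form_eq_zero hinv (by omega) hx hy]; simp
    · rw [grProj_of_ne t hb hy, map_zero, eq_comm]
      exact form_eq_zero hinv (by omega) (grProj_mem t _ x) hy
  exact LinearMap.congr_fun₂ this x y

/-- The radical is an ideal, and it is not all of the simple algebra because it does not contain
`e`. -/
theorem form_nondegenerate [LieAlgebra.IsSimple ℂ 𝔤] (hsymm : B.IsSymm)
    (hinv : B.lieInvariant 𝔤) (hB : B e f ≠ 0) : B.Nondegenerate := by
  refine hsymm.isRefl.nondegenerate_iff_separatingLeft.2 ?_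
  rw [LinearMap.separatingLeft_iff_ker_eq_bot]
  let K : LieIdeal ℂ 𝔤 :=
    { LinearMap.ker B with
      lie_mem := by
        intro x m hm
        have hm' : B m = 0 := hm
        change B ⁅x, m⁆ = 0
        ext z
        rw [hinv, hm']; simp }
  rcases LieAlgebra.IsSimple.eq_bot_or_eq_top K with hK | hK
  · have : K.toSubmodule = LinearMap.ker B := rfl
    rw [← this, hK]; rfl
  · exfalso
    have : e ∈ K := by rw [hK]; trivial
    have h0 : B e = 0 := this
    exact hB (by rw [h0]; rfl)

/-- By invariance the orthogonal of the image of `ad f` is the kernel of `ad f`. An element of that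
kernel has no component in `𝔤(j)`, `j > 0`, and only such a component could pair nontrivially with
`y`. So `y` lies in the double orthogonal of the image. -/
theorem exists_lie_f_eq (t : IsSl2Triple h e f) (hsymm : B.IsSymm) (hinv : B.lieInvariant 𝔤)
    (hB : B.Nondegenerate) {i : ℤ} (hi : i ≤ -1) {y : 𝔤} (hy : y ∈ gr h i) :
    y ∈ LinearMap.range (LieAlgebra.ad ℂ 𝔤 f) := by
  rw [← LinearMap.BilinForm.orthogonal_orthogonal hB hsymm.isRefl (LinearMap.range _),
    LinearMap.BilinForm.mem_orthogonal_iff]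
  intro w hw
  rw [LinearMap.BilinForm.mem_orthogonal_iff] at hw
  have hfw : ⁅f, w⁆ = 0 := by
    refine hB.2 _ fun x => ?_
    have := hw ⁅f, x⁆ ⟨x, rfl⟩
    rwa [hinv, neg_eq_zero] at this
  have hw' : grProj t (-i) w = 0 := by
    refine eq_zero_of_lie_f_eq_zero t (i := -i) (by omega) (grProj_mem t _ _) ?_
    have : LieAlgebra.ad ℂ 𝔤 f ∘ₗ grProj t (-i) = grProj t (-i - 2) ∘ₗ LieAlgebra.ad ℂ 𝔤 f :=
      eq_of_forall_gr t fun j x hx => by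
        simp only [LinearMap.comp_apply, LieAlgebra.ad_apply]
        have h2 := lie_f_mem_gr t hx
        by_cases hj : j = -i
        · subst hj; rw [grProj_self t hx, grProj_self t h2]
        · rw [grProj_of_ne t hj hx, grProj_of_ne t (by omega) h2, lie_zero]
    have h3 := LinearMap.congr_fun this w
    simp only [LinearMap.comp_apply, LieAlgebra.ad_apply, hfw, map_zero] at h3
    exact h3
  change B w y = 0
  have h4 := form_grProj t hinv i w y
  rwa [hw', grProj_self t hy, map_zero, LinearMap.zero_apply] at h4

/-- A graded right inverse of `ad f` on the sum of the `𝔤(j)`, `j < 0`. -/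
theorem exists_lie_f_section (t : IsSl2Triple h e f) (hsymm : B.IsSymm) (hinv : B.lieInvariant 𝔤)
    (hB : B.Nondegenerate) : ∃ r : 𝔤 →ₗ[ℂ] 𝔤,
      (∀ i ≤ -1, ∀ y ∈ gr h i, r y ∈ gr h (i + 2) ∧ ⁅f, r y⁆ = y) ∧
      ∀ i ≥ 0, ∀ y ∈ gr h i, r y = 0 := by
  obtain ⟨r₀, hr₀⟩ := (LieAlgebra.ad ℂ 𝔤 f : 𝔤 →ₗ[ℂ] 𝔤).rangeRestrict.exists_rightInverse_of_surjective
    (LinearMap.range_rangeRestrict _)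
  obtain ⟨r₁, hr₁⟩ := LinearMap.exists_extend r₀
  have hr : ∀ y ∈ LinearMap.range (LieAlgebra.ad ℂ 𝔤 f), ⁅f, r₁ y⁆ = y := by
    intro y hy
    have h1 := LinearMap.congr_fun hr₁ ⟨y, hy⟩
    have h2 := congrArg Subtype.val (LinearMap.congr_fun hr₀ ⟨y, hy⟩)
    simp only [LinearMap.comp_apply, Submodule.subtype_apply] at h1
    rw [h1]
    exact h2
  -- An arbitrary linear right inverse is made graded: on `gr h i` only the component of its value
  -- in `gr h (i + 2)` is kept, which suffices because `ad f` shifts the index by `-2`.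
  let L : ℤ → 𝔤 →ₗ[ℂ] 𝔤 := fun i => if i ≤ -1 then grProj t (i + 2) ∘ₗ r₁ else 0
  have hL : ∀ i, ∀ y ∈ gr h i, (∑ j ∈ weights h, L j ∘ₗ grProj t j) y = L i y := by
    intro i y hy
    rw [LinearMap.sum_apply]
    exact sum_grProj_apply t hy L
  refine ⟨∑ j ∈ weights h, L j ∘ₗ grProj t j, fun i hi y hy => ?_, fun i hi y hy => ?_⟩
  · rw [hL i y hy]
    simp only [L, if_pos hi, LinearMap.comp_apply]
    refine ⟨grProj_mem t _ _, ?_⟩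
    have h1 := hr y (exists_lie_f_eq t hsymm hinv hB hi hy)
    have : LieAlgebra.ad ℂ 𝔤 f ∘ₗ grProj t (i + 2) = grProj t i ∘ₗ LieAlgebra.ad ℂ 𝔤 f :=
      eq_of_forall_gr t fun j x hx => by
        simp only [LinearMap.comp_apply, LieAlgebra.ad_apply]
        have h2 := lie_f_mem_gr t hx
        by_cases hj : j = i + 2
        · subst hj; rw [grProj_self t hx, grProj_self t (by simpa using h2)]
        · rw [grProj_of_ne t hj hx, grProj_of_ne t (by omega) h2, lie_zero]
    have h3 := LinearMap.congr_fun this (r₁ y)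
    simp only [LinearMap.comp_apply, LieAlgebra.ad_apply] at h3
    rw [h3, h1, grProj_self t hy]
  · rw [hL i y hy]
    simp [L, show ¬ i ≤ -1 by omega]

/-- The restriction of `B y` to `𝔫`. -/
noncomputable def formDual (B : LinearMap.BilinForm ℂ 𝔤) : 𝔤 →ₗ[ℂ] Module.Dual ℂ (pos h) :=
  (Submodule.dualRestrict (pos h)) ∘ₗ B

theorem formDual_apply (y : 𝔤) (x : pos h) : formDual B y x = B y (x : 𝔤) := rfl

theorem formDual_eq_zero (hinv : B.lieInvariant 𝔤) {i : ℤ} (hi : 0 ≤ i) {y : 𝔤}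
    (hy : y ∈ gr h i) : formDual (h := h) B y = 0 := by
  ext ⟨x, hx⟩
  rw [formDual_apply, LinearMap.zero_apply]
  dsimp only
  induction hx using Submodule.iSup_induction' with
  | zero => simp
  | add x y _ _ hx hy => rw [map_add, hx, hy, add_zero]
  | mem j x hx =>
    by_cases hj : 0 < j
    · simp only [hj, iSup_pos] at hx
      exact form_eq_zero hinv (by omega) hy hx
    · simp [hj] at hx; simp [hx]

/-- Every functional on `𝔫` is represented by an element of the sum of the `𝔤(j)`, `j < 0`. -/
theorem exists_formDual_section (t : IsSl2Triple h e f) (hinv : B.lieInvariant 𝔤)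
    (hB : B.Nondegenerate) : ∃ η : Module.Dual ℂ (pos h) →ₗ[ℂ] 𝔤,
      (∀ θ, formDual B (η θ) = θ) ∧ (∀ i ≤ -1, ∀ y ∈ gr h i, η (formDual B y) = y) := by
  have key : ∀ θ : Module.Dual ℂ 𝔤, ∀ x, B ((B.toDual hB).symm θ) x = θ x :=
    fun θ x => LinearMap.BilinForm.apply_toDual_symm_apply θ x
  -- A functional on `𝔫` is extended by zero to the nonpositive part and then represented through
  -- `B`.
  refine ⟨(B.toDual hB).symm.toLinearMap ∘ₗ (posProj t).dualMap, fun θ => ?_, fun i hi y hy => ?_⟩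
  · ext x
    rw [formDual_apply, LinearMap.comp_apply, LinearEquiv.coe_coe, key, LinearMap.dualMap_apply,
      posProj_coe]
  · rw [← sub_eq_zero]
    refine hB.1 _ fun x => ?_
    rw [map_sub, LinearMap.sub_apply, sub_eq_zero, LinearMap.comp_apply, LinearEquiv.coe_coe, key,
      LinearMap.dualMap_apply, formDual_apply]
    have : B y ∘ₗ Submodule.subtype _ ∘ₗ posProj t = B y := eq_of_forall_gr t fun j x hx => by
      simp only [LinearMap.comp_apply, Submodule.subtype_apply]
      by_cases hj : 0 < j
      · rw [posProj_of_pos t hj hx]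
      · rw [posProj_of_nonpos t (by omega) hx, form_eq_zero hinv (by omega) hy hx]; simp
    exact LinearMap.congr_fun this x

end Form

theorem mem_centralizer {x : 𝔤} : x ∈ centralizer f ↔ ⁅f, x⁆ = 0 := by
  change ⁅x, f⁆ = 0 ↔ _
  rw [← lie_skew, neg_eq_zero]

end Grading

end WAlg

/-! ### Zeroth modes of an odd element on generators, through skewsymmetry. -/

namespace PVA
open SuperSym

variable {V : Type*} [AddCommGroup V] [Module ℂ V] [SuperSpace V]

theorem negLamDel_map_sigma (P : (SuperSym (ℂ[X] ⊗[ℂ] V))[X]) :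
    mapAlgHom sigma (negLamDel P) = negLamDel (mapAlgHom sigma P) := by
  induction P using Polynomial.induction_on' with
  | add p q hp hq => rw [map_add, map_add, hp, hq, map_add, map_add]
  | monomial n p =>
    have : ∀ (n : ℕ) (Q : (SuperSym (ℂ[X] ⊗[ℂ] V))[X]),
        mapAlgHom sigma (((-lamDel) ^ n) Q) = ((-lamDel) ^ n) (mapAlgHom sigma Q) := by
      intro n
      induction n with
      | zero => intro Q; rfl
      | succ n ih =>
        intro Q
        rw [pow_succ, Module.End.mul_apply, ih, Module.End.mul_apply, LinearMap.neg_apply, map_neg,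
          lamDel_map_sigma, LinearMap.neg_apply]
    rw [negLamDel_monomial, this]
    simp [negLamDel_monomial]

/-- The value at `λ = 0` of `P (-λ-∂)`. -/
noncomputable def negDel : (SuperSym (ℂ[X] ⊗[ℂ] V))[X] →ₗ[ℂ] SuperSym (ℂ[X] ⊗[ℂ] V) :=
  ((lcoeff (SuperSym (ℂ[X] ⊗[ℂ] V)) 0).restrictScalars ℂ) ∘ₗ negLamDel

theorem negDel_apply (P : (SuperSym (ℂ[X] ⊗[ℂ] V))[X]) :
    negDel P = (negLamDel P).coeff 0 := rfl

theorem negDel_C (p : SuperSym (ℂ[X] ⊗[ℂ] V)) : negDel (C p) = p := by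
  rw [negDel_apply, ← monomial_zero_left, negLamDel_monomial]
  simp

theorem negDel_C_mul_X (p : SuperSym (ℂ[X] ⊗[ℂ] V)) : negDel (C p * X) = -del p := by
  rw [negDel_apply, ← X_mul_C, negLamDel_X_mul, ← monomial_zero_left, negLamDel_monomial]
  simp [coeff_lamDel_zero]

section bracket

variable (β : V →ₗ[ℂ] V →ₗ[ℂ] (SuperSym (ℂ[X] ⊗[ℂ] V))[X])

theorem evenPart_one_tmul {v : V} (hv : parity v = v) :
    evenPart ((1 : ℂ[X]) ⊗ₜ[ℂ] v) = 1 ⊗ₜ v ∧ oddPart ((1 : ℂ[X]) ⊗ₜ[ℂ] v) = 0 := by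
  have : parity ((1 : ℂ[X]) ⊗ₜ[ℂ] v) = 1 ⊗ₜ v := by
    simp only [parity, LinearMap.lTensor_tmul]
    exact congrArg _ hv
  constructor
  · simp only [evenPart, LinearMap.smul_apply, LinearMap.add_apply, LinearMap.id_apply, this]
    module
  · simp [oddPart, this]

theorem oddPart_one_tmul {v : V} (hv : parity v = -v) :
    evenPart ((1 : ℂ[X]) ⊗ₜ[ℂ] v) = 0 ∧ oddPart ((1 : ℂ[X]) ⊗ₜ[ℂ] v) = 1 ⊗ₜ v := by
  have : parity ((1 : ℂ[X]) ⊗ₜ[ℂ] v) = -(1 ⊗ₜ v) := by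
    simp only [parity, LinearMap.lTensor_tmul]
    rw [← TensorProduct.tmul_neg]
    exact congrArg _ hv
  constructor
  · simp [evenPart, this]
  · simp only [oddPart, LinearMap.smul_apply, LinearMap.sub_apply, LinearMap.id_apply, this]
    module

theorem genBracket_one_tmul (v w : V) : genBracket β (1 ⊗ₜ v) (1 ⊗ₜ w) = β v w := by
  simp [genBracket, genBracketAux]

theorem superDeriv_zero {M : Type*} [AddCommGroup M] [Module ℂ M] [SuperSpace M] {B : Type*} [Ring B]
    [Algebra ℂ B] {j : SuperSym M →ₐ[ℂ] B} {s : B →ₐ[ℂ] B} (H : IsSuperExt j s) (ε : Bool) :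
    superDeriv H ε (0 : M →ₗ[ℂ] B) = 0 :=
  map_zero (superDerivL H ε)

/-- `superDeriv` replaces the prescribed values by their part of the right parity; this is the
source of the average over `sigma`. -/
theorem zeroMode_gen {f : SuperSym (ℂ[X] ⊗[ℂ] V)} (hf : sigma f = -f) (v : V) :
    zeroMode β f (gen v) =
      (2⁻¹ : ℂ) • (adGen β f (1 ⊗ₜ v) - mapAlgHom sigma (adGen β f (1 ⊗ₜ parity v))).coeff 0 := by
  have h1 : (parity : ℂ[X] ⊗[ℂ] V →ₗ[ℂ] _) (1 ⊗ₜ v) = 1 ⊗ₜ parity v := rfl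
  rw [zeroMode, LinearMap.comp_apply, bracket_of_odd β f hf]
  simp only [gen, LinearMap.comp_apply, TensorProduct.mk_apply, superDeriv_ι, homPart,
    LinearMap.smul_apply, LinearMap.add_apply, AlgHom.toLinearMap_apply, h1, sgn, if_true, neg_smul,
    one_smul, ← sub_eq_add_neg]
  rfl

/-- Skewsymmetry `{f _λ v} = -{v _(-λ-∂) f}` at `λ = 0`. It reduces the zeroth mode to a derivation
`{v _λ ·}` applied to `f`, which the Leibniz rule computes. -/
theorem zeroMode_gen_even {f : SuperSym (ℂ[X] ⊗[ℂ] V)} (hf : sigma f = -f) {v : V}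
    (hv : parity v = v) :
    zeroMode β f (gen v) = -negDel (superDeriv isSuperExt_C false (genBracket β (1 ⊗ₜ v)) f) := by
  obtain ⟨h1, h2⟩ := evenPart_one_tmul hv
  have h3 : adGen β f (1 ⊗ₜ v) =
      -negLamDel (superDeriv isSuperExt_C false (genBracket β (1 ⊗ₜ v)) f) := by
    rw [adGen_apply, h1, h2, genAd_apply, h1, h2, map_zero, superDeriv_zero]
    simp
  -- The value already has the correct parity, so the averaging in `zeroMode_gen` does not change
  -- it.
  have h4 : mapAlgHom sigma (adGen β f (1 ⊗ₜ v)) = -adGen β f (1 ⊗ₜ v) := by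
    rw [h3, map_neg, negLamDel_map_sigma, superDeriv_parity, hf]
    simp [sgn]
  rw [zeroMode_gen β hf, hv, h4, h3, sub_neg_eq_add, ← two_smul ℂ, coeff_smul, smul_smul,
    inv_mul_cancel₀ two_ne_zero, one_smul, coeff_neg, negDel_apply]

/-- As in the even case, except that exchanging two odd elements contributes a further sign. -/
theorem zeroMode_gen_odd {f : SuperSym (ℂ[X] ⊗[ℂ] V)} (hf : sigma f = -f) {v : V}
    (hv : parity v = -v) :
    zeroMode β f (gen v) = negDel (superDeriv isSuperExt_C true (genBracket β (1 ⊗ₜ v)) f) := by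
  obtain ⟨h1, h2⟩ := oddPart_one_tmul hv
  have h3 : adGen β f (1 ⊗ₜ v) =
      negLamDel (superDeriv isSuperExt_C true (genBracket β (1 ⊗ₜ v)) f) := by
    rw [adGen_apply, h1, h2, genAd_apply β (1 ⊗ₜ v), h1, h2, map_zero (genAd β),
      map_zero (genBracket β), superDeriv_zero, hf]
    simp
  have h4 : mapAlgHom sigma (adGen β f (1 ⊗ₜ v)) = adGen β f (1 ⊗ₜ v) := by
    rw [h3, negLamDel_map_sigma, superDeriv_parity, hf]
    simp [sgn]
  rw [zeroMode_gen β hf, hv, TensorProduct.tmul_neg, map_neg, map_neg, h4, h3, sub_neg_eq_add,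
    ← two_smul ℂ, coeff_smul, smul_smul, inv_mul_cancel₀ two_ne_zero, one_smul, negDel_apply]

end bracket
end PVA

namespace WAlg
open SuperSym PVA

variable {𝔤 : Type*} [LieRing 𝔤] [LieAlgebra ℂ 𝔤] [FiniteDimensional ℂ 𝔤] {h e f : 𝔤}

/-! ### Signs and dual-basis sums for the odd generators. -/

section products

theorem parity_one_tmul_odd (v : pos h × Module.Dual ℂ (pos h)) :
    parity ((1 : ℂ[X]) ⊗ₜ[ℂ] ((0, v) : Gen h)) = -(1 ⊗ₜ (0, v)) := by
  change (1 : ℂ[X]) ⊗ₜ[ℂ] parity ((0, v) : Gen h) = _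
  rw [← TensorProduct.tmul_neg]
  simp [parity]

theorem phiStar_mul_phiStar (θ θ' : Module.Dual ℂ (pos h)) :
    phiStar θ * phiStar θ' = -(phiStar θ' * phiStar θ) :=
  ι_odd _ _ (parity_one_tmul_odd _) (parity_one_tmul_odd _)

theorem mul_phiStar (θ : Module.Dual ℂ (pos h)) (a : S h) :
    a * phiStar θ = phiStar θ * sigma a :=
  odd_comm _ (parity_one_tmul_odd _) a

theorem sum_phiStar_swap {ι : Type*} [Fintype ι] (θ : ι → Module.Dual ℂ (pos h))
    (M : ι → ι → S h) :
    ∑ α, ∑ β, phiStar (θ α) * phiStar (θ β) * M α β =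
      -∑ α, ∑ β, phiStar (θ α) * phiStar (θ β) * M β α := by
  rw [Finset.sum_comm, ← Finset.sum_neg_distrib]
  refine Finset.sum_congr rfl fun α _ => ?_
  rw [← Finset.sum_neg_distrib]
  refine Finset.sum_congr rfl fun β _ => ?_
  rw [phiStar_mul_phiStar, neg_mul]

/-- The `φ^θ` anticommute, so only the antisymmetric part of the coefficients contributes. -/
theorem sum_phiStar_antisymm {ι : Type*} [Fintype ι] (θ : ι → Module.Dual ℂ (pos h))
    (M : ι → ι → S h) :
    ∑ α, ∑ β, phiStar (θ α) * phiStar (θ β) * M α β =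
      (2⁻¹ : ℂ) • ∑ α, ∑ β, phiStar (θ α) * phiStar (θ β) * (M α β - M β α) := by
  simp only [mul_sub, Finset.sum_sub_distrib]
  rw [sum_phiStar_swap θ fun α β => M β α, sub_neg_eq_add, ← two_smul ℂ, smul_smul,
    inv_mul_cancel₀ two_ne_zero, one_smul]

/-- The basis of `𝔫` used in the definition of the differential. -/
noncomputable abbrev bas (h : 𝔤) : Module.Basis (Fin (Module.finrank ℂ (pos h))) ℂ (pos h) :=
  Module.finBasis ℂ (pos h)

theorem sum_coord (L : pos h →ₗ[ℂ] S h) (v : pos h) :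
    ∑ α, (bas h).coord α v • L (bas h α) = L v := by
  conv_rhs => rw [← (bas h).sum_repr v, map_sum]
  simp

theorem sum_phiStar (θ : Module.Dual ℂ (pos h)) :
    ∑ α, θ (bas h α) • phiStar ((bas h).coord α) = phiStar θ := by
  conv_rhs => rw [← (bas h).sum_dual_apply_smul_coord θ, map_sum]
  simp

end products

/-! ### The differential on the generators of `S(R)`. -/

section generators

variable (t : IsSl2Triple h e f) (B : LinearMap.BilinForm ℂ 𝔤) (k : ℂ)

/-- `{v _λ ·}` for an even generator `v`. -/
noncomputable def adEven (v : 𝔤 × gr h 1) : S h →ₗ[ℂ] (S h)[X] :=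
  superDeriv isSuperExt_C false (genBracket (vectorBracket h f B k) (1 ⊗ₜ (v, 0)))

/-- `{v _λ ·}` for an odd generator `v`. -/
noncomputable def adOdd (v : pos h × Module.Dual ℂ (pos h)) : S h →ₗ[ℂ] (S h)[X] :=
  superDeriv isSuperExt_C true (genBracket (vectorBracket h f B k) (1 ⊗ₜ (0, v)))

theorem vectorBracket_apply (v w : Gen h) : vectorBracket h f B k v w =
      C (cur ⁅v.1.1, w.1.1⁆) + (k * B v.1.1 w.1.1) • X
        + (w.2.2 v.2.1 + v.2.2 w.2.1 + B f ⁅(v.1.2 : 𝔤), (w.1.2 : 𝔤)⁆) • 1 := rfl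

theorem parity_gen_apply (w : Gen h) : parity w = (w.1, -w.2) := rfl

theorem adEven_gen (v : 𝔤 × gr h 1) (w : Gen h) :
    adEven (f := f) B k v (gen w) = vectorBracket h f B k (v, 0) w := by
  have h1 : (parity : ℂ[X] ⊗[ℂ] Gen h →ₗ[ℂ] _) (1 ⊗ₜ w) = 1 ⊗ₜ parity w := rfl
  rw [adEven, gen, LinearMap.comp_apply, TensorProduct.mk_apply, superDeriv_ι]
  simp only [homPart, LinearMap.smul_apply, LinearMap.add_apply, LinearMap.comp_apply, h1,
    genBracket_one_tmul, vectorBracket_apply, parity_gen_apply, AlgHom.toLinearMap_apply, map_add,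
    map_smul, coe_mapAlgHom, map_C, map_X, map_one, RingHom.coe_coe, sigma_cur]
  simp [sgn]
  simp only [← smul_C]
  module

theorem adOdd_gen (v : pos h × Module.Dual ℂ (pos h)) (w : Gen h) :
    adOdd (f := f) B k v (gen w) = vectorBracket h f B k (0, v) w := by
  have h1 : (parity : ℂ[X] ⊗[ℂ] Gen h →ₗ[ℂ] _) (1 ⊗ₜ w) = 1 ⊗ₜ parity w := rfl
  rw [adOdd, gen, LinearMap.comp_apply, TensorProduct.mk_apply, superDeriv_ι]
  simp only [homPart, LinearMap.smul_apply, LinearMap.add_apply, LinearMap.comp_apply, h1,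
    genBracket_one_tmul, vectorBracket_apply, parity_gen_apply, AlgHom.toLinearMap_apply, map_add,
    map_smul, coe_mapAlgHom, map_C, map_X, map_one, RingHom.coe_coe, sigma_cur]
  simp [sgn]
  module

theorem adEven_mul (v : 𝔤 × gr h 1) (x y : S h) :
    adEven (f := f) B k v (x * y) = adEven (f := f) B k v x * C y + C x * adEven (f := f) B k v y := by
  simp [adEven, superDeriv_mul, twist]

theorem adOdd_mul (v : pos h × Module.Dual ℂ (pos h)) (x y : S h) :
    adOdd (f := f) B k v (x * y) =
      adOdd (f := f) B k v x * C y + C (sigma x) * adOdd (f := f) B k v y := by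
  simp [adOdd, superDeriv_mul, twist]

theorem d_gen_even (v : 𝔤 × gr h 1) :
    d t B k (gen (v, 0)) = -negDel (adEven (f := f) B k v (brst t B)) :=
  zeroMode_gen_even _ (sigma_brst t B) (by simp [parity])

theorem d_gen_odd (v : pos h × Module.Dual ℂ (pos h)) :
    d t B k (gen (0, v)) = negDel (adOdd (f := f) B k v (brst t B)) :=
  zeroMode_gen_odd _ (sigma_brst t B) (by simp [parity])

variable {t B k}

theorem adEven_cur (v : 𝔤 × gr h 1) (b : 𝔤) : adEven (f := f) B k v (cur b) =
    C (cur ⁅v.1, b⁆) + (k * B v.1 b) • X := by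
  simp [cur, adEven_gen, vectorBracket_apply]

theorem adEven_neutral (v : 𝔤 × gr h 1) (u : gr h 1) : adEven (f := f) B k v (neutral u) =
    C (algebraMap ℂ (S h) (B f ⁅(v.2 : 𝔤), (u : 𝔤)⁆)) := by
  simp [neutral, adEven_gen, vectorBracket_apply, Algebra.algebraMap_eq_smul_one, ← smul_C]

theorem adEven_phi (v : 𝔤 × gr h 1) (x : pos h) : adEven (f := f) B k v (phi x) = 0 := by
  simp [phi, adEven_gen, vectorBracket_apply]

theorem adEven_phiStar (v : 𝔤 × gr h 1) (θ : Module.Dual ℂ (pos h)) :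
    adEven (f := f) B k v (phiStar θ) = 0 := by
  simp [phiStar, adEven_gen, vectorBracket_apply]

theorem adOdd_cur (v : pos h × Module.Dual ℂ (pos h)) (b : 𝔤) :
    adOdd (f := f) B k v (cur b) = 0 := by
  have h2 : (cur b : S h) = gen ((b, 0), 0) := rfl
  rw [h2, adOdd_gen, vectorBracket_apply]
  simp

theorem adOdd_neutral (v : pos h × Module.Dual ℂ (pos h)) (u : gr h 1) :
    adOdd (f := f) B k v (neutral u) = 0 := by
  simp [neutral, adOdd_gen, vectorBracket_apply]

theorem adOdd_phi (v : pos h × Module.Dual ℂ (pos h)) (x : pos h) :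
    adOdd (f := f) B k v (phi x) = C (algebraMap ℂ (S h) (v.2 x)) := by
  simp [phi, adOdd_gen, vectorBracket_apply, Algebra.algebraMap_eq_smul_one, ← smul_C]

theorem adOdd_phiStar (v : pos h × Module.Dual ℂ (pos h)) (θ : Module.Dual ℂ (pos h)) :
    adOdd (f := f) B k v (phiStar θ) = C (algebraMap ℂ (S h) (θ v.1)) := by
  simp [phiStar, adOdd_gen, vectorBracket_apply, Algebra.algebraMap_eq_smul_one, ← smul_C]

theorem adEven_algebraMap (v : 𝔤 × gr h 1) (c : ℂ) :
    adEven (f := f) B k v (algebraMap ℂ _ c) = 0 := superDeriv_algebraMap _ _ _ c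

theorem adOdd_algebraMap (v : pos h × Module.Dual ℂ (pos h)) (c : ℂ) :
    adOdd (f := f) B k v (algebraMap ℂ _ c) = 0 := superDeriv_algebraMap _ _ _ c

theorem adEven_brst (v : 𝔤 × gr h 1) : adEven (f := f) B k v (brst t B) =
    ∑ α, C (phiStar ((bas h).coord α)) * (C (cur ⁅v.1, (bas h α : 𝔤)⁆) + (k * B v.1 (bas h α)) • X
      + C (algebraMap ℂ (S h) (B f ⁅(v.2 : 𝔤), (halfProj t (bas h α : 𝔤) : 𝔤)⁆))) := by
  rw [brst]
  simp only [map_add, map_sum, map_smul, adEven_mul, adEven_cur, adEven_phi, adEven_phiStar,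
    adEven_neutral, adEven_algebraMap, zero_mul, mul_zero, zero_add, add_zero,
    Finset.sum_const_zero, smul_zero]

/-- Bracketing `a` with `u_α` gives `[a, u_α] + λ k (a, u_α)`. The substitution `λ ↦ -∂` turns the
central term into the derivative of `φ^{(a,·)}`. -/
theorem d_cur (a : 𝔤) : d t B k (cur a) =
    ∑ α, phiStar ((bas h).coord α) * cur ⁅(bas h α : 𝔤), a⁆ + k • del (phiStar (formDual B a)) := by
  have h1 := d_gen_even t B k (a, 0)
  rw [adEven_brst] at h1
  have h2 : (cur a : S h) = gen ((a, 0), 0) := rfl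
  rw [h2, h1, ← sum_phiStar (formDual B a)]
  simp only [mul_add, map_sum, map_add, map_smul, ZeroMemClass.coe_zero, zero_lie, map_zero, add_zero,
    mul_smul_comm, ← C_mul, negDel_C, negDel_C_mul_X, formDual_apply, Finset.sum_add_distrib,
    Finset.smul_sum, neg_add, ← Finset.sum_neg_distrib, smul_neg, neg_neg, smul_smul]
  congr 1
  refine Finset.sum_congr rfl fun α _ => ?_
  rw [← lie_skew, map_neg, mul_neg, neg_neg]

theorem d_neutral (u : gr h 1) : d t B k (neutral u) =
    -∑ α, B f ⁅(u : 𝔤), (halfProj t (bas h α : 𝔤) : 𝔤)⁆ • phiStar ((bas h).coord α) := by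
  have h1 := d_gen_even t B k (0, u)
  rw [adEven_brst] at h1
  have h2 : (neutral u : S h) = gen ((0, u), 0) := rfl
  rw [h2, h1]
  simp only [zero_lie, map_zero, LinearMap.zero_apply, mul_zero, zero_smul, zero_add, map_sum,
    ← C_mul, negDel_C]
  simp only [Algebra.algebraMap_eq_smul_one, mul_smul_comm, mul_one]

theorem sum_coord_phi (x : pos h) (L : Fin (Module.finrank ℂ (pos h)) → pos h →ₗ[ℂ] S h)
    (θ : Fin (Module.finrank ℂ (pos h)) → Module.Dual ℂ (pos h)) :
    ∑ α, ∑ β, phiStar (θ α) * (((bas h).coord β x) • L α (bas h β)) =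
      ∑ α, phiStar (θ α) * L α x := by
  simp only [← Finset.mul_sum, sum_coord]

/-- The element `[x, y]` of `𝔫`, linear in `x ∈ 𝔤`. -/
noncomputable def posLie (t : IsSl2Triple h e f) (y : 𝔤) : 𝔤 →ₗ[ℂ] pos h :=
  -(posProj t ∘ₗ LieAlgebra.ad ℂ 𝔤 y)

theorem posLie_apply (t : IsSl2Triple h e f) (x y : 𝔤) : posLie t y x = posProj t ⁅x, y⁆ := by
  rw [posLie, LinearMap.neg_apply, LinearMap.comp_apply, LieAlgebra.ad_apply, ← map_neg, lie_skew]

theorem adOdd_brst (v : pos h × Module.Dual ℂ (pos h)) : adOdd (f := f) B k v (brst t B) =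
    ∑ α, C (algebraMap ℂ (S h) ((bas h).coord α v.1)) *
      C (cur (bas h α : 𝔤) + algebraMap ℂ _ (B f (bas h α : 𝔤)) + neutral (halfProj t (bas h α : 𝔤)))
    + (2⁻¹ : ℂ) • ∑ α, ∑ β,
      ((C (algebraMap ℂ (S h) ((bas h).coord α v.1)) * C (phiStar ((bas h).coord β))
        - C (phiStar ((bas h).coord α)) * C (algebraMap ℂ (S h) ((bas h).coord β v.1))) *
          C (phi (posProj t ⁅(bas h β : 𝔤), (bas h α : 𝔤)⁆)) +
        C (phiStar ((bas h).coord α) * phiStar ((bas h).coord β)) *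
          C (algebraMap ℂ (S h) (v.2 (posProj t ⁅(bas h β : 𝔤), (bas h α : 𝔤)⁆)))) := by
  rw [brst]
  simp only [map_add, map_sum, map_smul, adOdd_mul, adOdd_cur, adOdd_phi, adOdd_phiStar,
    adOdd_neutral, adOdd_algebraMap, mul_zero, add_zero, sigma_phiStar, map_mul, map_neg,
    neg_mul, mul_neg, neg_neg, sub_eq_add_neg]

theorem d_phiStar (θ : Module.Dual ℂ (pos h)) : d t B k (phiStar θ) =
    (2⁻¹ : ℂ) • ∑ α, ∑ β, phiStar ((bas h).coord α) * phiStar ((bas h).coord β) *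
      algebraMap ℂ (S h) (θ (posProj t ⁅(bas h β : 𝔤), (bas h α : 𝔤)⁆)) := by
  have h1 := d_gen_odd t B k (0, θ)
  rw [adOdd_brst] at h1
  have h2 : (phiStar θ : S h) = gen (0, (0, θ)) := rfl
  rw [h2, h1]
  simp only [map_zero, zero_mul, mul_zero, sub_zero, zero_add, Finset.sum_const_zero,
    ← C_mul, map_smul, map_sum, negDel_C]

/-- Contraction with `φ_x` removes one `φ^{v^α}` from each term of `d`. In `d (J a)` this is what
replaces the `𝔫`-part of a current by constants and `Φ`. -/
theorem d_phi (x : pos h) : d t B k (phi x) =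
    J t (x : 𝔤) + algebraMap ℂ _ (B f (x : 𝔤)) + neutral (halfProj t (x : 𝔤)) := by
  have h1 := d_gen_odd t B k (x, 0)
  rw [adOdd_brst] at h1
  have h2 : (phi x : S h) = gen (0, (x, 0)) := rfl
  have h3 : J t (x : 𝔤) = cur (x : 𝔤) + ∑ α, phiStar ((bas h).coord α) *
    phi (posProj t ⁅(bas h α : 𝔤), (x : 𝔤)⁆) := rfl
  -- `h4` and `h5` contract `x` with the first and with the second odd factor of the cubic term. The
  -- two contributions agree after signs, which cancels the factor `1/2`.
  have h4 : ∑ α, ∑ β, (bas h).coord α x • (phiStar ((bas h).coord β) *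
      phi (posProj t ⁅(bas h β : 𝔤), (bas h α : 𝔤)⁆)) = ∑ α, phiStar ((bas h).coord α) *
        phi (posProj t ⁅(bas h α : 𝔤), (x : 𝔤)⁆) := by
    have := sum_coord_phi x (fun β => phi ∘ₗ posProj t ∘ₗ
      LieAlgebra.ad ℂ 𝔤 (bas h β : 𝔤) ∘ₗ Submodule.subtype _) (bas h).coord
    simp only [LinearMap.comp_apply, Submodule.subtype_apply, LieAlgebra.ad_apply,
      mul_smul_comm] at this
    rw [Finset.sum_comm, this]
  have h5 : ∑ α, ∑ β, (bas h).coord β x • (phiStar ((bas h).coord α) *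
      phi (posProj t ⁅(bas h β : 𝔤), (bas h α : 𝔤)⁆)) = -∑ α, phiStar ((bas h).coord α) *
        phi (posProj t ⁅(bas h α : 𝔤), (x : 𝔤)⁆) := by
    have := sum_coord_phi x (fun α => phi ∘ₗ posLie t (bas h α : 𝔤) ∘ₗ Submodule.subtype _)
      (bas h).coord
    simp only [LinearMap.comp_apply, Submodule.subtype_apply, posLie_apply, mul_smul_comm] at this
    rw [this, ← Finset.sum_neg_distrib]
    refine Finset.sum_congr rfl fun α _ => ?_
    rw [← lie_skew, map_neg, map_neg, mul_neg]
  have h6 := sum_coord (cur ∘ₗ Submodule.subtype _) x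
  have h7 := sum_coord (Algebra.linearMap ℂ (S h) ∘ₗ B f ∘ₗ Submodule.subtype _) x
  have h8 := sum_coord (neutral ∘ₗ halfProj t ∘ₗ Submodule.subtype _) x
  simp only [LinearMap.comp_apply, Submodule.subtype_apply, Algebra.linearMap_apply,
    Algebra.algebraMap_eq_smul_one] at h6 h7 h8
  simp only [smul_comm _ (B f _) (1 : S h)] at h7
  rw [h2, h1, h3]
  simp only [LinearMap.zero_apply, map_zero, mul_zero, add_zero, ← C_mul, ← C_sub, map_sum,
    map_add, map_smul, negDel_C, sub_mul, mul_add]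
  simp only [Algebra.algebraMap_eq_smul_one, mul_smul_comm, mul_one, smul_mul_assoc, one_mul,
    Finset.sum_sub_distrib, h4, h5, Finset.sum_add_distrib, h6, h7, h8]
  module

end generators

end WAlg

namespace WAlg
open SuperSym PVA

variable {𝔤 : Type*} [LieRing 𝔤] [LieAlgebra ℂ 𝔤] [FiniteDimensional ℂ 𝔤] {h e f : 𝔤}

/-! ### The differential on `S(R_-)` and its vanishing square. -/

section differential

variable (t : IsSl2Triple h e f) (B : LinearMap.BilinForm ℂ 𝔤) (k : ℂ)

/-- `J_a` for `a` in the sum of the `𝔤(j)`, `j ≤ 0`, extended by `-Φ_[a]` to `𝔤(1/2)` and by `0` to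
the sum of the `𝔤(j)`, `j ≥ 1`. -/
noncomputable def Jext : 𝔤 →ₗ[ℂ] S h :=
  J t ∘ₗ (LinearMap.id - Submodule.subtype _ ∘ₗ posProj t) - neutral ∘ₗ halfProj t

/-- `φ^(B(y, ·))`. -/
noncomputable def phiForm : 𝔤 →ₗ[ℂ] S h := phiStar ∘ₗ formDual B

variable {t B k}

theorem Jext_apply (a : 𝔤) :
    Jext t a = J t (a - (posProj t a : 𝔤)) - neutral (halfProj t a) := rfl

theorem phiForm_apply (y : 𝔤) : phiForm (h := h) B y = phiStar (formDual B y) := rfl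

theorem Jext_of_nonpos {i : ℤ} (hi : i ≤ 0) {a : 𝔤} (ha : a ∈ gr h i) : Jext t a = J t a := by
  rw [Jext_apply, posProj_of_nonpos t hi ha, halfProj_of_ne t (by omega) ha]
  simp

theorem Jext_of_half {a : 𝔤} (ha : a ∈ gr h 1) : Jext t a = -neutral ⟨a, ha⟩ := by
  rw [Jext_apply, posProj_of_pos t one_pos ha, halfProj_of_mem t ha]
  simp

theorem Jext_eq_zero {i : ℤ} (hi : 2 ≤ i) {a : 𝔤} (ha : a ∈ gr h i) : Jext t a = 0 := by
  rw [Jext_apply, posProj_of_pos t (by omega) ha, halfProj_of_ne t (by omega) ha]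
  simp

theorem phiForm_eq_zero (hinv : B.lieInvariant 𝔤) {i : ℤ} (hi : 0 ≤ i) {y : 𝔤} (hy : y ∈ gr h i) :
    phiForm (h := h) B y = 0 := by
  rw [phiForm_apply, formDual_eq_zero hinv hi hy, map_zero]

theorem sigma_Jext (a : 𝔤) : sigma (Jext t a) = Jext t a := by
  rw [Jext_apply, map_sub, sigma_J, sigma_neutral]

theorem sigma_phiForm (y : 𝔤) : sigma (phiForm (h := h) B y) = -phiForm B y :=
  sigma_phiStar _

theorem Jext_lie_eq_zero {x y : 𝔤} (hx : x ∈ pos h) {j : ℤ} (hj : 1 ≤ j) (hy : y ∈ gr h j) :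
    Jext t ⁅x, y⁆ = 0 := by
  induction hx using Submodule.iSup_induction' with
  | zero => simp
  | add x x' _ _ hx hx' => rw [add_lie, map_add, hx, hx', add_zero]
  | mem i x hx =>
    by_cases hi : 0 < i
    · simp only [hi, iSup_pos] at hx
      exact Jext_eq_zero (by omega) (lie_mem_gr hx hy)
    · simp [hi] at hx; simp [hx]

theorem coe_posProj_lie (x y : pos h) : (posProj t ⁅(x : 𝔤), (y : 𝔤)⁆ : 𝔤) = ⁅(x : 𝔤), (y : 𝔤)⁆ := by
  rw [posProj_of_mem t (lie_mem_pos x.2 y.2)]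

theorem halfProj_posProj (a : 𝔤) : halfProj t (posProj t a : 𝔤) = halfProj t a := by
  have : halfProj t ∘ₗ Submodule.subtype _ ∘ₗ posProj t = halfProj t :=
    eq_of_forall_gr t fun i x hx => by
      simp only [LinearMap.comp_apply, Submodule.subtype_apply]
      by_cases hi : 0 < i
      · rw [posProj_of_pos t hi hx]
      · rw [posProj_of_nonpos t (by omega) hx, halfProj_of_ne t (by omega) hx]; simp
  exact LinearMap.congr_fun this a

theorem form_f_posProj (hinv : B.lieInvariant 𝔤) (a : 𝔤) : B f (posProj t a : 𝔤) = B f a := by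
  have : B f ∘ₗ Submodule.subtype _ ∘ₗ posProj t = B f :=
    eq_of_forall_gr t fun i x hx => by
      simp only [LinearMap.comp_apply, Submodule.subtype_apply]
      by_cases hi : 0 < i
      · rw [posProj_of_pos t hi hx]
      · rw [posProj_of_nonpos t (by omega) hx, form_eq_zero hinv (by omega) (f_mem_gr t) hx]; simp
  exact LinearMap.congr_fun this a

/-- The differential of `φ^θ` is the Chevalley–Eilenberg one, dual to the bracket of `𝔫`, so pairing
it with `L` evaluates `L` on brackets of basis elements. -/
theorem sum_d_phiStar_mul (L : pos h →ₗ[ℂ] S h) :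
    ∑ γ, d t B k (phiStar ((bas h).coord γ)) * L (bas h γ) =
      (2⁻¹ : ℂ) • ∑ α, ∑ β, phiStar ((bas h).coord α) * phiStar ((bas h).coord β) *
        L (posProj t ⁅(bas h β : 𝔤), (bas h α : 𝔤)⁆) := by
  simp only [← sum_coord L (posProj t _), d_phiStar, smul_mul_assoc, Finset.sum_mul, Finset.mul_sum,
    ← Finset.smul_sum, Algebra.algebraMap_eq_smul_one, mul_smul_comm, mul_one]
  congr 1
  rw [Finset.sum_comm]
  refine Finset.sum_congr rfl fun α _ => ?_
  rw [Finset.sum_comm]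

/-- By the Jacobi identity, the operator `ad [u_β, u_α]` is the antisymmetrization of `ad u_β ad
u_α`; antisymmetrizing also absorbs the factor `1/2`. -/
theorem sum_d_phiStar_mul_lie (L : 𝔤 →ₗ[ℂ] S h) (a : 𝔤) :
    ∑ γ, d t B k (phiStar ((bas h).coord γ)) * L ⁅(bas h γ : 𝔤), a⁆ =
      ∑ α, ∑ β, phiStar ((bas h).coord α) * phiStar ((bas h).coord β) *
        L ⁅(bas h β : 𝔤), ⁅(bas h α : 𝔤), a⁆⁆ := by
  have := sum_d_phiStar_mul (t := t) (B := B) (k := k)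
    (-(L ∘ₗ LieAlgebra.ad ℂ 𝔤 a ∘ₗ Submodule.subtype _))
  simp only [LinearMap.neg_apply, LinearMap.comp_apply, LieAlgebra.ad_apply,
    Submodule.subtype_apply, ← map_neg, lie_skew, coe_posProj_lie] at this
  rw [this, sum_phiStar_antisymm _ fun α β => L ⁅(bas h β : 𝔤), ⁅(bas h α : 𝔤), a⁆⁆]
  simp only [← map_sub, ← lie_lie]

/-- The terms from `d_cur` and from the differentials of the `φ^{v^α}` combine to `∑ φ^{v^α}
J_{[u_α,a]}`. The terms `d φ_{π[u_α,a]}` subtract from each `J_{[u_α,a]}` its `𝔫`-part and a `Φ`,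
leaving `Jext`, while the constants `(f, [u_α,a])` add up to `phiForm [f,a]`. -/
theorem d_J (hinv : B.lieInvariant 𝔤) (a : 𝔤) : d t B k (J t a) =
    ∑ α, phiStar ((bas h).coord α) * Jext t ⁅(bas h α : 𝔤), a⁆ + phiForm B ⁅f, a⁆
      + k • del (phiForm B a) := by
  have hJ : ∀ a, J t a = cur a + ∑ α, phiStar ((bas h).coord α) *
    phi (posProj t ⁅(bas h α : 𝔤), a⁆) := fun _ => rfl
  have h1 : ∑ α, phiStar ((bas h).coord α) * J t ⁅(bas h α : 𝔤), a⁆ =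
      ∑ α, phiStar ((bas h).coord α) * cur ⁅(bas h α : 𝔤), a⁆ +
        ∑ γ, d t B k (phiStar ((bas h).coord γ)) * phi (posProj t ⁅(bas h γ : 𝔤), a⁆) := by
    have := sum_d_phiStar_mul_lie (t := t) (B := B) (k := k) (phi ∘ₗ posProj t) a
    simp only [LinearMap.comp_apply] at this
    rw [this]
    simp only [hJ, mul_add, Finset.sum_add_distrib, Finset.mul_sum, mul_assoc]
  have h2 : ∑ α, phiStar ((bas h).coord α) * algebraMap ℂ (S h) (B f ⁅(bas h α : 𝔤), a⁆) =
      -phiForm B ⁅f, a⁆ := by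
    rw [phiForm_apply, ← sum_phiStar (formDual B _), ← Finset.sum_neg_distrib]
    refine Finset.sum_congr rfl fun α _ => ?_
    rw [formDual_apply, ← form_lie_right hinv, ← lie_skew, map_neg, map_neg, mul_neg,
      Algebra.algebraMap_eq_smul_one, mul_smul_comm, mul_one]
  rw [hJ a, map_add, d_cur, map_sum]
  simp only [d_mul, sigma_phiStar, d_phi, Finset.sum_add_distrib, Jext_apply, mul_add, mul_sub,
    neg_mul, map_sub, Finset.sum_sub_distrib, Finset.sum_neg_distrib, form_f_posProj hinv, h1, h2,
    halfProj_posProj, phiForm_apply]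
  abel

theorem phiForm_eq_sum (y : 𝔤) :
    phiForm B y = ∑ α, B y (bas h α : 𝔤) • phiStar ((bas h).coord α) :=
  (sum_phiStar (formDual B y)).symm

theorem d_neutral_eq (hinv : B.lieInvariant 𝔤) (u : gr h 1) :
    d t B k (neutral u) = -phiForm B ⁅f, (u : 𝔤)⁆ := by
  rw [d_neutral, phiForm_eq_sum]
  congr 1
  refine Finset.sum_congr rfl fun α _ => ?_
  congr 1
  rw [← form_lie_right hinv]
  have : B f ∘ₗ LieAlgebra.ad ℂ 𝔤 (u : 𝔤) ∘ₗ Submodule.subtype _ ∘ₗ halfProj t =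
      B f ∘ₗ LieAlgebra.ad ℂ 𝔤 (u : 𝔤) := eq_of_forall_gr t fun i x hx => by
    simp only [LinearMap.comp_apply, Submodule.subtype_apply, LieAlgebra.ad_apply]
    by_cases hi : i = 1
    · subst hi; rw [halfProj_of_mem t hx]
    · rw [halfProj_of_ne t hi hx, form_eq_zero hinv (by omega) (f_mem_gr t) (lie_mem_gr u.2 hx)]
      simp
  exact LinearMap.congr_fun this _

theorem gr_induction (t : IsSl2Triple h e f) {p : 𝔤 → Prop} (zero : p 0)
    (add : ∀ x y, p x → p y → p (x + y)) (mem : ∀ i, ∀ x ∈ gr h i, p x) (x : 𝔤) : p x := by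
  rw [← sum_grProj t x]
  exact Finset.sum_induction _ p add zero fun i _ => mem i _ (grProj_mem t i x)

/-- The value `-Φ` of `Jext` on `𝔤(1/2)` is chosen so that the formula for currents also gives the
differential of `Φ`. On higher eigenspaces every term vanishes. -/
theorem d_Jext (hinv : B.lieInvariant 𝔤) (a : 𝔤) : d t B k (Jext t a) =
    ∑ α, phiStar ((bas h).coord α) * Jext t ⁅(bas h α : 𝔤), a⁆ + phiForm B ⁅f, a⁆
      + k • del (phiForm B a) := by
  induction a using gr_induction t with
  | zero => simp
  | add x y hx hy =>
    simp only [map_add, lie_add, mul_add, Finset.sum_add_distrib, smul_add, hx, hy]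
    abel
  | mem i a ha =>
    by_cases hi : i ≤ 0
    · rw [Jext_of_nonpos hi ha, d_J hinv]
    · rw [phiForm_eq_zero hinv (by omega) ha]
      simp only [Jext_lie_eq_zero (Subtype.coe_prop _) (show 1 ≤ i by omega) ha, mul_zero,
        Finset.sum_const_zero, zero_add, map_zero, smul_zero, add_zero]
      by_cases hi' : i = 1
      · subst hi'
        rw [Jext_of_half ha, map_neg, d_neutral_eq hinv, neg_neg]
      · rw [Jext_eq_zero (by omega) ha, map_zero,
          phiForm_eq_zero hinv (i := i - 2) (by omega) (lie_f_mem_gr t ha)]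

theorem d_phiForm (hinv : B.lieInvariant 𝔤) (y : 𝔤) : d t B k (phiForm B y) =
    (2⁻¹ : ℂ) • ∑ α, phiStar ((bas h).coord α) * phiForm B ⁅(bas h α : 𝔤), y⁆ := by
  rw [phiForm_apply, d_phiStar, Finset.sum_comm]
  congr 1
  refine Finset.sum_congr rfl fun β _ => ?_
  rw [phiForm_eq_sum, Finset.mul_sum]
  refine Finset.sum_congr rfl fun α _ => ?_
  rw [formDual_apply, coe_posProj_lie, form_lie_right hinv, ← lie_skew, map_neg,
    LinearMap.neg_apply, map_neg, mul_neg, phiStar_mul_phiStar, neg_mul, neg_neg,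
    Algebra.algebraMap_eq_smul_one, mul_smul_comm, mul_one, mul_smul_comm]

theorem sum_phiStar_phiForm (M : Fin (Module.finrank ℂ (pos h)) → 𝔤) :
    ∑ α, phiStar ((bas h).coord α) * phiForm B (M α) =
      ∑ α, ∑ β, phiStar ((bas h).coord α) * phiStar ((bas h).coord β) *
        algebraMap ℂ (S h) (B (M α) (bas h β)) := by
  refine Finset.sum_congr rfl fun α _ => ?_
  rw [phiForm_eq_sum, Finset.mul_sum]
  refine Finset.sum_congr rfl fun β _ => ?_
  rw [Algebra.algebraMap_eq_smul_one, mul_smul_comm, mul_smul_comm, mul_one]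

/-- A cyclic permutation of three odd factors is even, so it leaves their product unchanged. -/
theorem sum_phiStar_cyclic {ι : Type*} [Fintype ι] (θ : ι → Module.Dual ℂ (pos h))
    (c : ι → ι → ι → ℂ) :
    ∑ α, ∑ β, ∑ γ, c α β γ • (phiStar (θ α) * phiStar (θ β) * phiStar (θ γ)) =
      ∑ α, ∑ β, ∑ γ, c β γ α • (phiStar (θ α) * phiStar (θ β) * phiStar (θ γ)) := by
  have h1 : ∀ α β γ, phiStar (θ β) * phiStar (θ γ) * phiStar (θ α) =
      phiStar (θ α) * phiStar (θ β) * phiStar (θ γ) := fun α β γ => by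
    rw [mul_phiStar, map_mul, sigma_phiStar, sigma_phiStar, neg_mul_neg, mul_assoc]
  calc _ = ∑ β, ∑ γ, ∑ α, c β γ α • (phiStar (θ α) * phiStar (θ β) * phiStar (θ γ)) := by
        exact Finset.sum_congr rfl fun β _ => Finset.sum_congr rfl fun γ _ =>
          Finset.sum_congr rfl fun α _ => by rw [h1 α β γ]
    _ = ∑ β, ∑ α, ∑ γ, c β γ α • (phiStar (θ α) * phiStar (θ β) * phiStar (θ γ)) :=
        Finset.sum_congr rfl fun β _ => Finset.sum_comm
    _ = _ := Finset.sum_comm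

/-- The coefficients are `B y [u_α,[u_β,u_γ]]`. The sum is unchanged by cyclic relabelling, and its
three cyclic versions add up to zero by the Jacobi identity. -/
theorem sum_phiForm_lie_lie (hinv : B.lieInvariant 𝔤) (y : 𝔤) :
    ∑ α, ∑ β, phiStar ((bas h).coord α) * phiStar ((bas h).coord β) *
        phiForm B ⁅(bas h β : 𝔤), ⁅(bas h α : 𝔤), y⁆⁆ = 0 := by
  let c : Fin (Module.finrank ℂ (pos h)) → Fin (Module.finrank ℂ (pos h)) →
    Fin (Module.finrank ℂ (pos h)) → ℂ := fun α β γ =>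
      B y ⁅(bas h α : 𝔤), ⁅(bas h β : 𝔤), (bas h γ : 𝔤)⁆⁆
  have h0 : ∀ α β γ, c α β γ + c β γ α + c γ α β = 0 := fun α β γ => by
    simp only [c, ← map_add, lie_jacobi, map_zero]
  have h1 : ∑ α, ∑ β, phiStar ((bas h).coord α) * phiStar ((bas h).coord β) *
        phiForm B ⁅(bas h β : 𝔤), ⁅(bas h α : 𝔤), y⁆⁆ = ∑ α, ∑ β, ∑ γ,
      c α β γ • (phiStar ((bas h).coord α) * phiStar ((bas h).coord β) *
        phiStar ((bas h).coord γ)) := by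
    refine Finset.sum_congr rfl fun α _ => Finset.sum_congr rfl fun β _ => ?_
    rw [phiForm_eq_sum, Finset.mul_sum]
    refine Finset.sum_congr rfl fun γ _ => ?_
    rw [hinv, hinv, neg_neg, mul_smul_comm]
  have h2 := sum_phiStar_cyclic (bas h).coord c
  have h3 := sum_phiStar_cyclic (bas h).coord fun α β γ => c β γ α
  have h4 : (3 : ℂ) • ∑ α, ∑ β, ∑ γ,
      c α β γ • (phiStar ((bas h).coord α) * phiStar ((bas h).coord β) *
        phiStar ((bas h).coord γ)) = 0 := by
    rw [show (3 : ℂ) = 1 + 1 + 1 by norm_num, add_smul, add_smul, one_smul]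
    nth_rewrite 2 [h2]
    nth_rewrite 2 [h2.trans h3]
    simp only [← Finset.sum_add_distrib, ← add_smul, h0, zero_smul, Finset.sum_const_zero]
  rw [h1]
  exact (smul_eq_zero_iff_right (by norm_num)).1 h4

theorem d_d_phiForm (hinv : B.lieInvariant 𝔤) (y : 𝔤) :
    d t B k (d t B k (phiForm B y)) = 0 := by
  have h1 := sum_d_phiStar_mul_lie (t := t) (B := B) (k := k) (phiForm B) y
  rw [sum_phiForm_lie_lie hinv] at h1
  rw [d_phiForm hinv, map_smul, map_sum]
  simp only [d_mul, Finset.sum_add_distrib, h1, sigma_phiStar, d_phiForm hinv, mul_smul_comm,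
    Finset.mul_sum, neg_mul, Finset.sum_neg_distrib, ← Finset.smul_sum, ← mul_assoc,
    sum_phiForm_lie_lie hinv, smul_zero, neg_zero, add_zero]

/-- After antisymmetrization both sides pair `f` with double brackets of `a` and two basis elements;
the Jacobi identity supplies the factor `2` relating them. -/
theorem sum_phiStar_phiForm_f (hinv : B.lieInvariant 𝔤) (a : 𝔤) :
    (2⁻¹ : ℂ) • ∑ α, phiStar ((bas h).coord α) * phiForm B ⁅(bas h α : 𝔤), ⁅f, a⁆⁆ =
      ∑ α, phiStar ((bas h).coord α) * phiForm B ⁅f, ⁅(bas h α : 𝔤), a⁆⁆ := by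
  rw [sum_phiStar_phiForm, sum_phiStar_phiForm,
    sum_phiStar_antisymm _ fun α β => algebraMap ℂ (S h) (B ⁅(bas h α : 𝔤), ⁅f, a⁆⁆ (bas h β)),
    sum_phiStar_antisymm _ fun α β => algebraMap ℂ (S h) (B ⁅f, ⁅(bas h α : 𝔤), a⁆⁆ (bas h β)),
    smul_smul, Finset.smul_sum, Finset.smul_sum]
  refine Finset.sum_congr rfl fun α _ => ?_
  rw [Finset.smul_sum, Finset.smul_sum]
  refine Finset.sum_congr rfl fun β _ => ?_
  have key : ∀ x y : 𝔤, B ⁅x, ⁅f, a⁆⁆ y - B ⁅y, ⁅f, a⁆⁆ x =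
      2 * (B ⁅f, ⁅x, a⁆⁆ y - B ⁅f, ⁅y, a⁆⁆ x) := by
    intro x y
    have e1 : ∀ x y : 𝔤, B ⁅x, ⁅f, a⁆⁆ y = -B f ⁅a, ⁅x, y⁆⁆ := fun x y => by
      rw [hinv, form_lie_right hinv f]
    have e2 : ∀ x y : 𝔤, B ⁅f, ⁅x, a⁆⁆ y = B f ⁅⁅x, a⁆, y⁆ := fun x y => (form_lie_right hinv _ _ _).symm
    have e3 : ⁅a, ⁅x, y⁆⁆ = -(⁅⁅x, a⁆, y⁆ - ⁅⁅y, a⁆, x⁆) := by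
      rw [leibniz_lie, ← lie_skew a x, ← lie_skew a y, lie_neg, ← lie_skew x (⁅y, a⁆ : 𝔤), neg_lie]
      abel
    rw [e1, e1, e2, e2, ← map_sub, ← lie_skew y x, lie_neg, map_neg, e3, map_neg]
    ring
  rw [← map_sub, key, ← map_sub, map_mul, Algebra.algebraMap_eq_smul_one, smul_mul_assoc, one_mul,
    mul_smul_comm, smul_smul, mul_assoc, inv_mul_cancel₀ two_ne_zero, mul_one]

/-- The coefficients `B [u_α,a] u_β` are antisymmetric and the odd generators anticommute, so `∂`
contributes equally from either factor. -/
theorem del_sum_phiStar_phiForm (hinv : B.lieInvariant 𝔤) (a : 𝔤) :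
    (2⁻¹ : ℂ) • del (∑ α, phiStar ((bas h).coord α) * phiForm B ⁅(bas h α : 𝔤), a⁆) =
      ∑ α, phiStar ((bas h).coord α) * del (phiForm B ⁅(bas h α : 𝔤), a⁆) := by
  have h1 : ∑ α, del (phiStar ((bas h).coord α)) * phiForm B ⁅(bas h α : 𝔤), a⁆ =
      ∑ α, phiStar ((bas h).coord α) * del (phiForm B ⁅(bas h α : 𝔤), a⁆) := by
    simp only [phiForm_eq_sum, map_sum, map_smul, Finset.mul_sum, mul_smul_comm]
    rw [Finset.sum_comm]
    refine Finset.sum_congr rfl fun β _ => Finset.sum_congr rfl fun α _ => ?_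
    rw [mul_phiStar, sigma_del, sigma_phiStar, map_neg, mul_neg, hinv, hinv,
      ← lie_skew (bas h α : 𝔤), map_neg, neg_neg]
    module
  rw [map_sum]
  simp only [del_mul, Finset.sum_add_distrib, h1]
  rw [← two_smul ℂ, smul_smul, inv_mul_cancel₀ two_ne_zero, one_smul]

/-- The double sum of `Jext [u_β,[u_α,a]]` appears once from differentiating `φ^{v^α}` and once,
with the opposite sign, from `Jext [u_α,a]`. The terms with `f` and with `∂` cancel by the two
preceding identities. -/
theorem d_d_Jext (hinv : B.lieInvariant 𝔤) (a : 𝔤) :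
    d t B k (d t B k (Jext t a)) = 0 := by
  have h1 := sum_d_phiStar_mul_lie (t := t) (B := B) (k := k) (Jext t) a
  rw [d_Jext hinv, map_add, map_add, map_sum, map_smul, d_del, d_phiForm hinv, d_phiForm hinv,
    sum_phiStar_phiForm_f hinv, map_smul, del_sum_phiStar_phiForm hinv]
  simp only [d_mul, Finset.sum_add_distrib, h1, sigma_phiStar, d_Jext hinv, mul_add, neg_mul,
    Finset.sum_neg_distrib, Finset.mul_sum, mul_smul_comm, ← mul_assoc, ← Finset.smul_sum]
  module

end differential
end WAlg

namespace WAlg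
open SuperSym PVA

variable {𝔤 : Type*} [LieRing 𝔤] [LieAlgebra ℂ 𝔤] [FiniteDimensional ℂ 𝔤] {h e f : 𝔤}

/-- An odd derivation of the differential superalgebra `S(R)`. -/
structure IsOddDerivation (D : S h →ₗ[ℂ] S h) : Prop where
  mul : ∀ x y, D (x * y) = D x * y + SuperSym.sigma x * D y
  sigma : ∀ x, D (SuperSym.sigma x) = -SuperSym.sigma (D x)
  del : ∀ x, D (PVA.del x) = PVA.del (D x)

theorem IsOddDerivation.one {D : S h →ₗ[ℂ] S h} (hD : IsOddDerivation D) : D 1 = 0 := by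
  have := hD.mul 1 1
  rwa [mul_one, mul_one, map_one SuperSym.sigma, one_mul, left_eq_add] at this

theorem IsOddDerivation.del_pow {D : S h →ₗ[ℂ] S h} (hD : IsOddDerivation D) (n : ℕ) (x : S h) :
    D ((PVA.del ^ n) x) = (PVA.del ^ n) (D x) := by
  induction n with
  | zero => rfl
  | succ n ih => rw [pow_succ', Module.End.mul_apply, Module.End.mul_apply, hD.del, ih]

theorem isOddDerivation_d (t : IsSl2Triple h e f) (B : LinearMap.BilinForm ℂ 𝔤) (k : ℂ) :
    IsOddDerivation (d t B k) := ⟨d_mul t B k, d_sigma t B k, d_del t B k⟩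

theorem sigma_del_pow (n : ℕ) (x : S h) : sigma ((del ^ n) x) = (del ^ n) (sigma x) := by
  induction n with
  | zero => rfl
  | succ n ih => rw [pow_succ', Module.End.mul_apply, Module.End.mul_apply, sigma_del, ih]

/-! ### The homotopy, an odd derivation lowering the charge. -/

section homotopy

variable (t : IsSl2Triple h e f) (τ : Module.Dual ℂ (pos h) →ₗ[ℂ] 𝔤)

/-- The values of `homotopy` on generators. -/
noncomputable def homotopyGen : Gen h →ₗ[ℂ] S h where
  -- The value on the current `a` cancels the image of the ghost part of `J_a`, so that the
  -- derivation kills every `J_a`.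
  toFun v := Jext t (τ v.2.2) - ∑ α, Jext t (τ ((bas h).coord α)) *
    phi (posProj t ⁅(bas h α : 𝔤), v.1.1⁆)
  map_add' v w := by simp [mul_add, Finset.sum_add_distrib]; abel
  map_smul' c v := by simp [Finset.smul_sum, smul_sub]

theorem homotopyGen_apply (v : Gen h) : homotopyGen t τ v =
    Jext t (τ v.2.2) - ∑ α, Jext t (τ ((bas h).coord α)) *
    phi (posProj t ⁅(bas h α : 𝔤), v.1.1⁆) := rfl

/-- `P(∂) v ↦ P(∂) (homotopyGen v)`. -/
noncomputable def homotopyAux : ℂ[X] ⊗[ℂ] Gen h →ₗ[ℂ] S h :=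
  TensorProduct.lift ((aeval (R := ℂ) (del : Module.End ℂ (S h))).toLinearMap.compl₂
    (homotopyGen t τ))

theorem homotopyAux_tmul (P : ℂ[X]) (v : Gen h) :
    homotopyAux t τ (P ⊗ₜ v) = aeval (R := ℂ) (del : Module.End ℂ (S h)) P (homotopyGen t τ v) := rfl

theorem homotopyAux_delGen (x : ℂ[X] ⊗[ℂ] Gen h) :
    homotopyAux t τ (delGen x) = del (homotopyAux t τ x) := by
  induction x with
  | zero => simp
  | add x y hx hy => simp only [map_add, hx, hy]
  | tmul P v =>
    rw [delGen, LinearMap.rTensor_tmul, LinearMap.mulLeft_apply, homotopyAux_tmul,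
      homotopyAux_tmul, map_mul, aeval_X, Module.End.mul_apply]

theorem homotopyAux_parity (x : ℂ[X] ⊗[ℂ] Gen h) :
    sigma (homotopyAux t τ (parity x)) = -homotopyAux t τ x := by
  induction x with
  | zero => simp
  | add x y hx hy => simp only [map_add, hx, hy, neg_add]
  | tmul P v =>
    have h2 : ∀ x : S h, sigma (aeval (R := ℂ) (del : Module.End ℂ (S h)) P x) =
        aeval (R := ℂ) (del : Module.End ℂ (S h)) P (sigma x) := by
      intro x
      induction P using Polynomial.induction_on' with
      | add p q hp hq => simp only [map_add, LinearMap.add_apply, hp, hq]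
      | monomial n c =>
        simp only [aeval_monomial, Module.End.mul_apply, sigma_del_pow,
          Module.algebraMap_end_apply, map_smul]
    have h3 : sigma (homotopyGen t τ (parity v)) = -homotopyGen t τ v := by
      rw [homotopyGen_apply, homotopyGen_apply, parity_gen_apply]
      simp [sigma_Jext, sigma_phi]
      abel
    have h1 : (parity : ℂ[X] ⊗[ℂ] Gen h →ₗ[ℂ] _) (P ⊗ₜ v) = P ⊗ₜ parity v := rfl
    rw [h1, homotopyAux_tmul, homotopyAux_tmul, h2, h3, map_neg]

/-- The odd derivation with `φ^θ ↦ Jext (τ θ)` and `J_a, φ_x, Φ_[u] ↦ 0`. -/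
noncomputable def homotopy : S h →ₗ[ℂ] S h :=
  superDeriv isSuperExt_id true (homotopyAux t τ)

theorem homotopy_ι (x : ℂ[X] ⊗[ℂ] Gen h) : homotopy t τ (ι x) = homotopyAux t τ x := by
  rw [homotopy, superDeriv_ι]
  simp only [homPart, sgn, LinearMap.smul_apply, LinearMap.add_apply, LinearMap.comp_apply,
    AlgHom.toLinearMap_apply, homotopyAux_parity]
  simp only [if_true, smul_neg, neg_smul, one_smul, neg_neg]
  module

theorem isOddDerivation_homotopy : IsOddDerivation (homotopy t τ) where
  mul x y := superDeriv_mul _ _ _ x y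
  sigma x := by
    have := superDeriv_parity isSuperExt_id true (homotopyAux t τ) x
    rw [sgn, if_pos rfl, neg_smul, one_smul] at this
    rw [eq_neg_iff_add_eq_zero, ← eq_neg_iff_add_eq_zero.1 this, add_comm]
    rfl
  del x := by
    have hmul : ∀ x y, homotopy t τ (x * y) = homotopy t τ x * y + sigma x * homotopy t τ y :=
      fun x y => superDeriv_mul _ _ _ x y
    induction x using SuperSym.induction with
    | hc c =>
      have : del (algebraMap ℂ (S h) c) = 0 := superDeriv_algebraMap _ _ _ c
      rw [this, homotopy, superDeriv_algebraMap, map_zero, map_zero]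
    | hι x => rw [del_ι, homotopy_ι, homotopy_ι, homotopyAux_delGen]
    | hm a b ha hb =>
      simp only [del_mul, map_add, hmul, ha, hb, sigma_del]
      abel
    | ha a b ha hb => simp only [map_add, ha, hb]

theorem homotopy_gen (v : Gen h) : homotopy t τ (gen v) = homotopyGen t τ v := by
  rw [gen, LinearMap.comp_apply, homotopy_ι, TensorProduct.mk_apply, homotopyAux_tmul, map_one,
    Module.End.one_apply]

theorem homotopy_phiStar (θ : Module.Dual ℂ (pos h)) :
    homotopy t τ (phiStar θ) = Jext t (τ θ) := by
  rw [phiStar, LinearMap.comp_apply, homotopy_gen, homotopyGen_apply]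
  simp

theorem homotopy_neutral (u : gr h 1) : homotopy t τ (neutral u) = 0 := by
  rw [neutral, LinearMap.comp_apply, homotopy_gen, homotopyGen_apply]
  simp

theorem homotopy_phi (x : pos h) : homotopy t τ (phi x) = 0 := by
  rw [phi, LinearMap.comp_apply, homotopy_gen, homotopyGen_apply]
  simp

theorem homotopy_cur (a : 𝔤) : homotopy t τ (cur a) =
    -∑ α, Jext t (τ ((bas h).coord α)) * phi (posProj t ⁅(bas h α : 𝔤), a⁆) := by
  rw [cur, LinearMap.comp_apply, homotopy_gen, homotopyGen_apply]
  simp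

theorem homotopy_J (a : 𝔤) : homotopy t τ (J t a) = 0 := by
  have hJ : J t a = cur a + ∑ α, phiStar ((bas h).coord α) *
    phi (posProj t ⁅(bas h α : 𝔤), a⁆) := rfl
  rw [hJ, map_add, map_sum, homotopy_cur]
  simp [(isOddDerivation_homotopy t τ).mul, homotopy_phiStar, homotopy_phi]

theorem homotopy_Jext (a : 𝔤) : homotopy t τ (Jext t a) = 0 := by
  rw [Jext_apply, map_sub, homotopy_J, homotopy_neutral, sub_zero]

end homotopy

/-! ### Monomials adapted to `ad f`, and the filtration by degree. -/

section filtration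

variable (t : IsSl2Triple h e f) (B : LinearMap.BilinForm ℂ 𝔤) (r : 𝔤 →ₗ[ℂ] 𝔤)

/-- Homogeneous generators of `S(R_-)` adapted to a section `r` of `ad f`: `IsGoodGen t B r g p c m`
says that `g` has degree `p/2` and charge `c`, and weight `m = 0` or `m = 1` according to
whether `g` is `J_a` with `a ∈ 𝔤_f` or not. -/
inductive IsGoodGen : S h → ℤ → ℤ → ℕ → Prop
  | cent {i : ℤ} (hi : i ≤ 0) {a : 𝔤} (ha : a ∈ gr h i) (hf : ⁅f, a⁆ = 0) :
      IsGoodGen (Jext t a) (1 - i) 0 0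
  | im {i : ℤ} (hi : i ≤ -1) {y : 𝔤} (hy : y ∈ gr h i) : IsGoodGen (Jext t (r y)) (-i - 1) 0 1
  | form {i : ℤ} (hi : i ≤ -1) {y : 𝔤} (hy : y ∈ gr h i) : IsGoodGen (phiForm B y) (-i - 1) 1 1

/-- Products of derivatives of homogeneous generators, with their degree, charge and weight. -/
inductive IsGoodMonomial : S h → ℤ → ℤ → ℕ → Prop
  | one : IsGoodMonomial 1 0 0 0
  | cons (n : ℕ) {g x : S h} {p p' c c' : ℤ} {m m' : ℕ} (hg : IsGoodGen t B r g p c m)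
      (hx : IsGoodMonomial x p' c' m') :
      IsGoodMonomial ((del ^ n) g * x) (p + p') (c + c') (m + m')

/-- The elements of `S(R_-)` of degree at most `p/2` and charge `c`. -/
noncomputable def filCharge (p c : ℤ) : Submodule ℂ (S h) :=
  Submodule.span ℂ {x | ∃ q ≤ p, ∃ m, IsGoodMonomial t B r x q c m}

variable {t B r}

theorem filCharge_mono {p q : ℤ} (hpq : p ≤ q) (c : ℤ) : filCharge t B r p c ≤ filCharge t B r q c :=
  Submodule.span_mono fun _ ⟨s, hs, m, hx⟩ => ⟨s, hs.trans hpq, m, hx⟩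

theorem IsGoodMonomial.mem {x : S h} {p c : ℤ} {m : ℕ} (hx : IsGoodMonomial t B r x p c m) :
    x ∈ filCharge t B r p c := Submodule.subset_span ⟨p, le_rfl, m, hx⟩

theorem IsGoodGen.monomial {g : S h} {p c : ℤ} {m : ℕ} (hg : IsGoodGen t B r g p c m) (n : ℕ) :
    IsGoodMonomial t B r ((del ^ n) g) p c m := by
  simpa using IsGoodMonomial.cons n hg IsGoodMonomial.one

theorem IsGoodGen.mem {g : S h} {p c : ℤ} {m : ℕ} (hg : IsGoodGen t B r g p c m) :
    g ∈ filCharge t B r p c := (hg.monomial 0).mem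

theorem IsGoodMonomial.mul {x y : S h} {p p' c c' : ℤ} {m m' : ℕ}
    (hx : IsGoodMonomial t B r x p c m) (hy : IsGoodMonomial t B r y p' c' m') :
    IsGoodMonomial t B r (x * y) (p + p') (c + c') (m + m') := by
  induction hx with
  | one => simpa using hy
  | cons n hg _ ih =>
    rw [mul_assoc, add_assoc, add_assoc, add_assoc]
    exact IsGoodMonomial.cons n hg ih

theorem mul_mem_filCharge {x y : S h} {p p' c c' : ℤ} (hx : x ∈ filCharge t B r p c)
    (hy : y ∈ filCharge t B r p' c') : x * y ∈ filCharge t B r (p + p') (c + c') := by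
  have := Submodule.mul_mem_mul hx hy
  rw [filCharge, filCharge, Submodule.span_mul_span] at this
  refine Submodule.span_le.2 ?_ this
  rintro _ ⟨x, ⟨q, hq, m, hx⟩, y, ⟨q', hq', m', hy⟩, rfl⟩
  exact Submodule.subset_span ⟨_, add_le_add hq hq', _, hx.mul hy⟩

/-- A linear map sends `filCharge p c` to `filCharge (p + s) (c + s')` if it does so on monomials. -/
theorem map_mem_filCharge {D : S h →ₗ[ℂ] S h} {s s' : ℤ}
    (hD : ∀ x p c m, IsGoodMonomial t B r x p c m → D x ∈ filCharge t B r (p + s) (c + s'))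
    {x : S h} {p c : ℤ} (hx : x ∈ filCharge t B r p c) : D x ∈ filCharge t B r (p + s) (c + s') := by
  have : filCharge t B r p c ≤ (filCharge t B r (p + s) (c + s')).comap D := by
    refine Submodule.span_le.2 ?_
    rintro x ⟨q, hq, m, hx⟩
    exact filCharge_mono (by omega) _ (hD x q c m hx)
  exact this hx

theorem del_mem_filCharge {x : S h} {p c : ℤ} (hx : x ∈ filCharge t B r p c) :
    del x ∈ filCharge t B r p c := by
  have := map_mem_filCharge (t := t) (B := B) (r := r) (D := del) (s := 0) (s' := 0)
    (fun x p c m hx => by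
      rw [add_zero, add_zero]
      induction hx with
      | one =>
        have : del (1 : S h) = 0 := superDeriv_one _ _ _
        rw [this]; exact zero_mem _
      | cons n hg hx ih =>
        rw [del_mul]
        refine add_mem ?_ (mul_mem_filCharge (hg.monomial n).mem ih)
        rw [← Module.End.mul_apply, ← pow_succ']
        exact mul_mem_filCharge (hg.monomial _).mem hx.mem) hx
  simpa using this

theorem del_pow_mem_filCharge (n : ℕ) {x : S h} {p c : ℤ} (hx : x ∈ filCharge t B r p c) :
    (del ^ n) x ∈ filCharge t B r p c := by
  induction n with
  | zero => exact hx
  | succ n ih => rw [pow_succ', Module.End.mul_apply]; exact del_mem_filCharge ih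

theorem IsGoodGen.sigma_mem {g : S h} {p c : ℤ} {m : ℕ} (hg : IsGoodGen t B r g p c m) :
    sigma g ∈ filCharge t B r p c := by
  have h1 := hg.mem
  cases hg with
  | cent hi ha hf => rwa [sigma_Jext]
  | im hi hy => rwa [sigma_Jext]
  | form hi hy => rw [sigma_phiForm]; exact neg_mem h1

/-- Since `∂` has degree and charge zero, the Leibniz rule carries bounds on generators over to all
monomials. -/
theorem IsOddDerivation.mem_filCharge {D : S h →ₗ[ℂ] S h} (hD : IsOddDerivation D) {s : ℤ}
    (H : ∀ g p c m, IsGoodGen t B r g p c m → D g ∈ filCharge t B r p (c + s))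
    {x : S h} {p c : ℤ} (hx : x ∈ filCharge t B r p c) : D x ∈ filCharge t B r p (c + s) := by
  have := map_mem_filCharge (t := t) (B := B) (r := r) (D := D) (s := 0) (s' := s)
    (fun x p c m hx => by
      rw [add_zero]
      induction hx with
      | one => rw [hD.one]; exact zero_mem _
      | cons n hg hx ih =>
        rw [hD.mul, hD.del_pow, sigma_del_pow]
        refine add_mem ?_ ?_
        · rw [add_right_comm]
          exact mul_mem_filCharge (del_pow_mem_filCharge n (H _ _ _ _ hg)) hx.mem
        · rw [add_assoc]
          exact mul_mem_filCharge (del_pow_mem_filCharge n hg.sigma_mem) ih) hx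
  simpa using this

/-- Nonnegative degrees make induction on the degree terminate. Charge comes only from factors
`phiForm y`, which have weight one, so weight zero forces charge zero. -/
theorem IsGoodMonomial.nonneg {x : S h} {p c : ℤ} {m : ℕ} (hx : IsGoodMonomial t B r x p c m) :
    0 ≤ p ∧ 0 ≤ c ∧ (m = 0 → c = 0) := by
  induction hx with
  | one => simp
  | cons n hg _ ih =>
    obtain ⟨h1, h2, h3⟩ := ih
    cases hg <;> refine ⟨by omega, by omega, by omega⟩

theorem filCharge_eq_bot {p c : ℤ} (hpc : p < 0 ∨ c < 0) : filCharge t B r p c = ⊥ := by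
  rw [filCharge, Submodule.span_eq_bot]
  rintro x ⟨q, hq, m, hx⟩
  have := hx.nonneg
  omega

end filtration

end WAlg

namespace WAlg
open SuperSym PVA

variable {𝔤 : Type*} [LieRing 𝔤] [LieAlgebra ℂ 𝔤] [FiniteDimensional ℂ 𝔤] {h e f : 𝔤}

/-- `r` is a graded section of `ad f` on the sum of the `𝔤(j)`, `j < 0`, and `η` represents
functionals on `𝔫` by elements of the sum of the `𝔤(j)`, `j < 0`. -/
structure IsSection (h f : 𝔤) (B : LinearMap.BilinForm ℂ 𝔤) (r : 𝔤 →ₗ[ℂ] 𝔤)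
    (η : Module.Dual ℂ (pos h) →ₗ[ℂ] 𝔤) : Prop where
  invariant : B.lieInvariant 𝔤
  mem_gr : ∀ i ≤ -1, ∀ y ∈ gr h i, r y ∈ gr h (i + 2)
  lie_f : ∀ i ≤ -1, ∀ y ∈ gr h i, ⁅f, r y⁆ = y
  eq_zero : ∀ i ≥ 0, ∀ y ∈ gr h i, r y = 0
  formDual : ∀ θ, formDual B (η θ) = θ
  apply_formDual : ∀ i ≤ -1, ∀ y ∈ gr h i, η (WAlg.formDual B y) = y

/-! ### Degree and charge of the differential and of the homotopy. -/

section bounds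

variable {t : IsSl2Triple h e f} {B : LinearMap.BilinForm ℂ 𝔤} {k : ℂ} {r : 𝔤 →ₗ[ℂ] 𝔤}
  {η : Module.Dual ℂ (pos h) →ₗ[ℂ] 𝔤} (H : IsSection h f B r η)
include H

/-- Write `a = (a - r [f,a]) + r [f,a]`, where the first summand centralizes `f` and the second is
in the image of `r`. -/
theorem IsSection.Jext_mem {i : ℤ} {a : 𝔤} (ha : a ∈ gr h i) :
    Jext t a ∈ filCharge t B r (1 - i) 0 := by
  by_cases hi : 2 ≤ i
  · rw [Jext_eq_zero hi ha]; exact zero_mem _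
  have hfa := lie_f_mem_gr t ha
  have h1 : Jext t (r ⁅f, a⁆) ∈ filCharge t B r (1 - i) 0 := by
    have := (IsGoodGen.im (t := t) (B := B) (r := r) (i := i - 2) (by omega) hfa).mem
    rwa [show -(i - 2) - 1 = 1 - i by ring] at this
  have h2 : a - r ⁅f, a⁆ ∈ gr h i := by
    have := H.mem_gr (i - 2) (by omega) _ hfa
    rw [sub_add_cancel] at this
    exact sub_mem ha this
  have h3 : ⁅f, a - r ⁅f, a⁆⁆ = 0 := by
    rw [lie_sub, H.lie_f (i - 2) (by omega) _ hfa, sub_self]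
  have h4 : Jext t (a - r ⁅f, a⁆) ∈ filCharge t B r (1 - i) 0 := by
    by_cases hi' : i ≤ 0
    · exact (IsGoodGen.cent hi' h2 h3).mem
    -- Here `i = 1`, where `ad f` is injective, so the centralizing summand is zero.
    · rw [eq_zero_of_lie_f_eq_zero t (by omega) h2 h3, map_zero]; exact zero_mem _
  have := add_mem h4 h1
  rwa [← map_add, sub_add_cancel] at this

theorem IsSection.phiForm_mem {i : ℤ} {y : 𝔤} (hy : y ∈ gr h i) :
    phiForm B y ∈ filCharge t B r (-i - 1) 1 := by
  by_cases hi : 0 ≤ i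
  · rw [phiForm_eq_zero H.invariant hi hy]; exact zero_mem _
  · exact (IsGoodGen.form (by omega) hy).mem

theorem IsSection.homotopy_phiForm (y : 𝔤) :
    homotopy t (r ∘ₗ η) (phiForm B y) = Jext t (r y) := by
  rw [phiForm_apply, homotopy_phiStar, LinearMap.comp_apply]
  induction y using gr_induction t with
  | zero => simp
  | add x y hx hy => simp only [map_add, hx, hy]
  | mem i y hy =>
    by_cases hi : 0 ≤ i
    · rw [formDual_eq_zero H.invariant hi hy, H.eq_zero i hi y hy, map_zero, map_zero]
    · rw [H.apply_formDual i (by omega) y hy]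

theorem IsSection.homotopy_mem {x : S h} {p c : ℤ} (hx : x ∈ filCharge t B r p c) :
    homotopy t (r ∘ₗ η) x ∈ filCharge t B r p (c - 1) := by
  refine (isOddDerivation_homotopy t (r ∘ₗ η)).mem_filCharge (s := -1) (fun g p c m hg => ?_) hx
  cases hg with
  | cent hi ha hf => rw [homotopy_Jext]; exact zero_mem _
  | im hi hy => rw [homotopy_Jext]; exact zero_mem _
  | form hi hy => rw [H.homotopy_phiForm]; exact (IsGoodGen.im hi hy).mem

omit H in
theorem grProj_of_mem_pos (t : IsSl2Triple h e f) {l : ℤ} (hl : l ≤ 0) {x : 𝔤} (hx : x ∈ pos h) :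
    grProj t l x = 0 := by
  induction hx using Submodule.iSup_induction' with
  | zero => simp
  | add x x' _ _ hx hx' => rw [map_add, hx, hx', add_zero]
  | mem i x hx =>
    by_cases hi : 0 < i
    · simp only [hi, iSup_pos] at hx
      exact grProj_of_ne t (by omega) hx
    · simp [hi] at hx; simp [hx]

/-- The basis of `𝔫` need not be homogeneous, so single terms have no visible degree. Projecting one
factor to `gr h l` allows the dual functional to be replaced by its part represented in `gr h (-l)`.
-/
theorem IsSection.sum_phiStar_grProj {l : ℤ} (hl : 0 < l) (L : 𝔤 →ₗ[ℂ] S h) :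
    ∑ α, phiStar ((bas h).coord α) * L (grProj t l (bas h α : 𝔤)) =
      ∑ α, phiForm B (grProj t (-l) (η ((bas h).coord α))) * L (grProj t l (bas h α : 𝔤)) := by
  have hB : ∀ α (x : 𝔤), B (grProj t (-l) (η ((bas h).coord α))) x =
      (bas h).coord α ⟨grProj t l x, mem_pos hl (grProj_mem t l x)⟩ := fun α x => by
    rw [← form_grProj t H.invariant]
    have := LinearMap.congr_fun (H.formDual ((bas h).coord α))
      ⟨grProj t l x, mem_pos hl (grProj_mem t l x)⟩
    rwa [formDual_apply] at this
  have h1 : ∀ β, ∑ α, (bas h).coord α ⟨grProj t l (bas h β : 𝔤), mem_pos hl (grProj_mem t l _)⟩ •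
      L (grProj t l (bas h α : 𝔤)) = L (grProj t l (bas h β : 𝔤)) := fun β => by
    have := sum_coord (L ∘ₗ grProj t l ∘ₗ Submodule.subtype _)
      ⟨grProj t l (bas h β : 𝔤), mem_pos hl (grProj_mem t l _)⟩
    simp only [LinearMap.comp_apply, Submodule.subtype_apply] at this
    rw [this, grProj_self t (grProj_mem t l _)]
  simp only [phiForm_eq_sum, hB, Finset.sum_mul, smul_mul_assoc]
  rw [Finset.sum_comm]
  refine Finset.sum_congr rfl fun β _ => ?_
  simp only [← mul_smul_comm]
  rw [← Finset.mul_sum, h1]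

/-- On the component of index `l` the odd factor has doubled degree `l - 1`, which restores all but
one of the `l` units lost by `L`. -/
theorem IsSection.sum_phiStar_mem {L : 𝔤 →ₗ[ℂ] S h} {q c : ℤ}
    (hL : ∀ l, 0 < l → ∀ x ∈ gr h l, L x ∈ filCharge t B r (q - l) c) :
    ∑ α, phiStar ((bas h).coord α) * L (bas h α : 𝔤) ∈ filCharge t B r (q - 1) (c + 1) := by
  have h1 : ∑ α, phiStar ((bas h).coord α) * L (bas h α : 𝔤) =
      ∑ l ∈ weights h, ∑ α, phiStar ((bas h).coord α) * L (grProj t l (bas h α : 𝔤)) := by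
    rw [Finset.sum_comm]
    refine Finset.sum_congr rfl fun α _ => ?_
    rw [← Finset.mul_sum, ← map_sum, sum_grProj]
  rw [h1]
  refine sum_mem fun l _ => ?_
  by_cases hl : 0 < l
  · rw [H.sum_phiStar_grProj hl]
    refine sum_mem fun α _ => ?_
    have h2 := mul_mem_filCharge (H.phiForm_mem (t := t) (grProj_mem t (-l) (η ((bas h).coord α))))
      (hL l hl _ (grProj_mem t l (bas h α : 𝔤)))
    rwa [show - -l - 1 + (q - l) = q - 1 by ring, add_comm 1 c] at h2
  · simp only [grProj_of_mem_pos t (not_lt.1 hl) (Subtype.coe_prop _), map_zero, mul_zero,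
      Finset.sum_const_zero]
    exact zero_mem _

/-- `phiForm [f,a]` is the only term of doubled degree `1 - i`: the sum over the basis has degree at
most `-i`, the `k ∂` term at most `-i - 1`. -/
theorem IsSection.d_Jext_sub_mem {i : ℤ} {a : 𝔤} (ha : a ∈ gr h i) :
    d t B k (Jext t a) - phiForm B ⁅f, a⁆ ∈ filCharge t B r (-i) 1 := by
  have h1 := H.sum_phiStar_mem (t := t) (L := -(Jext t ∘ₗ LieAlgebra.ad ℂ 𝔤 a)) (q := 1 - i) (c := 0)
    (fun l _ x hx => by
      rw [LinearMap.neg_apply, LinearMap.comp_apply, LieAlgebra.ad_apply, ← map_neg, lie_skew]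
      have := H.Jext_mem (t := t) (lie_mem_gr hx ha)
      rwa [show 1 - (l + i) = 1 - i - l by ring] at this)
  simp only [LinearMap.neg_apply, LinearMap.comp_apply, LieAlgebra.ad_apply, ← map_neg, lie_skew]
    at h1
  have h2 := filCharge_mono (show -i - 1 ≤ -i by omega) _
    (del_mem_filCharge (H.phiForm_mem (t := t) ha))
  rw [d_Jext H.invariant, add_sub_right_comm, add_sub_cancel_right]
  refine add_mem ?_ (Submodule.smul_mem _ k h2)
  rwa [show 1 - i - 1 = -i by ring, zero_add] at h1

theorem IsSection.d_Jext_mem {i : ℤ} {a : 𝔤} (ha : a ∈ gr h i) :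
    d t B k (Jext t a) ∈ filCharge t B r (1 - i) 1 := by
  have h1 := filCharge_mono (show -i ≤ 1 - i by omega) _ (H.d_Jext_sub_mem (t := t) (k := k) ha)
  have h2 := H.phiForm_mem (t := t) (lie_f_mem_gr t ha)
  rw [show -(i - 2) - 1 = 1 - i by ring] at h2
  simpa using add_mem h1 h2

theorem IsSection.d_phiForm_mem {i : ℤ} {y : 𝔤} (hy : y ∈ gr h i) :
    d t B k (phiForm B y) ∈ filCharge t B r (-i - 2) 2 := by
  have h1 := H.sum_phiStar_mem (t := t) (L := -(phiForm B ∘ₗ LieAlgebra.ad ℂ 𝔤 y)) (q := -i - 1)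
    (c := 1) (fun l _ x hx => by
      rw [LinearMap.neg_apply, LinearMap.comp_apply, LieAlgebra.ad_apply, ← map_neg, lie_skew]
      have := H.phiForm_mem (t := t) (lie_mem_gr hx hy)
      rwa [show -(l + i) - 1 = -i - 1 - l by ring] at this)
  simp only [LinearMap.neg_apply, LinearMap.comp_apply, LieAlgebra.ad_apply, ← map_neg, lie_skew]
    at h1
  rw [d_phiForm H.invariant]
  refine Submodule.smul_mem _ _ ?_
  rwa [show -i - 1 - 1 = -i - 2 by ring] at h1

theorem IsSection.d_mem {x : S h} {p c : ℤ} (hx : x ∈ filCharge t B r p c) :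
    d t B k x ∈ filCharge t B r p (c + 1) := by
  refine (isOddDerivation_d t B k).mem_filCharge (s := 1) (fun g p c m hg => ?_) hx
  cases hg with
  | cent hi ha hf => exact H.d_Jext_mem ha
  | im hi hy =>
    have := H.d_Jext_mem (t := t) (k := k) (H.mem_gr _ hi _ hy)
    refine filCharge_mono (by omega) _ this
  | form hi hy => exact filCharge_mono (by omega) _ (H.d_phiForm_mem hy)

end bounds

/-- The anticommutator of the differential and the homotopy. -/
noncomputable def laplacian (t : IsSl2Triple h e f) (B : LinearMap.BilinForm ℂ 𝔤) (k : ℂ)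
    (τ : Module.Dual ℂ (pos h) →ₗ[ℂ] 𝔤) : Module.End ℂ (S h) :=
  d t B k ∘ₗ homotopy t τ + homotopy t τ ∘ₗ d t B k

/-! ### The Laplacian: an even derivation with eigenvalue the weight, to leading order. -/

section laplacian

variable {t : IsSl2Triple h e f} {B : LinearMap.BilinForm ℂ 𝔤} {k : ℂ} {r : 𝔤 →ₗ[ℂ] 𝔤}
  {η : Module.Dual ℂ (pos h) →ₗ[ℂ] 𝔤} {τ : Module.Dual ℂ (pos h) →ₗ[ℂ] 𝔤}

theorem laplacian_apply (x : S h) : laplacian t B k τ x =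
    d t B k (homotopy t τ x) + homotopy t τ (d t B k x) := rfl

/-- The anticommutator of two odd derivations is an even derivation; the mixed terms cancel. -/
theorem laplacian_mul (x y : S h) : laplacian t B k τ (x * y) =
    laplacian t B k τ x * y + x * laplacian t B k τ y := by
  have hs := isOddDerivation_homotopy t τ
  simp only [laplacian_apply, d_mul, hs.mul, map_add, d_sigma, hs.sigma, sigma_sigma]
  noncomm_ring

theorem laplacian_del_pow (n : ℕ) (x : S h) :
    laplacian t B k τ ((del ^ n) x) = (del ^ n) (laplacian t B k τ x) := by
  have hs := isOddDerivation_homotopy t τ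
  have hd := isOddDerivation_d t B k
  simp only [laplacian_apply, hs.del_pow, hd.del_pow, map_add]

theorem laplacian_one : laplacian t B k τ 1 = 0 := by
  rw [laplacian_apply, (isOddDerivation_homotopy t τ).one, (isOddDerivation_d t B k).one, map_zero,
    map_zero, add_zero]

variable (H : IsSection h f B r η)
include H

theorem IsSection.laplacian_mem {x : S h} {p c : ℤ} (hx : x ∈ filCharge t B r p c) :
    laplacian t B k (r ∘ₗ η) x ∈ filCharge t B r p c := by
  have h1 := H.d_mem (k := k) (H.homotopy_mem hx)
  have h2 := H.homotopy_mem (H.d_mem (k := k) hx)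
  rw [sub_add_cancel] at h1
  rw [add_sub_cancel_right] at h2
  exact add_mem h1 h2

/-- To leading order `d` is `Jext a ↦ phiForm [f,a]` and the homotopy is `phiForm y ↦ Jext (r y)`.
With `[f, r y] = y`, their anticommutator fixes `Jext (r y)` and `phiForm y`, and kills `Jext a`
when `[f,a] = 0`. -/
theorem IsSection.laplacian_gen {g : S h} {p c : ℤ} {m : ℕ} (hg : IsGoodGen t B r g p c m) :
    laplacian t B k (r ∘ₗ η) g - (m : ℂ) • g ∈ filCharge t B r (p - 1) c := by
  rw [laplacian_apply]
  cases hg with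
  | @cent i hi a ha hf =>
    have h1 := H.homotopy_mem (H.d_Jext_sub_mem (t := t) (k := k) ha)
    rw [hf, map_zero, sub_zero] at h1
    rw [homotopy_Jext, map_zero, zero_add, Nat.cast_zero, zero_smul, sub_zero]
    exact filCharge_mono (by omega) _ h1
  | @im i hi y hy =>
    have h1 := H.homotopy_mem (H.d_Jext_sub_mem (t := t) (k := k) (H.mem_gr _ hi _ hy))
    rw [H.lie_f _ hi _ hy, map_sub, H.homotopy_phiForm] at h1
    rw [homotopy_Jext, map_zero, zero_add, Nat.cast_one, one_smul]
    exact filCharge_mono (by omega) _ h1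
  | @form i hi y hy =>
    have h1 := H.homotopy_mem (H.d_phiForm_mem (t := t) (k := k) hy)
    have h2 := H.d_Jext_sub_mem (t := t) (k := k) (H.mem_gr _ hi _ hy)
    rw [H.lie_f _ hi _ hy] at h2
    rw [H.homotopy_phiForm, Nat.cast_one, one_smul, add_sub_right_comm]
    exact add_mem (filCharge_mono (by omega) _ h2) (filCharge_mono (by omega) _ h1)

omit H in
theorem leibniz_sub_smul {A : Type*} [Ring A] [Algebra ℂ A] (a b x y : A) (c c' : ℂ) :
    b * x + a * y - (c + c') • (a * x) = (b - c • a) * x + a * (y - c' • x) := by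
  rw [sub_mul, mul_sub, add_smul, smul_mul_assoc, mul_smul_comm]
  abel

/-- By the Leibniz rule the leading eigenvalues of the factors add up to the weight. -/
theorem IsSection.laplacian_monomial {x : S h} {p c : ℤ} {m : ℕ}
    (hx : IsGoodMonomial t B r x p c m) :
    laplacian t B k (r ∘ₗ η) x - (m : ℂ) • x ∈ filCharge t B r (p - 1) c := by
  induction hx with
  | one => rw [laplacian_one]; simp
  | @cons n g x p p' c c' m m' hg hx ih =>
    have h1 := del_pow_mem_filCharge n (H.laplacian_gen (k := k) hg)
    have h2 := add_mem (mul_mem_filCharge h1 hx.mem)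
      (filCharge_mono (show p + (p' - 1) ≤ p - 1 + p' by omega) _
        (mul_mem_filCharge (hg.monomial n).mem ih))
    rw [laplacian_mul, laplacian_del_pow]
    rw [map_sub, map_smul, ← leibniz_sub_smul, ← Nat.cast_add,
      show p - 1 + p' = p + p' - 1 by ring] at h2
    exact h2

end laplacian

/-! ### Vanishing of `d²` on `S(R_-)`, and its spanning monomials. -/

section square

variable {t : IsSl2Triple h e f} {B : LinearMap.BilinForm ℂ 𝔤} {k : ℂ} {r : 𝔤 →ₗ[ℂ] 𝔤}

/-- The square of an odd derivation is an even derivation, so its vanishing can be tested on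
generators. -/
theorem d_d_mul (x y : S h) :
    d t B k (d t B k (x * y)) = d t B k (d t B k x) * y + x * d t B k (d t B k y) := by
  simp only [d_mul, map_add, d_sigma, sigma_sigma]
  noncomm_ring

theorem d_d_monomial (hinv : B.lieInvariant 𝔤) {x : S h} {p c : ℤ} {m : ℕ}
    (hx : IsGoodMonomial t B r x p c m) : d t B k (d t B k x) = 0 := by
  have hd := isOddDerivation_d t B k
  induction hx with
  | one => rw [hd.one, map_zero]
  | cons n hg hx ih =>
    rw [d_d_mul, ih, hd.del_pow, hd.del_pow]
    cases hg with
    | cent => rw [d_d_Jext hinv]; simp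
    | im => rw [d_d_Jext hinv]; simp
    | form => rw [d_d_phiForm hinv]; simp

/-- `S(R_-)` is spanned by the products of derivatives of homogeneous generators. -/
theorem IsSection.Sminus_eq {η : Module.Dual ℂ (pos h) →ₗ[ℂ] 𝔤} (H : IsSection h f B r η) :
    (Sminus t).toSubmodule =
      Submodule.span ℂ {x | ∃ p c m, IsGoodMonomial t B r x p c m} := by
  have hle : ∀ p c, filCharge t B r p c ≤
      Submodule.span ℂ {x | ∃ p c m, IsGoodMonomial t B r x p c m} := fun p c =>
    Submodule.span_mono fun x ⟨q, _, m, hx⟩ => ⟨q, c, m, hx⟩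
  have hmul : ∀ x y, x ∈ Submodule.span ℂ {x | ∃ p c m, IsGoodMonomial t B r x p c m} →
      y ∈ Submodule.span ℂ {x | ∃ p c m, IsGoodMonomial t B r x p c m} →
      x * y ∈ Submodule.span ℂ {x | ∃ p c m, IsGoodMonomial t B r x p c m} := by
    intro x y hx hy
    have := Submodule.mul_mem_mul hx hy
    rw [Submodule.span_mul_span] at this
    refine Submodule.span_mono ?_ this
    rintro _ ⟨x, ⟨p, c, m, hx⟩, y, ⟨p', c', m', hy⟩, rfl⟩
    exact ⟨_, _, _, hx.mul hy⟩
  have hdel : ∀ n x, x ∈ Submodule.span ℂ {x | ∃ p c m, IsGoodMonomial t B r x p c m} →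
      (del ^ n) x ∈ Submodule.span ℂ {x | ∃ p c m, IsGoodMonomial t B r x p c m} := by
    intro n x hx
    have : Submodule.span ℂ {x | ∃ p c m, IsGoodMonomial t B r x p c m} ≤
        (Submodule.span ℂ {x | ∃ p c m, IsGoodMonomial t B r x p c m}).comap (del ^ n) := by
      refine Submodule.span_le.2 ?_
      rintro x ⟨p, c, m, hx⟩
      exact hle p c (del_pow_mem_filCharge n hx.mem)
    exact this hx
  have hJ : ∀ a, Jext t a ∈ Submodule.span ℂ {x | ∃ p c m, IsGoodMonomial t B r x p c m} := by
    intro a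
    induction a using gr_induction t with
    | zero => simp
    | add x y hx hy => rw [map_add]; exact add_mem hx hy
    | mem i a ha => exact hle _ _ (H.Jext_mem ha)
  have hphi : ∀ y, phiForm B y ∈
      Submodule.span ℂ {x | ∃ p c m, IsGoodMonomial t B r x p c m} := by
    intro a
    induction a using gr_induction t with
    | zero => simp
    | add x y hx hy => rw [map_add]; exact add_mem hx hy
    | mem i a ha => exact hle _ _ (H.phiForm_mem ha)
  have hminus : ∀ n g, IsMinusGen t g → (del ^ n) g ∈ Sminus t := fun n g hg =>
    Algebra.subset_adjoin ⟨n, g, hg, rfl⟩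
  have hJ' : ∀ n a, (del ^ n) (Jext t a) ∈ Sminus t := by
    intro n a
    rw [Jext_apply, map_sub]
    refine sub_mem (hminus n _ (.J _ ?_)) (hminus n _ (.neutral _))
    refine (Submodule.projectionOnto_apply_eq_zero_iff (isCompl_pos t)).1 ?_
    change posProj t _ = 0
    rw [map_sub, posProj_coe, sub_self]
  apply le_antisymm
  · intro x (hx : x ∈ Sminus t)
    induction hx using Algebra.adjoin_induction with
    | mem x hx =>
      obtain ⟨n, g, hg, rfl⟩ := hx
      refine hdel n _ ?_
      cases hg with
      | J a ha =>
        have : J t a = Jext t a + neutral (halfProj t a) := by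
          rw [Jext_apply, posProj_of_mem_nonpos t ha]; simp
        have h2 : J t a = Jext t a - Jext t (halfProj t a : 𝔤) := by
          rw [this, Jext_of_half (Subtype.coe_prop _), sub_neg_eq_add]
        rw [h2]
        exact sub_mem (hJ _) (hJ _)
      | phiStar θ =>
        have : phiStar θ = phiForm B (η θ) := by rw [phiForm_apply, H.formDual]
        rw [this]; exact hphi _
      | neutral u =>
        have : neutral u = -Jext t (u : 𝔤) := by rw [Jext_of_half u.2, neg_neg]
        rw [this]; exact neg_mem (hJ _)
    | algebraMap c =>
      rw [Algebra.algebraMap_eq_smul_one]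
      exact Submodule.smul_mem _ _ (Submodule.subset_span ⟨_, _, _, .one⟩)
    | add x y _ _ hx hy => exact add_mem hx hy
    | mul x y _ _ hx hy => exact hmul _ _ hx hy
  · refine Submodule.span_le.2 ?_
    rintro x ⟨p, c, m, hx⟩
    change x ∈ Sminus t
    induction hx with
    | one => exact one_mem _
    | cons n hg hx ih =>
      refine mul_mem ?_ ih
      cases hg with
      | cent => exact hJ' n _
      | im => exact hJ' n _
      | form => exact hminus n _ (.phiStar _)

end square

end WAlg

namespace WAlg
open SuperSym PVA

/-! ### Polynomials in an endomorphism with nonzero constant term. -/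

section annihilated

variable {V : Type*} [AddCommGroup V] [Module ℂ V] {N : Module.End ℂ V}

/-- Isolates the constant term of `R`, which is inverted in constructing both the cocycles and the
cohomologies. -/
theorem aeval_apply_eq (R : ℂ[X]) (x : V) :
    aeval N R x = aeval N R.divX (N x) + R.coeff 0 • x := by
  conv_lhs => rw [← R.divX_mul_X_add]
  simp

theorem aeval_mem {W : Submodule ℂ V} (hW : ∀ x ∈ W, N x ∈ W) (R : ℂ[X]) {x : V} (hx : x ∈ W) :
    aeval N R x ∈ W := by
  induction R using Polynomial.induction_on' with
  | add p q hp hq => rw [map_add]; exact add_mem hp hq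
  | monomial n c =>
    rw [aeval_monomial, Module.End.mul_apply, Module.algebraMap_end_apply]
    refine W.smul_mem c ?_
    induction n with
    | zero => exact hx
    | succ n ih => rw [pow_succ', Module.End.mul_apply]; exact hW _ ih

/-- The vectors sent to `W` by a polynomial in `N` with nonzero constant term. -/
noncomputable def invertedInto {W : Submodule ℂ V} (hW : ∀ x ∈ W, N x ∈ W) : Submodule ℂ V where
  carrier := {x | ∃ R : ℂ[X], R.coeff 0 ≠ 0 ∧ aeval N R x ∈ W}
  zero_mem' := ⟨1, by simp, by simp⟩
  add_mem' := by
    rintro x y ⟨R, hR, hx⟩ ⟨R', hR', hy⟩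
    -- The product works for both vectors, since polynomials in `N` commute and preserve `W`.
    refine ⟨R * R', by rw [mul_coeff_zero]; exact mul_ne_zero hR hR', ?_⟩
    rw [map_add]
    refine add_mem ?_ ?_
    · rw [mul_comm, map_mul, Module.End.mul_apply]; exact aeval_mem hW _ hx
    · rw [map_mul, Module.End.mul_apply]; exact aeval_mem hW _ hy
  smul_mem' := by
    rintro c x ⟨R, hR, hx⟩
    exact ⟨R, hR, by rw [map_smul]; exact W.smul_mem c hx⟩

theorem le_invertedInto {W : Submodule ℂ V} (hW : ∀ x ∈ W, N x ∈ W) : W ≤ invertedInto hW :=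
  fun x hx => ⟨1, by simp, by simpa using hx⟩

/-- If `R` works for `(N - m) x`, then `R (X - m)` works for `x`, with constant term `-m R(0) ≠ 0`.
-/
theorem mem_invertedInto_of_sub {W : Submodule ℂ V} (hW : ∀ x ∈ W, N x ∈ W) {m : ℂ} (hm : m ≠ 0)
    {x : V} (hx : N x - m • x ∈ invertedInto hW) : x ∈ invertedInto hW := by
  obtain ⟨R, hR, hx⟩ := hx
  refine ⟨R * (X - C m), by simp [mul_coeff_zero, hR, hm], ?_⟩
  simpa [Module.algebraMap_end_apply] using hx

end annihilated

/-! ### Inverting the Laplacian by induction on degree, and the corrected `J_a`. -/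

variable {𝔤 : Type*} [LieRing 𝔤] [LieAlgebra ℂ 𝔤] [FiniteDimensional ℂ 𝔤] {h e f : 𝔤}
  {t : IsSl2Triple h e f} {B : LinearMap.BilinForm ℂ 𝔤} {k : ℂ} {r : 𝔤 →ₗ[ℂ] 𝔤}
  {η : Module.Dual ℂ (pos h) →ₗ[ℂ] 𝔤} (H : IsSection h f B r η)

include H

/-- Induction on the degree, starting from the zero space in negative degree. A monomial of weight
`m > 0` has its degree lowered by `N - m`; one of weight zero is handled by `hc`. -/
theorem IsSection.filCharge_le_invertedInto {W : Submodule ℂ (S h)}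
    (hW : ∀ x ∈ W, laplacian t B k (r ∘ₗ η) x ∈ W) {c : ℤ}
    (hc : ∀ x p, IsGoodMonomial t B r x p c 0 → ∃ w ∈ W, x - w ∈ filCharge t B r (p - 1) c) (p : ℤ) :
    filCharge t B r p c ≤ invertedInto hW := by
  have key : ∀ n : ℕ, ∀ p < (n : ℤ), filCharge t B r p c ≤ invertedInto hW := by
    intro n
    induction n with
    | zero =>
      intro p hp
      rw [filCharge_eq_bot (Or.inl (by simpa using hp))]
      exact bot_le
    | succ n ih =>
      intro p hp
      refine Submodule.span_le.2 ?_
      rintro x ⟨q, hq, m, hx⟩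
      by_cases hm : m = 0
      · subst hm
        obtain ⟨w, hw, hxw⟩ := hc x q hx
        have := add_mem (ih (q - 1) (by push_cast at hp; omega) hxw) (le_invertedInto hW hw)
        rwa [sub_add_cancel] at this
      · exact mem_invertedInto_of_sub hW (Nat.cast_ne_zero.2 hm)
          (ih (q - 1) (by push_cast at hp; omega) (H.laplacian_monomial hx))
  exact key (p.toNat + 1) p (by push_cast; omega)

theorem IsSection.d_d {x : S h} (hx : x ∈ Sminus t) : d t B k (d t B k x) = 0 := by
  have h1 : (Sminus t).toSubmodule ≤ (LinearMap.ker (d t B k)).comap (d t B k) := by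
    rw [H.Sminus_eq]
    refine Submodule.span_le.2 ?_
    rintro x ⟨p, c, m, hx⟩
    exact d_d_monomial H.invariant hx
  exact h1 hx

theorem IsSection.filCharge_le (p c : ℤ) : filCharge t B r p c ≤ (Sminus t).toSubmodule := by
  rw [H.Sminus_eq]
  exact Submodule.span_mono fun x ⟨q, _, m, hx⟩ => ⟨q, c, m, hx⟩

theorem IsSection.map_mem_Sminus {D : S h →ₗ[ℂ] S h}
    (hD : ∀ p c, ∀ x ∈ filCharge t B r p c, D x ∈ Sminus t) {x : S h} (hx : x ∈ Sminus t) :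
    D x ∈ Sminus t := by
  have h1 : (Sminus t).toSubmodule ≤ (Sminus t).toSubmodule.comap D := by
    conv_lhs => rw [H.Sminus_eq]
    refine Submodule.span_le.2 ?_
    rintro x ⟨p, c, m, hx⟩
    exact hD p c x hx.mem
  exact h1 hx

theorem IsSection.homotopy_mem_Sminus {x : S h} (hx : x ∈ Sminus t) :
    homotopy t (r ∘ₗ η) x ∈ Sminus t :=
  H.map_mem_Sminus (fun _ _ _ hx => H.filCharge_le _ _ (H.homotopy_mem hx)) hx

theorem IsSection.laplacian_mem_Sminus {x : S h} (hx : x ∈ Sminus t) :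
    laplacian t B k (r ∘ₗ η) x ∈ Sminus t :=
  H.map_mem_Sminus (fun _ _ _ hx => H.filCharge_le _ _ (H.laplacian_mem hx)) hx

/-- Both sides equal `d s d x`, because `d` squares to zero on `S(R_-)`. -/
theorem IsSection.d_laplacian {x : S h} (hx : x ∈ Sminus t) :
    d t B k (laplacian t B k (r ∘ₗ η) x) = laplacian t B k (r ∘ₗ η) (d t B k x) := by
  rw [laplacian_apply, laplacian_apply, map_add, H.d_d (H.homotopy_mem_Sminus hx), H.d_d hx,
    map_zero, add_zero, zero_add]

theorem IsSection.d_aeval_laplacian (R : ℂ[X]) {x : S h} (hx : x ∈ Sminus t) :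
    d t B k (aeval (laplacian t B k (r ∘ₗ η)) R x) =
      aeval (laplacian t B k (r ∘ₗ η)) R (d t B k x) := by
  induction R using Polynomial.induction_on' with
  | add p q hp hq => simp only [map_add, LinearMap.add_apply, hp, hq]
  | monomial n c =>
    simp only [aeval_monomial, Module.End.mul_apply, Module.algebraMap_end_apply, map_smul]
    congr 1
    induction n generalizing x with
    | zero => rfl
    | succ n ih =>
      rw [pow_succ, Module.End.mul_apply, Module.End.mul_apply, ih (H.laplacian_mem_Sminus hx),
        H.d_laplacian hx]

/-- `J_a`, for `a ∈ 𝔤_f`, can be corrected by terms of lower degree to a cocycle. -/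
theorem IsSection.exists_cocycle {i : ℤ} {a : 𝔤} (ha : a ∈ gr h i) (hf : ⁅f, a⁆ = 0) :
    ∃ A ∈ filCharge t B r (-i) 0, d t B k (Jext t a + A) = 0 := by
  have hW : ∀ x ∈ (⊥ : Submodule ℂ (S h)), laplacian t B k (r ∘ₗ η) x ∈ (⊥ : Submodule ℂ (S h)) := by
    simp
  have h1 := H.d_Jext_sub_mem (t := t) (k := k) ha
  rw [hf, map_zero, sub_zero] at h1
  -- The differential of `Jext a` has charge one, and no weight-zero monomial does, so the
  -- hypothesis on those is vacuous and `W = 0` can be taken.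
  obtain ⟨R, hR, hR'⟩ := H.filCharge_le_invertedInto hW (fun x p hx => by
    have := hx.nonneg; omega) _ h1
  rw [Submodule.mem_bot] at hR'
  have hJ : Jext t a ∈ Sminus t := H.filCharge_le _ _ (H.Jext_mem ha)
  -- The correction is chosen so that `Jext a + A = R(0)⁻¹ R(N) Jext a`. Its degree bound comes from
  -- `N (Jext a) = s (d (Jext a))`, since `d (Jext a)` has doubled degree at most `-i` when `[f,a] =
  -- 0`.
  refine ⟨(R.coeff 0)⁻¹ • aeval (laplacian t B k (r ∘ₗ η)) R.divX
    (laplacian t B k (r ∘ₗ η) (Jext t a)), Submodule.smul_mem _ _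
      (aeval_mem (fun x hx => H.laplacian_mem hx) _ ?_), ?_⟩
  · have h2 := H.homotopy_mem h1
    rw [laplacian_apply, homotopy_Jext, map_zero, zero_add]
    exact h2
  · have h2 : Jext t a + (R.coeff 0)⁻¹ • aeval (laplacian t B k (r ∘ₗ η)) R.divX
        (laplacian t B k (r ∘ₗ η) (Jext t a)) =
        (R.coeff 0)⁻¹ • aeval (laplacian t B k (r ∘ₗ η)) R (Jext t a) := by
      rw [aeval_apply_eq R, smul_add, smul_smul, inv_mul_cancel₀ hR, one_smul, add_comm]
    rw [h2, map_smul, H.d_aeval_laplacian R hJ, hR', smul_zero]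

theorem IsGoodMonomial.isMonomial {x : S h} {p c : ℤ} {m : ℕ} (hx : IsGoodMonomial t B r x p c m) :
    ∃ c' : ℕ, c = c' ∧ IsMonomial t x p c' := by
  induction hx with
  | one => exact ⟨0, rfl, .one⟩
  | cons n hg _ ih =>
    obtain ⟨c', rfl, hx⟩ := ih
    cases hg with
    | @cent i hi a ha hf =>
      refine ⟨c', by simp, ?_⟩
      rw [Jext_of_nonpos hi ha, show 1 - i = -i + 1 by ring]
      exact .J n i hi a ha hx
    | @im i hi y hy =>
      refine ⟨c', by simp, ?_⟩
      have h1 := H.mem_gr i hi y hy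
      by_cases hi' : i + 2 ≤ 0
      · rw [Jext_of_nonpos hi' h1, show -i - 1 = -(i + 2) + 1 by ring]
        exact .J n _ hi' _ h1 hx
      -- Now `r y` lies in `𝔤(1/2)`, and the generator is `Φ_[-r y]`, of degree zero.
      · obtain rfl : i = -1 := by omega
        rw [Jext_of_half h1, ← map_neg]
        rw [show -(-1 : ℤ) - 1 + _ = _ from zero_add _]
        exact .neutral n _ hx
    | @form i hi y hy =>
      refine ⟨c' + 1, by push_cast; ring, ?_⟩
      refine .phiStar n (-i) (formDual B y) (fun l hl v hv => ?_) hx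
      exact form_eq_zero H.invariant (by omega) hy hv

theorem IsSection.mem_filtration {x : S h} {p c : ℤ} (hx : x ∈ filCharge t B r p c) :
    x ∈ filtration t p := by
  have : filCharge t B r p c ≤ filtration t p := by
    refine Submodule.span_le.2 ?_
    rintro x ⟨q, hq, m, hx⟩
    obtain ⟨c', _, hx'⟩ := hx.isMonomial H
    exact Submodule.mem_iSup_of_mem q (Submodule.mem_iSup_of_mem hq
      (Submodule.subset_span ⟨c', hx'⟩))
  exact this hx

theorem IsSection.mem_chargePiece {x : S h} {p : ℤ} {c : ℕ} (hx : x ∈ filCharge t B r p c) :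
    x ∈ chargePiece t c := by
  have : filCharge t B r p c ≤ chargePiece t c := by
    refine Submodule.span_le.2 ?_
    rintro x ⟨q, hq, m, hx⟩
    obtain ⟨c', hc, hx'⟩ := hx.isMonomial H
    obtain rfl : c = c' := by exact_mod_cast hc
    exact Submodule.subset_span ⟨q, hx'⟩
  exact this hx

/-! ### The corrected elements generate the cohomology. -/

section generation

variable {I : Type*} {u : Module.Basis I ℂ (centralizer f)} {n : I → ℤ}
  (hn : ∀ i, (u i : 𝔤) ∈ gr h (n i)) {A : I → S h}
  (hA : ∀ i, A i ∈ filCharge t B r (-n i) 0) (hd : ∀ i, d t B k (Jext t (u i : 𝔤) + A i) = 0)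

/-- The differential subalgebra generated by the cocycles `Jext (u i) + A i`. -/
noncomputable def cocycleAlgebra (t : IsSl2Triple h e f) (u : Module.Basis I ℂ (centralizer f))
    (A : I → S h) : Subalgebra ℂ (S h) :=
  Algebra.adjoin ℂ {x | ∃ (m : ℕ) (i : I), x = (del ^ m) (Jext t (u i : 𝔤) + A i)}

include hn hA

theorem IsSection.cocycle_mem (i : I) : Jext t (u i : 𝔤) + A i ∈ filCharge t B r (1 - n i) 0 :=
  add_mem (H.Jext_mem (hn i)) (filCharge_mono (by omega) _ (hA i))

omit H hA in
-- Expand `a` in the basis of `𝔤_f` and project to `gr h i`; the basis consists of eigenvectors, so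
-- only those of index `i` remain.
theorem mem_span_of_mem_gr {i : ℤ} {a : 𝔤} (ha : a ∈ gr h i) (hf : ⁅f, a⁆ = 0) (t : IsSl2Triple h e f) :
    a ∈ Submodule.span ℂ {x | ∃ j, n j = i ∧ x = (u j : 𝔤)} := by
  have h1 : (⟨a, mem_centralizer.2 hf⟩ : centralizer f) ∈ Submodule.span ℂ (Set.range u) := by
    rw [u.span_eq]; trivial
  have h2 := Submodule.mem_map_of_mem (f := grProj t i ∘ₗ Submodule.subtype _) h1
  rw [Submodule.map_span, LinearMap.comp_apply, Submodule.subtype_apply, grProj_self t ha] at h2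
  refine Submodule.span_le.2 ?_ h2
  rintro _ ⟨_, ⟨j, rfl⟩, rfl⟩
  rw [LinearMap.comp_apply, Submodule.subtype_apply]
  by_cases hj : n j = i
  · rw [← hj, grProj_self t (hn j)]
    exact Submodule.subset_span ⟨j, rfl, rfl⟩
  · rw [grProj_of_ne t hj (hn j)]; exact zero_mem _

omit H hn in
theorem exists_sub_Jext_mem (l : ℕ) {i : ℤ} {a : 𝔤}
    (ha : a ∈ Submodule.span ℂ {x | ∃ j, n j = i ∧ x = (u j : 𝔤)}) :
    ∃ v ∈ cocycleAlgebra t u A, (del ^ l) (Jext t a) - v ∈ filCharge t B r (-i) 0 := by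
  induction ha using Submodule.span_induction with
  | mem a ha =>
    obtain ⟨j, rfl, rfl⟩ := ha
    refine ⟨_, Algebra.subset_adjoin ⟨l, j, rfl⟩, ?_⟩
    rw [← map_sub, sub_add_cancel_left, map_neg]
    exact neg_mem (del_pow_mem_filCharge l (hA j))
  | zero => exact ⟨0, zero_mem _, by simp⟩
  | add a b _ _ iha ihb =>
    obtain ⟨v, hv, hv'⟩ := iha
    obtain ⟨w, hw, hw'⟩ := ihb
    refine ⟨v + w, add_mem hv hw, ?_⟩
    rw [map_add, map_add, add_sub_add_comm]
    exact add_mem hv' hw'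
  | smul c a _ iha =>
    obtain ⟨v, hv, hv'⟩ := iha
    refine ⟨c • v, Subalgebra.smul_mem _ hv c, ?_⟩
    rw [map_smul, map_smul, ← smul_sub]
    exact Submodule.smul_mem _ c hv'

/-- A weight-zero monomial is a product of derivatives of `J_a` with `a ∈ 𝔤_f`; replacing each
factor by its corrected version alters only lower degrees. -/
theorem IsSection.exists_sub_mem {x : S h} {p c : ℤ} {m : ℕ} (hx : IsGoodMonomial t B r x p c m)
    (hm : m = 0) : ∃ w ∈ cocycleAlgebra t u A, x - w ∈ filCharge t B r (p - 1) c := by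
  induction hx with
  | one => exact ⟨1, one_mem _, by simp⟩
  | @cons l g x p p' c c' m m' hg hx ih =>
    obtain ⟨w, hw, hxw⟩ := ih (by omega)
    obtain rfl : m = 0 := by omega
    have h1 : ∃ v ∈ cocycleAlgebra t u A, (del ^ l) g - v ∈ filCharge t B r (p - 1) c := by
      cases hg with
      | @cent i hi a ha hf =>
        have h2 := mem_span_of_mem_gr hn ha hf t
        have h3 := exists_sub_Jext_mem hA l h2
        exact ⟨h3.choose, h3.choose_spec.1, filCharge_mono (by omega) _ h3.choose_spec.2⟩
    obtain ⟨v, hv, hgv⟩ := h1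
    refine ⟨v * w, mul_mem hv hw, ?_⟩
    -- Every summand contains a difference of lower degree.
    have h3 : (del ^ l) g * x - v * w = ((del ^ l) g - v) * x + (del ^ l) g * (x - w)
        - ((del ^ l) g - v) * (x - w) := by noncomm_ring
    rw [h3]
    refine sub_mem (add_mem ?_ ?_) ?_
    · exact filCharge_mono (by omega) _ (mul_mem_filCharge hgv hx.mem)
    · exact filCharge_mono (by omega) _ (mul_mem_filCharge (hg.monomial l).mem hxw)
    · exact filCharge_mono (by omega) _ (mul_mem_filCharge hgv hxw)

include hd

/-- The homotopy sends a corrected element to charge `-1`, hence to zero, and `d` kills it too. `N`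
is a derivation commuting with `∂`, so it vanishes on the generated subalgebra. -/
theorem IsSection.laplacian_cocycle {x : S h} (hx : x ∈ cocycleAlgebra t u A) :
    laplacian t B k (r ∘ₗ η) x = 0 := by
  induction hx using Algebra.adjoin_induction with
  | mem x hx =>
    obtain ⟨m, i, rfl⟩ := hx
    have h1 := H.homotopy_mem (H.cocycle_mem hn hA i)
    rw [filCharge_eq_bot (Or.inr (by norm_num)), Submodule.mem_bot] at h1
    rw [laplacian_del_pow, laplacian_apply, hd, h1, map_zero, map_zero, add_zero, map_zero]
  | algebraMap c =>
    rw [Algebra.algebraMap_eq_smul_one, map_smul, laplacian_one, smul_zero]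
  | add x y _ _ hx hy => rw [map_add, hx, hy, add_zero]
  | mul x y _ _ hx hy => rw [laplacian_mul, hx, hy, zero_mul, mul_zero, add_zero]

/-- Every cocycle is cohomologous to an element of `cocycleAlgebra`. -/
theorem IsSection.exists_cohomologous {z : S h} (hz : z ∈ Sminus t) (hz' : d t B k z = 0) :
    ∃ g ∈ cocycleAlgebra t u A, ∃ w ∈ Sminus t, d t B k w = z - g := by
  have hW : ∀ x ∈ (cocycleAlgebra t u A).toSubmodule,
      laplacian t B k (r ∘ₗ η) x ∈ (cocycleAlgebra t u A).toSubmodule := fun x hx => by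
    rw [H.laplacian_cocycle hn hA hd hx]; exact zero_mem _
  have h1 : (Sminus t).toSubmodule ≤ invertedInto hW := by
    rw [H.Sminus_eq]
    refine Submodule.span_le.2 ?_
    rintro x ⟨p, c, m, hx⟩
    exact H.filCharge_le_invertedInto hW (fun x p hx => H.exists_sub_mem hn hA hx rfl) p hx.mem
  obtain ⟨R, hR, hg⟩ := h1 hz
  have hsz := H.homotopy_mem_Sminus hz
  -- Since `d z = 0`, `N z = d s z`, so with `Q = R.divX` one has `R(N) z = R(0) z + d (Q(N) s z)`.
  -- Dividing by `R(0)` gives both witnesses.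
  refine ⟨(R.coeff 0)⁻¹ • _, Subalgebra.smul_mem _ hg _, -((R.coeff 0)⁻¹ •
    aeval (laplacian t B k (r ∘ₗ η)) R.divX (homotopy t (r ∘ₗ η) z)),
    neg_mem (Subalgebra.smul_mem _ (aeval_mem (W := (Sminus t).toSubmodule)
      (fun x hx => H.laplacian_mem_Sminus hx) _ hsz) _), ?_⟩
  rw [map_neg, map_smul, H.d_aeval_laplacian _ hsz, aeval_apply_eq R, laplacian_apply z, hz',
    map_zero, add_zero, smul_add, smul_smul, inv_mul_cancel₀ hR, one_smul]
  abel

end generation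

end WAlg

/-! ### The proposition. -/

theorem mainTheorem2 {𝔤 : Type*} [LieRing 𝔤] [LieAlgebra ℂ 𝔤] [FiniteDimensional ℂ 𝔤]
    [LieAlgebra.IsSimple ℂ 𝔤] {h e f : 𝔤} (t : IsSl2Triple h e f)
    (B : LinearMap.BilinForm ℂ 𝔤) (hsymm : B.IsSymm) (hinv : B.lieInvariant 𝔤)
    (hef : B e f = 1) (hhh : B h h = 2) (k : ℂ)
    {I : Type*} (u : Module.Basis I ℂ (WAlg.centralizer f)) (n : I → ℤ)
    (hn : ∀ i, (u i : 𝔤) ∈ WAlg.gr h (n i)) :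
    ∃ A : I → WAlg.S h,
      (∀ i, A i ∈ WAlg.filtration t (-n i)) ∧ (∀ i, A i ∈ WAlg.chargePiece t 0) ∧
      ∃ hZ : ∀ i, WAlg.J t (u i : 𝔤) + A i ∈ WAlg.cocycles t B k,
        WAlg.DifferentiallyGenerates t B k
          (Set.range fun i => WAlg.toCohomology t B k ⟨WAlg.J t (u i : 𝔤) + A i, hZ i⟩) := by
  have hB : B.Nondegenerate := WAlg.form_nondegenerate hsymm hinv (e := e) (f := f) (by simp [hef])
  obtain ⟨r, hr, hr0⟩ := WAlg.exists_lie_f_section t hsymm hinv hB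
  obtain ⟨η, hη, hη'⟩ := WAlg.exists_formDual_section t hinv hB
  have H : WAlg.IsSection h f B r η := ⟨hinv, fun i hi y hy => (hr i hi y hy).1,
    fun i hi y hy => (hr i hi y hy).2, hr0, hη, hη'⟩
  have huf : ∀ i, ⁅f, (u i : 𝔤)⁆ = 0 := fun i => WAlg.mem_centralizer.1 (u i).2
  -- The centralizer of `f` has no part of positive eigenvalue, so `J` and `Jext` agree on it.
  have hn0 : ∀ i, n i ≤ 0 := fun i => by
    by_contra hi
    exact u.ne_zero i (Subtype.ext
      (WAlg.eq_zero_of_lie_f_eq_zero t (by omega) (hn i) (huf i)))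
  choose A hA hd using fun i => H.exists_cocycle (t := t) (k := k) (hn i) (huf i)
  have hJ : ∀ i, WAlg.J t (u i : 𝔤) = WAlg.Jext t (u i : 𝔤) := fun i =>
    (WAlg.Jext_of_nonpos (hn0 i) (hn i)).symm
  have hZ : ∀ i, WAlg.J t (u i : 𝔤) + A i ∈ WAlg.cocycles t B k := fun i =>
    ⟨by rw [hJ]; exact H.filCharge_le _ _ (H.cocycle_mem hn hA i), by rw [hJ]; exact hd i⟩
  refine ⟨A, fun i => H.mem_filtration (hA i), fun i => H.mem_chargePiece (hA i), hZ, ?_⟩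
  intro T hT hdel
  -- It remains to compare with `cocycleAlgebra`: its elements are cocycles, and their classes lie
  -- in every `∂`-stable subalgebra `T` containing the given classes.
  have hG : ∀ g ∈ WAlg.cocycleAlgebra t u A, ∃ hg : g ∈ WAlg.cocycles t B k,
      WAlg.toCohomology t B k ⟨g, hg⟩ ∈ T := by
    intro g hg
    induction hg using Algebra.adjoin_induction with
    | mem x hx =>
      obtain ⟨m, i, rfl⟩ := hx
      rw [← hJ]
      induction m with
      | zero => exact ⟨hZ i, hT ⟨i, rfl⟩⟩
      | succ m ih =>
        obtain ⟨hg, hg'⟩ := ih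
        rw [pow_succ', Module.End.mul_apply]
        exact ⟨(WAlg.delCocycles t B k ⟨_, hg⟩).2, hdel _ hg'⟩
    | algebraMap c =>
      exact ⟨Subalgebra.algebraMap_mem _ c,
        by
          have := Subalgebra.algebraMap_mem T c
          rw [← (WAlg.toCohomology t B k).commutes c] at this
          exact this⟩
    | add x y _ _ hx hy =>
      obtain ⟨hx, hx'⟩ := hx
      obtain ⟨hy, hy'⟩ := hy
      refine ⟨add_mem hx hy, ?_⟩
      have := add_mem hx' hy'
      rw [← map_add] at this
      exact this
    | mul x y _ _ hx hy =>
      obtain ⟨hx, hx'⟩ := hx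
      obtain ⟨hy, hy'⟩ := hy
      refine ⟨mul_mem hx hy, ?_⟩
      have := mul_mem hx' hy'
      rw [← map_mul] at this
      exact this
  rw [eq_top_iff]
  rintro z -
  obtain ⟨z, rfl⟩ : ∃ z', WAlg.toCohomology t B k z' = z := by
    obtain ⟨z'⟩ := z
    exact ⟨z', rfl⟩
  obtain ⟨g, hg, w, hw, hwz⟩ := H.exists_cohomologous hn hA hd z.2.1 z.2.2
  obtain ⟨hgc, hgT⟩ := hG g hg
  have : WAlg.toCohomology t B k z = WAlg.toCohomology t B k ⟨g, hgc⟩ := by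
    refine (RingCon.eq _).2 ?_
    rw [TwoSidedIdeal.rel_iff, WAlg.mem_boundaries]
    exact ⟨w, hw, hwz⟩
  rw [this]
  exact hgT
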